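/- **Conventions.** Let $\mathcal H^n$ be Hausdorff $n$-measure. A metric space $X$ is *Ahlfors $n$-regular* if there is $C\ge 1$ with $r^n/C\le \mathcal H^n(B(x,r))\le Cr^n$ for all $x\in X$ and $0<r<\operatorname{diam}X$. A *continuum* is a nonempty compact connected set. $X$ is *linearly locally connected* if there is $\lambda\ge 1$ such that for all $x\in X$, $r>0$, any two points of $B(x,r)$ lie in a continuum contained in $B(x,\lambda r)$, and any two points of $X\setminus B(x,r)$ lie in a continuum contained in $X\setminus B(x,r/\lambda)$. A *curve* is a continuous map of an interval into $X$. For a family $\Gamma$ of curves in $X$, $\operatorname{Mod}_3\Gamma=\inf\int_X\rho^3\,d\mathcal H^3$, the infimum being over all Borel $\rho\colon X\to[0,\infty]$ with $\int_\gamma\rho\,ds\ge 1$ for every locally rectifiable $\gamma\in\Gamma$. For $E,F\subset X$, $\Gamma_E$ is the family of nonconstant curves in $X$ meeting $E$, and $\Gamma(E,F)$ is the family of curves meeting both $E$ and $F$. **The space.** Let $f(t)=t^3/3$ and $Y_0=\{(t,y)\in\mathbb R^2: 0\le t<1,\ 0\le y\le f(t)\}$. Take two copies of $Y_0$, the top and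 the bottom one, and glue them along $\{(t,y)\in Y_0: y=0\text{ or }y=f(t)\}$. For all integers $m\ge1$ and odd $i$ with $1\le i<2^m$ put $t=i/2^m$ and $\ell=\min\{2^{-m},f(t)\}$. Cut the top copy along the slit $\{t\}\times[0,\ell]$, keeping the endpoints of the slit uncut; so each point $(t,s)$, $0<s<\ell$, is replaced by two points, one on the left and one on the right side of the slit. Let $S_i^m$ (a "pillowcase") be the double of the square $[0,2^{-m}]^2$ along its boundary, and cut it likewise along the slit $[0,\ell]\times\{0\}$ of its boundary edge, so that each point $(s,0)$, $0<s<\ell$, is replaced by two points, one on each face. Glue $S_i^m$ to the top copy by identifying, for $0\le s\le\ell$, the point $(t,s)$ on the left (right) side of the first slit with the point $(s,0)$ on the first (second) face of $S_i^m$. Let $Y$ be the resulting space, with the length metric $d_Y$ induced by the Euclidean metric on the pieces, and let $z\in Y$ be the cusp point $(0,0)$. Let $X=Y\times(-2,2)$ with the metric $d((y,s),(y',s'))=\sqrt{d_Y(y,y')^2+|s-s'|^2}$, and let $E=\{z\}\times[-1,1]$. **Theorem 1.1.** The space $Y$ is Ahlfors $2$-regular. The space $X$ is Ahlfors $3$-regular,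 linearly locally connected and homeomorphic to $\mathbb R^3$. The set $E$ is a continuum with more than one point, and $\operatorname{Mod}_3\Gamma_E=0$. Consequently $\operatorname{Mod}_3\Gamma(E,F)=0$ for every continuum $F\subset X$ disjoint from $E$. In particular, there is an Ahlfors $3$-regular, linearly locally connected metric space homeomorphic to $\mathbb R^3$ that contains a nondegenerate continuum $E$ with $\operatorname{Mod}_3\Gamma_E=0$, and then also $\operatorname{Mod}_3\Gamma(E,F)=0$ for every continuum $F$ disjoint from $E$. -/

import Mathlib

open MeasureTheory Set
open scoped ENNReal

noncomputable section

/-! # Modulus of curve families in metric spaces -/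

/-- A continuum: a compact connected (in particular nonempty) set. -/
def IsContinuumSet {X : Type*} [TopologicalSpace X] (K : Set X) : Prop :=
  IsCompact K ∧ IsConnected K

/-- A curve in `X`: a continuous map of a nonempty interval `domain` of the real line (open, closed
or half-open, bounded or not) into `X`. Only the values of `toFun` on `domain` matter. -/
structure MetricCurve (X : Type*) [TopologicalSpace X] where
  domain : Set ℝ
  toFun : ℝ → X
  nonempty : domain.Nonempty
  ordConnected : domain.OrdConnected
  continuousOn : ContinuousOn toFun domain

namespace MetricCurve

variable {X : Type*} [MetricSpace X]

/-- The curve intersects the set `A`. -/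
def Meets (γ : MetricCurve X) (A : Set X) : Prop := ∃ t ∈ γ.domain, γ.toFun t ∈ A

/-- The curve is not constant. -/
def IsNonconstant (γ : MetricCurve X) : Prop :=
  ∃ s ∈ γ.domain, ∃ t ∈ γ.domain, γ.toFun s ≠ γ.toFun t

/-- Every compact subcurve has finite length. -/
def IsLocallyRectifiable (γ : MetricCurve X) : Prop :=
  LocallyBoundedVariationOn γ.toFun γ.domain

/-- `∫_γ ρ ds`, for a locally rectifiable curve: the supremum over the compact subcurves
`γ|[a,b]` of `∫₀^ℓ ρ(γₛ(u)) du`, where `ℓ` is the length of `γ|[a,b]` and `γₛ : [0,ℓ] → X` its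
arc-length parametrization. -/
def lineIntegral (γ : MetricCurve X) (ρ : X → ℝ≥0∞) : ℝ≥0∞ :=
  ⨆ (a ∈ γ.domain) (b ∈ γ.domain) (_ : a ≤ b),
    ∫⁻ u in Icc 0 (eVariationOn γ.toFun (Icc a b)).toReal,
      ρ (naturalParameterization γ.toFun (Icc a b) a u)

end MetricCurve

/-- `ρ` is admissible for the curve family `Γ`. -/
def IsAdmissible {X : Type*} [MetricSpace X] [MeasurableSpace X]
    (Γ : Set (MetricCurve X)) (ρ : X → ℝ≥0∞) : Prop :=
  Measurable ρ ∧ ∀ γ ∈ Γ, γ.IsLocallyRectifiable → 1 ≤ γ.lineIntegral ρ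

/-- The `p`-modulus of a curve family with respect to the measure `μ`. -/
def curveModulus {X : Type*} [MetricSpace X] [MeasurableSpace X]
    (μ : Measure X) (p : ℝ) (Γ : Set (MetricCurve X)) : ℝ≥0∞ :=
  ⨅ (ρ : X → ℝ≥0∞) (_ : IsAdmissible Γ ρ), ∫⁻ x, ρ x ^ p ∂μ

/-- `Γ_E`: the nonconstant curves that intersect `E`. -/
def curvesMeeting {X : Type*} [MetricSpace X] (E : Set X) : Set (MetricCurve X) :=
  {γ | γ.IsNonconstant ∧ γ.Meets E}

/-- `Γ(E, F)`: the curves joining `E` to `F`, that is, intersecting both. -/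
def curvesJoining {X : Type*} [MetricSpace X] (E F : Set X) : Set (MetricCurve X) :=
  {γ | γ.Meets E ∧ γ.Meets F}

/-- Ahlfors `n`-regularity with respect to the Hausdorff `n`-measure. (Mathlib's Hausdorff measure
differs from other normalizations by a positive constant factor, which is absorbed by `C`.) -/
def IsAhlforsRegular (n : ℝ) (X : Type*) [MetricSpace X] [MeasurableSpace X] [BorelSpace X] :
    Prop :=
  ∃ C : ℝ, 1 ≤ C ∧ ∀ (x : X) (r : ℝ), 0 < r →
    ENNReal.ofReal r < Metric.ediam (univ : Set X) →
      ENNReal.ofReal (r ^ n / C) ≤ Measure.hausdorffMeasure n (Metric.ball x r) ∧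
      Measure.hausdorffMeasure n (Metric.ball x r) ≤ ENNReal.ofReal (C * r ^ n)

/-- Linear local connectivity. -/
def IsLinearlyLocallyConnected (X : Type*) [MetricSpace X] : Prop :=
  ∃ l : ℝ, 1 ≤ l ∧ ∀ (x : X) (r : ℝ), 0 < r →
    (∀ y ∈ Metric.ball x r, ∀ z ∈ Metric.ball x r,
      ∃ K : Set X, IsContinuumSet K ∧ K ⊆ Metric.ball x (l * r) ∧ y ∈ K ∧ z ∈ K) ∧
    (∀ y ∈ (Metric.ball x r)ᶜ, ∀ z ∈ (Metric.ball x r)ᶜ,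
      ∃ K : Set X, IsContinuumSet K ∧ K ⊆ (Metric.ball x (r / l))ᶜ ∧ y ∈ K ∧ z ∈ K)

/-! # The cusped surface with pillowcases -/

namespace CuspExample

/-- The Euclidean plane, with coordinates `p 0` and `p 1`. -/
abbrev Plane : Type := EuclideanSpace ℝ (Fin 2)

/-- The profile `f(t) = t³/3` of the cusp. -/
def profile (t : ℝ) : ℝ := t ^ 3 / 3

/-- The planar region `Y₀ = {(t, y) : 0 ≤ t < 1, 0 ≤ y ≤ f(t)}`. -/
def region : Set Plane := {p | 0 ≤ p 0 ∧ p 0 < 1 ∧ 0 ≤ p 1 ∧ p 1 ≤ profile (p 0)}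

/-- The dyadic rationals `i / 2^m` in `(0, 1)`, in lowest terms. -/
structure Dyadic : Type where
  m : ℕ
  i : ℕ
  one_le : 1 ≤ m
  lt_pow : i < 2 ^ m
  odd : Odd i

namespace Dyadic

/-- The dyadic rational `i / 2^m`. -/
def pos (d : Dyadic) : ℝ := d.i / 2 ^ d.m

/-- The side length `2^{-m}` of the pillowcase. -/
def side (d : Dyadic) : ℝ := 1 / 2 ^ d.m

/-- The length `min {2^{-m}, f(i / 2^m)}` of the slit. -/
def slitLength (d : Dyadic) : ℝ := min d.side (profile d.pos)

/-- The slit `I = {i / 2^m} × [0, min {2^{-m}, f(i / 2^m)}]` in `Y₀`. -/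
def slit (d : Dyadic) : Set Plane := {p | p 0 = d.pos ∧ 0 ≤ p 1 ∧ p 1 ≤ d.slitLength}

/-- The square `[0, 2^{-m}]²`. The pillowcase is its double. The slit in the pillowcase is
`J = [0, min {2^{-m}, f(i / 2^m)}] × {0}`, on the common boundary of the two faces. -/
def square (d : Dyadic) : Set Plane :=
  {q | (0 ≤ q 0 ∧ q 0 ≤ d.side) ∧ (0 ≤ q 1 ∧ q 1 ≤ d.side)}

end Dyadic

/-- The pieces from which the surface is glued, as a disjoint union.
* `front b p`: the point `p` of the top copy of `Y₀`. If `p` lies on a slit, then `b = false` and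
  `b = true` stand for the left and the right side of the slit at `p`; if `p` does not lie on a
  slit, the two will be identified.
* `back p`: the point `p` of the bottom copy of `Y₀`.
* `pillow d b q`: the point `q` of the face number `b` of the pillowcase belonging to `d`. -/
inductive Piece : Type where
  | front (b : Bool) (p : region) : Piece
  | back (p : region) : Piece
  | pillow (d : Dyadic) (b : Bool) (q : d.square) : Piece

/-- The identifications.
* `unslit`: off the slits, the top copy of `Y₀` is not cut.
* `seam`: the top and the bottom copy of `Y₀` are glued along the manifold boundary
  `{y = 0} ∪ {y = f(t)}` of `Y₀`.
* `slit`: the left (right) side of the slit `I` is glued to the slit `J` as seen from the first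
  (second) face of the pillowcase; the point at distance `s` from the lower endpoint of `I`
  corresponds to `(s, 0)`.
* `edge`: the two faces of a pillowcase are glued along the boundary of the square, except for
  the interior points of the slit `J`. -/
inductive Glue : Piece → Piece → Prop where
  | unslit (p : region) (hp : ∀ d : Dyadic, p.1 ∉ d.slit) :
      Glue (.front false p) (.front true p)
  | seam (b : Bool) (p : region) (hp : p.1 1 = 0 ∨ p.1 1 = profile (p.1 0)) :
      Glue (.front b p) (.back p)
  | slit (b : Bool) (d : Dyadic) (p : region) (q : d.square) (hp : p.1 ∈ d.slit)
      (h0 : q.1 0 = p.1 1) (h1 : q.1 1 = 0) :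
      Glue (.front b p) (.pillow d b q)
  | edge (d : Dyadic) (q : d.square)
      (hq : q.1 0 = 0 ∨ q.1 0 = d.side ∨ q.1 1 = 0 ∨ q.1 1 = d.side)
      (hJ : ¬ (q.1 1 = 0 ∧ 0 < q.1 0 ∧ q.1 0 < d.slitLength)) :
      Glue (.pillow d false q) (.pillow d true q)

/-- `Seg x y L`: the points `x` and `y` are joined by a straight line segment of Euclidean length
`L` within a single piece. In the top copy of `Y₀`, such a segment may not cross a slit: a
non-vertical one leaves its left endpoint to the right, arrives at its right endpoint from the left
and meets no slit in between; a vertical one stays on the same side. -/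
inductive Seg : Piece → Piece → ℝ → Prop where
  | frontTransverse (p q : region) (hpq : p.1 0 < q.1 0) (hseg : segment ℝ p.1 q.1 ⊆ region)
      (hslit : ∀ z ∈ openSegment ℝ p.1 q.1, ∀ d : Dyadic, z ∉ d.slit) :
      Seg (.front true p) (.front false q) (dist p.1 q.1)
  | frontVertical (b : Bool) (p q : region) (hpq : p.1 0 = q.1 0) :
      Seg (.front b p) (.front b q) (dist p.1 q.1)
  | back (p q : region) (hseg : segment ℝ p.1 q.1 ⊆ region) :
      Seg (.back p) (.back q) (dist p.1 q.1)
  | pillow (d : Dyadic) (b : Bool) (q q' : d.square) :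
      Seg (.pillow d b q) (.pillow d b q') (dist q.1 q'.1)

/-- `PolyPath x y L`: the points `x` and `y` are joined by a polygonal path of total length `L` in
the glued surface: finitely many straight segments, each within one piece, and identifications. -/
inductive PolyPath : Piece → Piece → ℝ → Prop where
  | refl (x : Piece) : PolyPath x x 0
  | glue {x y z : Piece} {L : ℝ} (h : Glue x y ∨ Glue y x) (hL : PolyPath y z L) : PolyPath x z L
  | seg {x y z : Piece} {K L : ℝ} (h : Seg x y K ∨ Seg y x K) (hL : PolyPath y z L) :
      PolyPath x z (K + L)

theorem Seg.nonneg {x y : Piece} {L : ℝ} (h : Seg x y L) : 0 ≤ L := by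
  cases h <;> exact dist_nonneg

theorem PolyPath.nonneg {x y : Piece} {L : ℝ} (h : PolyPath x y L) : 0 ≤ L := by
  induction h with
  | refl => exact le_rfl
  | glue _ _ ih => exact ih
  | seg h _ ih => exact add_nonneg (h.elim Seg.nonneg Seg.nonneg) ih

theorem PolyPath.trans {x y z : Piece} {K L : ℝ} (h : PolyPath x y K) (h' : PolyPath y z L) :
    PolyPath x z (K + L) := by
  induction h with
  | refl => simpa using h'
  | glue hg _ ih => exact .glue hg (ih h')
  | seg hs _ ih => rw [add_assoc]; exact .seg hs (ih h')

theorem PolyPath.symm {x y : Piece} {L : ℝ} (h : PolyPath x y L) : PolyPath y x L := by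
  induction h with
  | refl => exact .refl _
  | glue hg _ ih => simpa using ih.trans (.glue hg.symm (.refl _))
  | seg hs _ ih =>
    have := ih.trans (.seg hs.symm (.refl _))
    rwa [add_zero, add_comm] at this

theorem Dyadic.pos_nonneg (d : Dyadic) : 0 ≤ d.pos := by
  unfold Dyadic.pos; positivity

theorem Dyadic.pos_lt_one (d : Dyadic) : d.pos < 1 := by
  unfold Dyadic.pos
  rw [div_lt_one (by positivity)]
  exact_mod_cast d.lt_pow

theorem Dyadic.side_nonneg (d : Dyadic) : 0 ≤ d.side := by
  unfold Dyadic.side; positivity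

theorem profile_nonneg {t : ℝ} (ht : 0 ≤ t) : 0 ≤ profile t := by
  unfold profile; positivity

theorem floor_mem {t : ℝ} (h0 : 0 ≤ t) (h1 : t < 1) : !₂[t, (0 : ℝ)] ∈ region := by
  simp [region, h0, h1, profile_nonneg h0]

/-- The tip `(0, 0)` of the cusp, as a point of `Y₀`. -/
def tip : region := ⟨!₂[0, 0], floor_mem le_rfl one_pos⟩

theorem polyPath_floor (b : Bool) {t : ℝ} (h0 : 0 ≤ t) (h1 : t < 1) :
    ∃ L, PolyPath (.front b ⟨_, floor_mem h0 h1⟩) (.back tip) L := by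
  refine ⟨_, .glue (.inl (.seam b _ (.inl (by simp)))) (.seg (.inl (.back _ _ ?_)) (.refl _))⟩
  rintro z ⟨u, v, hu, hv, huv, rfl⟩
  have h2 : u * t < 1 := by nlinarith
  simp [region, tip, h2, mul_nonneg hu h0, profile_nonneg (mul_nonneg hu h0)]

theorem polyPath_front (b : Bool) (p : region) : ∃ L, PolyPath (.front b p) (.back tip) L := by
  obtain ⟨L, hL⟩ := polyPath_floor b p.2.1 p.2.2.1
  exact ⟨_, .seg (.inl (.frontVertical b p _ (by simp))) hL⟩

theorem polyPath_tip (x : Piece) : ∃ L, PolyPath x (.back tip) L := by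
  cases x with
  | front b p => exact polyPath_front b p
  | back p =>
    obtain ⟨L, hL⟩ := polyPath_floor false p.2.1 p.2.2.1
    refine ⟨_, .seg (.inl (.back p ⟨_, floor_mem p.2.1 p.2.2.1⟩ ?_))
      (.glue (.inr (.seam false _ (.inl (by simp)))) hL)⟩
    rintro z ⟨u, v, hu, hv, huv, rfl⟩
    have e : u * p.1 0 + v * p.1 0 = p.1 0 := by rw [← add_mul, huv, one_mul]
    have h3 : u * p.1 1 ≤ p.1 1 := mul_le_of_le_one_left p.2.2.2.1 (by linarith)
    simp only [region, mem_ofPred_eq, PiLp.add_apply, PiLp.smul_apply, smul_eq_mul,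
      Matrix.cons_val_zero, Matrix.cons_val_one, e]
    exact ⟨p.2.1, p.2.2.1, by simpa using mul_nonneg hu p.2.2.2.1,
      by simpa using h3.trans p.2.2.2.2⟩
  | pillow d b q =>
    obtain ⟨L, hL⟩ := polyPath_floor b d.pos_nonneg d.pos_lt_one
    refine ⟨_, .seg (.inl (.pillow d b q ⟨!₂[0, 0], ?_⟩)) (.glue (.inr (.slit b d _ _ ?_ ?_ ?_)) hL)⟩
    · simp [Dyadic.square, d.side_nonneg]
    · simp [Dyadic.slit, Dyadic.slitLength, d.side_nonneg, profile_nonneg d.pos_nonneg]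
    · simp
    · simp

theorem exists_polyPath (x y : Piece) : {L | PolyPath x y L}.Nonempty := by
  obtain ⟨K, hK⟩ := polyPath_tip x
  obtain ⟨L, hL⟩ := polyPath_tip y
  exact ⟨_, hK.trans hL.symm⟩

theorem bddBelow_polyPath (x y : Piece) : BddBelow {L | PolyPath x y L} :=
  ⟨0, fun _ h => h.nonneg⟩

/-- The length (pseudo)metric: the infimum of the lengths of the polygonal paths. -/
instance : PseudoMetricSpace Piece where
  dist x y := sInf {L | PolyPath x y L}
  dist_self x := le_antisymm (csInf_le (bddBelow_polyPath x x) (.refl x))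
    (Real.sInf_nonneg fun _ h => h.nonneg)
  dist_comm x y := by
    congr 1
    ext L
    exact ⟨PolyPath.symm, PolyPath.symm⟩
  dist_triangle x y z := by
    refine le_of_forall_pos_le_add fun ε hε => ?_
    obtain ⟨K, hK, hK'⟩ := exists_lt_of_csInf_lt (exists_polyPath x y)
      (lt_add_of_pos_right _ (half_pos hε))
    obtain ⟨L, hL, hL'⟩ := exists_lt_of_csInf_lt (exists_polyPath y z)
      (lt_add_of_pos_right _ (half_pos hε))
    have := csInf_le (bddBelow_polyPath x z) (PolyPath.trans hK hL)
    linarith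

/-- The surface `Y`: the glued space with its length metric `d_Y`. -/
def Surface : Type := SeparationQuotient Piece

instance : MetricSpace Surface := inferInstanceAs (MetricSpace (SeparationQuotient Piece))
instance : MeasurableSpace Surface := borel Surface
instance : BorelSpace Surface := ⟨rfl⟩

/-- The cusp point of `Y`. -/
def cusp : Surface := SeparationQuotient.mk (.back tip)

/-- The space `X = Y × (-2, 2)` with the Euclidean product metric. -/
def Space : Type := WithLp 2 (Surface × Ioo (-2 : ℝ) 2)

instance : MetricSpace Space := inferInstanceAs (MetricSpace (WithLp 2 (Surface × Ioo (-2 : ℝ) 2)))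
instance : MeasurableSpace Space := borel Space
instance : BorelSpace Space := ⟨rfl⟩

/-- The set `E = {cusp} × [-1, 1]` in `X`. -/
def cuspSet : Set Space :=
  {x : WithLp 2 (Surface × Ioo (-2 : ℝ) 2) | x.fst = cusp ∧ (x.snd : ℝ) ∈ Icc (-1 : ℝ) 1}

end CuspExample

end

/-!
# A cusped surface with pillowcases, and a continuum of vanishing modulus

*Modulus.* Let `t` be the first coordinate on the surface `Y`, each pillowcase being collapsed to
its position. The cusp is so thin that the shell `2⁻ᵏ⁻¹ < t ≤ 2⁻ᵏ`, without the pillowcases, has area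
of order `2⁻ᵏ f(2⁻ᵏ) ~ 16⁻ᵏ`. The test function `ρ = 1 / t`, set to zero on the pillowcases, therefore
has `∫ ρ³ < ∞` (`lintegral_testFunction_ne_top`), while `∫ ρ ds = ∞` along every nonconstant
rectifiable curve through `E`: such a curve either stays over `t = 0`, where `ρ = ∞`, or, since `t` is
`1`-Lipschitz, its integral dominates the divergent integral of `1 / t` over an interval `(0, t₁]`;
the zeros of `ρ` do not matter there, as the positions of the pillowcases are countable
(`lintegral_reciprocalWeight_comp`). All positive multiples of `ρ` are thus admissible, and the
modulus is zero.

*Regularity.* The upper bound for the area of a ball of radius `r` comes from charts that are locally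
Lipschitz (`Surface.locally_lipschitz_front`) and from a sum of `min side r ^ 2` over the pillowcases
that the ball can meet, which is controlled by disjoint planar boxes (`tsum_min_side_sq_le`). The
lower bound holds at the cusp only thanks to the pillowcases: every ball is mapped by a `1`-Lipschitz
map of the surface to the plane onto a set that contains a square of comparable size
(`capturesSquare_ball`), either by folding the surface onto `Y₀` or by retracting it onto a
pillowcase, and near each point of the floor there are pillowcases of every size. Products with an
interval give the bounds for `X` (`hausdorffMeasure_product_le`, `Space.le_hausdorffMeasure_ball`).

*Topology.* Each pillowcase, cut open along its slit, is a disc, and is mapped to a thin lens; the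
slits are widened so that the lenses fit in. A point is shifted to the right by the total width of the
lenses on its left, in the coordinate `1 / (1 - t)`, in which there is room at the open end. The
resulting coordinates are Lipschitz, they separate points (`dist_eq_zero_of_coords`) and are all
attained (`exists_top`, `exists_back`), which yields a continuous bijection of `Y` onto the double of
`Y₀`, hence onto the plane. Its inverse is continuous because the parts `t ≤ a < 1` of the surface are
compact (`Surface.homeomorphPlane`).

*Linear local connectivity* holds for a product with an interval as soon as the first factor is a
bounded length space that is not too small: two points far from `x` are joined through a slice
`Y × {s}` far from `x`.
-/

noncomputable section

namespace CuspExample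

open Filter Topology
open scoped NNReal

/-! ### The profile, the dyadic positions and the region -/

theorem abs_coord_sub_le (p q : Plane) (i : Fin 2) : |p i - q i| ≤ dist p q := by
  rw [EuclideanSpace.dist_eq]
  refine Real.abs_le_sqrt ?_
  rw [← sq_abs, ← Real.dist_eq]
  exact Finset.single_le_sum (f := fun j => dist (p j) (q j) ^ 2) (fun j _ => by positivity)
    (Finset.mem_univ i)

theorem plane_dist_le (p q : Plane) : dist p q ≤ |p 0 - q 0| + |p 1 - q 1| := by
  rw [EuclideanSpace.dist_eq, Fin.sum_univ_two, Real.dist_eq, Real.dist_eq]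
  refine Real.sqrt_le_iff.2 ⟨by positivity, ?_⟩
  nlinarith [abs_nonneg (p 0 - q 0), abs_nonneg (p 1 - q 1)]

theorem profile_strictMono : StrictMono profile := fun _ _ h =>
  div_lt_div_of_pos_right ((Odd.strictMono_pow (by decide : Odd 3)) h) (by norm_num)

theorem profile_mono : Monotone profile := profile_strictMono.monotone

theorem profile_zero : profile 0 = 0 := by simp [profile]

theorem profile_pos {t : ℝ} (ht : 0 < t) : 0 < profile t := by unfold profile; positivity

theorem continuous_profile : Continuous profile := by unfold profile; fun_prop

theorem abs_profile_sub_le {s t : ℝ} (hs : s ∈ Icc (0 : ℝ) 1) (ht : t ∈ Icc (0 : ℝ) 1) :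
    |profile s - profile t| ≤ |s - t| := by
  have h : profile s - profile t = (s - t) * ((s ^ 2 + s * t + t ^ 2) / 3) := by
    unfold profile; ring
  rw [h, abs_mul]
  refine mul_le_of_le_one_right (abs_nonneg _) ?_
  obtain ⟨hs0, hs1⟩ := hs
  obtain ⟨ht0, ht1⟩ := ht
  rw [abs_of_nonneg (by positivity)]
  nlinarith [mul_nonneg hs0 ht0]

theorem profile_le_self {t : ℝ} (h0 : 0 ≤ t) (h1 : t ≤ 1) : profile t ≤ t := by
  have := abs_profile_sub_le (s := t) (t := 0) ⟨h0, h1⟩ (by simp)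
  rw [profile_zero, sub_zero, sub_zero, abs_of_nonneg h0] at this
  exact (le_abs_self _).trans this

theorem profile_le_third {t : ℝ} (h0 : 0 ≤ t) (h1 : t ≤ 1) : profile t ≤ 1 / 3 := by
  unfold profile
  have : t ^ 3 ≤ 1 := pow_le_one₀ h0 h1
  linarith

namespace Dyadic

theorem side_pos (d : Dyadic) : 0 < d.side := by unfold side; positivity

theorem side_le_half (d : Dyadic) : d.side ≤ 1 / 2 := by
  unfold side
  have : (2 : ℝ) ^ 1 ≤ 2 ^ d.m := pow_le_pow_right₀ (by norm_num) d.one_le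
  exact one_div_le_one_div_of_le (by norm_num) (by simpa using this)

theorem side_le_pos (d : Dyadic) : d.side ≤ d.pos := by
  unfold side pos
  have : (1 : ℝ) ≤ d.i := by exact_mod_cast d.odd.pos
  gcongr

theorem pos_pos (d : Dyadic) : 0 < d.pos := d.side_pos.trans_le d.side_le_pos

theorem slitLength_pos (d : Dyadic) : 0 < d.slitLength := lt_min d.side_pos (profile_pos d.pos_pos)

theorem slitLength_le_side (d : Dyadic) : d.slitLength ≤ d.side := min_le_left _ _

theorem slitLength_le_profile (d : Dyadic) : d.slitLength ≤ profile d.pos := min_le_right _ _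

theorem ext' {d e : Dyadic} (hm : d.m = e.m) (hi : d.i = e.i) : d = e := by
  cases d; cases e; simp_all

instance : Countable Dyadic :=
  (show Function.Injective fun d : Dyadic => (d.m, d.i) from fun _ _ h =>
    ext' (Prod.ext_iff.1 h).1 (Prod.ext_iff.1 h).2).countable

theorem eq_of_pos_eq_of_le {d e : Dyadic} (h : d.pos = e.pos) (hm : d.m ≤ e.m) : d = e := by
  obtain ⟨k, hk⟩ := Nat.exists_eq_add_of_le hm
  unfold pos at h
  rw [div_eq_div_iff (by positivity) (by positivity), hk, pow_add] at h
  have h2 : d.i * 2 ^ k = e.i := by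
    have : (d.i * 2 ^ k : ℝ) = e.i :=
      mul_right_cancel₀ (b := (2 : ℝ) ^ d.m) (by positivity) (by linarith)
    exact_mod_cast this
  rcases Nat.eq_zero_or_pos k with rfl | hk0
  · exact ext' (by omega) (by simpa using h2)
  · exfalso
    have := e.odd
    rw [← h2] at this
    exact (Nat.not_odd_iff_even.2 ((Nat.even_pow.2 ⟨even_two, hk0.ne'⟩).mul_left d.i)) this

theorem pos_injective : Function.Injective pos := fun d e h => by
  rcases le_total d.m e.m with hm | hm
  · exact eq_of_pos_eq_of_le h hm
  · exact (eq_of_pos_eq_of_le h.symm hm).symm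

theorem side_le_abs_of_le {d e : Dyadic} (hne : d ≠ e) (hm : d.m ≤ e.m) :
    e.side ≤ |d.pos - e.pos| := by
  obtain ⟨k, hk⟩ := Nat.exists_eq_add_of_le hm
  have h0 : d.pos - e.pos ≠ 0 := sub_ne_zero.2 fun h => hne (pos_injective h)
  have h1 : d.pos - e.pos = ((d.i * 2 ^ k - e.i : ℤ) : ℝ) / 2 ^ e.m := by
    unfold pos; rw [hk, pow_add]; push_cast; field_simp
  rw [h1] at h0 ⊢
  have h2 : ((d.i * 2 ^ k - e.i : ℤ) : ℝ) ≠ 0 := fun h => h0 (by rw [h, zero_div])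
  rw [abs_div, abs_of_pos (by positivity : (0 : ℝ) < 2 ^ e.m)]
  unfold side
  have h3 : (1 : ℝ) ≤ |((d.i * 2 ^ k - e.i : ℤ) : ℝ)| := by
    exact_mod_cast Int.one_le_abs (by exact_mod_cast h2)
  gcongr

/-- Distinct dyadic positions are separated by the smaller of their side lengths. -/
theorem min_side_le_abs {d e : Dyadic} (hne : d ≠ e) : min d.side e.side ≤ |d.pos - e.pos| := by
  rcases le_total d.m e.m with hm | hm
  · exact (min_le_right _ _).trans (side_le_abs_of_le hne hm)
  · rw [abs_sub_comm]; exact (min_le_left _ _).trans (side_le_abs_of_le hne.symm hm)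

/-- There are only finitely many dyadic positions with side length bounded from below. -/
theorem finite_le_side {ε : ℝ} (hε : 0 < ε) : {d : Dyadic | ε ≤ d.side}.Finite := by
  obtain ⟨n, hn⟩ := exists_pow_lt_of_lt_one hε (by norm_num : (1 / 2 : ℝ) < 1)
  refine Finite.of_finite_image (f := fun d : Dyadic => (d.m, d.i))
    (((finite_Iio n).prod (finite_Iio (2 ^ n))).subset ?_) fun d _ e _ h =>
      ext' (Prod.ext_iff.1 h).1 (Prod.ext_iff.1 h).2
  rintro _ ⟨d, hd, rfl⟩
  have hd : ε ≤ d.side := hd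
  have h1 : d.m < n := by
    by_contra hcon
    have : d.side ≤ (1 / 2) ^ n := by
      unfold side
      rw [one_div_pow]
      exact one_div_le_one_div_of_le (by positivity)
        (pow_le_pow_right₀ (by norm_num) (not_lt.1 hcon))
    linarith
  exact ⟨h1, d.lt_pow.trans (Nat.pow_lt_pow_right (by norm_num) h1)⟩

/-- Every point of `[0, 1)` is close, at every scale, to a dyadic position of that scale. -/
theorem exists_near {t ρ : ℝ} (h0 : 0 ≤ t) (h1 : t < 1) (hρ : 0 < ρ) (hρ1 : ρ ≤ 1) :
    ∃ d : Dyadic, |d.pos - t| ≤ d.side ∧ ρ / 4 ≤ d.side ∧ d.side ≤ ρ := by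
  obtain ⟨n, hn, hn'⟩ := exists_nat_pow_near_of_lt_one hρ hρ1 (by norm_num : (0 : ℝ) < 1 / 2)
    (by norm_num)
  have hpos : (0 : ℝ) < 2 ^ n := by positivity
  set k := ⌊t * 2 ^ n⌋₊ with hk
  have hk1 : (k : ℝ) ≤ t * 2 ^ n := Nat.floor_le (by positivity)
  have hk2 : t * 2 ^ n < k + 1 := Nat.lt_floor_add_one _
  have hk3 : k < 2 ^ n := by
    have : (k : ℝ) < 2 ^ n := hk1.trans_lt (by nlinarith)
    exact_mod_cast this
  have hpw : ((1 : ℝ) / 2) ^ n = 1 / 2 ^ n := one_div_pow _ _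
  refine ⟨⟨n + 1, 2 * k + 1, by omega, by rw [pow_succ]; omega, ⟨k, rfl⟩⟩, ?_, ?_, ?_⟩
  · unfold pos side
    have e : ((2 * k + 1 : ℕ) : ℝ) / 2 ^ (n + 1) - t
        = ((2 * k + 1) - 2 * (t * 2 ^ n)) / 2 ^ (n + 1) := by
      rw [pow_succ]; push_cast; field_simp
    simp only [e, abs_div]
    rw [abs_of_pos (by positivity : (0 : ℝ) < 2 ^ (n + 1))]
    gcongr
    rw [abs_le]; constructor <;> linarith
  · unfold side
    simp only [pow_succ]
    rw [hpw] at hn'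
    have : (1 : ℝ) / (2 ^ n * 2) = 1 / 2 ^ n / 2 := by field_simp
    linarith
  · unfold side
    simp only [pow_succ]
    rw [pow_succ, hpw] at hn
    have : (1 : ℝ) / (2 ^ n * 2) = 1 / 2 ^ n / 2 := by field_simp
    linarith

end Dyadic

theorem pt_mem {t y : ℝ} (h0 : 0 ≤ t) (h1 : t < 1) (hy : 0 ≤ y) (hy' : y ≤ profile t) :
    (!₂[t, y] : Plane) ∈ region := by
  simp [region, h0, h1, hy, hy']

theorem base_nonneg (p : region) : 0 ≤ p.1 0 := p.2.1
theorem base_lt_one (p : region) : p.1 0 < 1 := p.2.2.1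
theorem height_nonneg (p : region) : 0 ≤ p.1 1 := p.2.2.2.1
theorem height_le_profile (p : region) : p.1 1 ≤ profile (p.1 0) := p.2.2.2.2

theorem height_le_third (p : region) : p.1 1 ≤ 1 / 3 :=
  (height_le_profile p).trans (profile_le_third (base_nonneg p) (base_lt_one p).le)

theorem region_ext {p q : region} (h0 : p.1 0 = q.1 0) (h1 : p.1 1 = q.1 1) : p = q := by
  ext i; fin_cases i
  · exact h0
  · exact h1

theorem square_ext {d : Dyadic} {p q : d.square} (h0 : p.1 0 = q.1 0) (h1 : p.1 1 = q.1 1) :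
    p = q := by
  ext i; fin_cases i
  · exact h0
  · exact h1

/-- The projection of a point of `Y₀` to the floor `y = 0`. -/
def floorPt (p : region) : region := ⟨!₂[p.1 0, 0], floor_mem p.2.1 p.2.2.1⟩

@[simp] theorem floorPt_zero (p : region) : (floorPt p).1 0 = p.1 0 := by simp [floorPt]
@[simp] theorem floorPt_one (p : region) : (floorPt p).1 1 = 0 := by simp [floorPt]

/-- The lower endpoint of a slit. -/
def Dyadic.foot (d : Dyadic) : region := ⟨!₂[d.pos, 0], floor_mem d.pos_nonneg d.pos_lt_one⟩

@[simp] theorem Dyadic.foot_zero (d : Dyadic) : d.foot.1 0 = d.pos := by simp [foot]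
@[simp] theorem Dyadic.foot_one (d : Dyadic) : d.foot.1 1 = 0 := by simp [foot]

/-- The point of a square corresponding to the lower endpoint of the slit. -/
def Dyadic.origin (d : Dyadic) : d.square := ⟨!₂[0, 0], by simp [square, d.side_nonneg]⟩

@[simp] theorem Dyadic.origin_zero (d : Dyadic) : d.origin.1 0 = 0 := by simp [origin]
@[simp] theorem Dyadic.origin_one (d : Dyadic) : d.origin.1 1 = 0 := by simp [origin]

/-! ### Upper bounds for the distance -/

theorem PolyPath.dist_le {x y : Piece} {L : ℝ} (h : PolyPath x y L) : dist x y ≤ L :=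
  csInf_le (bddBelow_polyPath x y) h

theorem Seg.dist_le {x y : Piece} {L : ℝ} (h : Seg x y L) : dist x y ≤ L := by
  simpa using (PolyPath.seg (.inl h) (.refl y)).dist_le

theorem Glue.dist_eq {x y : Piece} (h : Glue x y) : dist x y = 0 :=
  le_antisymm (PolyPath.glue (.inl h) (.refl y)).dist_le dist_nonneg

theorem exists_polyPath_lt {x y : Piece} {r : ℝ} (h : dist x y < r) :
    ∃ L, PolyPath x y L ∧ L < r :=
  exists_lt_of_csInf_lt (exists_polyPath x y) h

/-- A function that respects the identifications and is `K`-Lipschitz along segments is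
`K`-Lipschitz for the length metric. -/
theorem abs_sub_le_mul_dist {h : Piece → ℝ} {K : ℝ} (hg : ∀ x y, Glue x y → h x = h y)
    (hs : ∀ x y L, Seg x y L → |h x - h y| ≤ K * L) (hK : 0 ≤ K) (x y : Piece) :
    |h x - h y| ≤ K * dist x y := by
  have key : ∀ {x y L}, PolyPath x y L → |h x - h y| ≤ K * L := by
    intro x y L hL
    induction hL with
    | refl => simp
    | glue h' _ ih =>
      rcases h' with h' | h'
      · rwa [hg _ _ h']
      · rwa [← hg _ _ h']
    | @seg x y z K' L' h' _ ih =>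
      have h1 : |h x - h y| ≤ K * K' := by
        rcases h' with h' | h'
        · exact hs _ _ _ h'
        · rw [abs_sub_comm]; exact hs _ _ _ h'
      calc |h x - h z| ≤ |h x - h y| + |h y - h z| := abs_sub_le _ _ _
        _ ≤ K * (K' + L') := by rw [mul_add]; exact add_le_add h1 ih
  refine le_of_forall_pos_le_add fun ε hε => ?_
  obtain ⟨L, hL, hL'⟩ := exists_polyPath_lt
    (lt_add_of_pos_right (dist x y) (div_pos hε (by linarith : 0 < K + 1)))
  refine (key hL).trans ?_
  have : K * (ε / (K + 1)) ≤ ε := by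
    rw [mul_div_assoc', div_le_iff₀ (by linarith)]; nlinarith
  nlinarith

theorem dist_front_vertical_le (b : Bool) {p q : region} (h : p.1 0 = q.1 0) :
    dist (Piece.front b p) (Piece.front b q) ≤ |p.1 1 - q.1 1| := by
  refine (Seg.frontVertical b p q h).dist_le.trans ((plane_dist_le _ _).trans ?_)
  simp [h]

theorem dist_front_floor (b : Bool) (p : region) :
    dist (Piece.front b p) (.back (floorPt p)) ≤ p.1 1 := by
  have h1 := dist_front_vertical_le b (p := p) (q := floorPt p) (by simp)
  have h2 := (Glue.seam b (floorPt p) (.inl (by simp))).dist_eq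
  have h3 := dist_triangle (Piece.front b p) (.front b (floorPt p)) (.back (floorPt p))
  simp only [floorPt_one, sub_zero, abs_of_nonneg (height_nonneg p)] at h1
  linarith

theorem mem_segment_coord {p q z : Plane} (hz : z ∈ segment ℝ p q) :
    ∃ u : ℝ, 0 ≤ u ∧ u ≤ 1 ∧ ∀ i, z i = p i + u * (q i - p i) := by
  rw [segment_eq_image'] at hz
  obtain ⟨u, hu, rfl⟩ := hz
  exact ⟨u, hu.1, hu.2, fun i => by simp⟩

theorem mem_openSegment_coord {p q z : Plane} (hz : z ∈ openSegment ℝ p q) :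
    ∃ u : ℝ, 0 < u ∧ u < 1 ∧ ∀ i, z i = p i + u * (q i - p i) := by
  rw [openSegment_eq_image'] at hz
  obtain ⟨u, hu, rfl⟩ := hz
  exact ⟨u, hu.1, hu.2, fun i => by simp⟩

theorem segment_subset_of_vertical {p q : region} (h : p.1 0 = q.1 0) :
    segment ℝ p.1 q.1 ⊆ region := by
  intro z hz
  obtain ⟨u, hu0, hu1, hu⟩ := mem_segment_coord hz
  have h0 : z 0 = p.1 0 := by rw [hu, h]; ring
  refine ⟨h0 ▸ base_nonneg p, h0 ▸ base_lt_one p, ?_, ?_⟩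
  · rw [hu]; nlinarith [height_nonneg p, height_nonneg q]
  · have := height_le_profile q
    rw [← h] at this
    rw [h0, hu]; nlinarith [height_le_profile p]

theorem segment_subset_of_horizontal {p q : region} (h : p.1 1 = q.1 1) (hpq : p.1 0 ≤ q.1 0) :
    segment ℝ p.1 q.1 ⊆ region := by
  intro z hz
  obtain ⟨u, hu0, hu1, hu⟩ := mem_segment_coord hz
  have h1 : z 1 = p.1 1 := by rw [hu, h]; ring
  have h2 : p.1 0 ≤ z 0 := by rw [hu]; nlinarith
  have h3 : z 0 ≤ q.1 0 := by rw [hu]; nlinarith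
  exact ⟨(base_nonneg p).trans h2, h3.trans_lt (base_lt_one q), h1 ▸ height_nonneg p,
    h1 ▸ (height_le_profile p).trans (profile_mono h2)⟩

/-- The distance in the bottom copy is bounded by the length of a horizontal and a vertical move. -/
theorem dist_back_le (p q : region) :
    dist (Piece.back p) (.back q) ≤ |p.1 0 - q.1 0| + |p.1 1 - q.1 1| := by
  wlog hpq : p.1 0 ≤ q.1 0 generalizing p q
  · rw [dist_comm, abs_sub_comm, abs_sub_comm (p.1 1)]; exact this q p (le_of_not_ge hpq)
  set w : region := ⟨!₂[q.1 0, p.1 1], pt_mem (base_nonneg q) (base_lt_one q) (height_nonneg p)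
    ((height_le_profile p).trans (profile_mono hpq))⟩ with hw
  have hw0 : w.1 0 = q.1 0 := by simp [hw]
  have hw1 : w.1 1 = p.1 1 := by simp [hw]
  have h1 := (Seg.back p w (segment_subset_of_horizontal hw1.symm (hw0 ▸ hpq))).dist_le.trans
    (plane_dist_le _ _)
  have h2 := (Seg.back w q (segment_subset_of_vertical hw0)).dist_le.trans (plane_dist_le _ _)
  have h3 := dist_triangle (Piece.back p) (.back w) (.back q)
  simp only [hw0, hw1, sub_self, abs_zero, add_zero, zero_add] at h1 h2
  linarith

/-- A horizontal and then a vertical move in the top copy, starting on the right side of the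
possible slit at the left end, if the horizontal part meets no slit. -/
theorem dist_front_le {p q : region} {y : ℝ} (hpq : p.1 0 < q.1 0) (hy0 : 0 ≤ y)
    (hyp : y ≤ p.1 1) (hyq : y ≤ q.1 1)
    (hslit : ∀ d : Dyadic, p.1 0 < d.pos → d.pos < q.1 0 → d.slitLength < y) :
    dist (Piece.front true p) (.front false q) ≤
      (p.1 1 - y) + (q.1 0 - p.1 0) + (q.1 1 - y) := by
  set v : region := ⟨!₂[p.1 0, y], pt_mem (base_nonneg p) (base_lt_one p) hy0
    (hyp.trans (height_le_profile p))⟩ with hv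
  set w : region := ⟨!₂[q.1 0, y], pt_mem (base_nonneg q) (base_lt_one q) hy0
    (hyq.trans (height_le_profile q))⟩ with hw
  have hv0 : v.1 0 = p.1 0 := by simp [hv]
  have hv1 : v.1 1 = y := by simp [hv]
  have hw0 : w.1 0 = q.1 0 := by simp [hw]
  have hw1 : w.1 1 = y := by simp [hw]
  have h1 := dist_front_vertical_le true hv0.symm
  have h2 := dist_front_vertical_le false hw0
  have h3 := (Seg.frontTransverse v w (by rwa [hv0, hw0])
    (segment_subset_of_horizontal (by rw [hv1, hw1]) (by rw [hv0, hw0]; exact hpq.le)) ?_).dist_le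
  · have h4 := h3.trans (plane_dist_le _ _)
    have h5 := dist_triangle (Piece.front true p) (.front true v) (.front false q)
    have h6 := dist_triangle (Piece.front true v) (.front false w) (.front false q)
    rw [hv0, hw0, hv1, hw1, sub_self, abs_zero, abs_of_neg (by linarith)] at h4
    rw [hv1, abs_of_nonneg (by linarith)] at h1
    rw [hw1, abs_of_nonpos (by linarith)] at h2
    linarith
  · intro z hz d hd
    obtain ⟨u, hu0, hu1, hu⟩ := mem_openSegment_coord hz
    have hz0 := hu 0
    have hz1 := hu 1
    rw [hv0, hw0] at hz0
    rw [hv1, hw1, sub_self, mul_zero, add_zero] at hz1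
    obtain ⟨hd0, hd1, hd2⟩ := hd
    have := hslit d (by rw [← hd0, hz0]; nlinarith) (by rw [← hd0, hz0]; nlinarith)
    linarith

theorem front_sides_dist_eq {p : region} (h : ∀ d : Dyadic, d.pos = p.1 0 → d.slitLength < p.1 1) :
    dist (Piece.front false p) (.front true p) = 0 :=
  (Glue.unslit p fun d hd => by have := h d hd.1.symm; linarith [hd.2.2]).dist_eq

theorem dist_pillow_le (d : Dyadic) (b : Bool) (q q' : d.square) :
    dist (Piece.pillow d b q) (.pillow d b q') ≤ |q.1 0 - q'.1 0| + |q.1 1 - q'.1 1| :=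
  (Seg.pillow d b q q').dist_le.trans (plane_dist_le _ _)

theorem dist_pillow_foot (d : Dyadic) (b : Bool) (q : d.square) :
    dist (Piece.pillow d b q) (.back d.foot) ≤ q.1 0 + q.1 1 := by
  have h1 := dist_pillow_le d b q d.origin
  have h2 := (Glue.slit b d d.foot d.origin
    (by simp [Dyadic.slit, d.slitLength_pos.le]) (by simp) (by simp)).dist_eq
  have h3 := (Glue.seam b d.foot (.inl (by simp))).dist_eq
  have h4 := dist_triangle (Piece.pillow d b q) (.pillow d b d.origin) (.back d.foot)
  have h5 := dist_triangle (Piece.pillow d b d.origin) (.front b d.foot) (.back d.foot)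
  rw [dist_comm] at h2
  rw [d.origin_zero, d.origin_one, sub_zero, sub_zero, abs_of_nonneg q.2.1.1,
    abs_of_nonneg q.2.2.1] at h1
  linarith

theorem dist_pillow_foot_le_side (d : Dyadic) (b : Bool) (q : d.square) :
    dist (Piece.pillow d b q) (.back d.foot) ≤ 2 * d.side := by
  have := dist_pillow_foot d b q
  linarith [q.2.1.2, q.2.2.2]

/-! ### The folding map onto the region -/

/-- The first coordinate of the projection of the surface to `Y₀` that collapses each pillowcase
onto its slit. -/
def Piece.base : Piece → ℝ
  | .front _ p => p.1 0
  | .back p => p.1 0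
  | .pillow d _ _ => d.pos

/-- The second coordinate of the projection of the surface to `Y₀`. -/
def Piece.height : Piece → ℝ
  | .front _ p => p.1 1
  | .back p => p.1 1
  | .pillow d _ q => min (q.1 0) d.slitLength

theorem Glue.base_eq {x y : Piece} (h : Glue x y) : x.base = y.base := by
  cases h with
  | slit b d p q hp h0 h1 => exact hp.1
  | _ => rfl

theorem Glue.height_eq {x y : Piece} (h : Glue x y) : x.height = y.height := by
  cases h with
  | slit b d p q hp h0 h1 =>
    simp only [Piece.height]; rw [h0, min_eq_left hp.2.2]
  | _ => rfl

theorem Seg.abs_base_sub_le {x y : Piece} {L : ℝ} (h : Seg x y L) : |x.base - y.base| ≤ L := by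
  cases h with
  | pillow => simp [Piece.base]
  | _ => exact abs_coord_sub_le _ _ 0

theorem Seg.abs_height_sub_le {x y : Piece} {L : ℝ} (h : Seg x y L) :
    |x.height - y.height| ≤ L := by
  cases h with
  | pillow d b q q' =>
    refine (abs_min_sub_min_le_max _ _ _ _).trans ?_
    rw [sub_self, abs_zero, max_eq_left (abs_nonneg _)]
    exact abs_coord_sub_le _ _ 0
  | _ => exact abs_coord_sub_le _ _ 1

theorem abs_base_sub_le (x y : Piece) : |x.base - y.base| ≤ dist x y := by
  simpa using abs_sub_le_mul_dist (K := 1) (fun _ _ h => h.base_eq)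
    (fun _ _ _ h => by simpa using h.abs_base_sub_le) zero_le_one x y

theorem abs_height_sub_le (x y : Piece) : |x.height - y.height| ≤ dist x y := by
  simpa using abs_sub_le_mul_dist (K := 1) (fun _ _ h => h.height_eq)
    (fun _ _ _ h => by simpa using h.abs_height_sub_le) zero_le_one x y

theorem Piece.base_mem (x : Piece) : 0 ≤ x.base ∧ x.base < 1 := by
  cases x with
  | front b p => exact ⟨base_nonneg p, base_lt_one p⟩
  | back p => exact ⟨base_nonneg p, base_lt_one p⟩
  | pillow d b q => exact ⟨d.pos_nonneg, d.pos_lt_one⟩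

/-- Every point of the surface lies near the bottom copy of the floor. -/
theorem exists_dist_floor_le (x : Piece) : ∃ p : region, p.1 1 = 0 ∧ dist x (.back p) ≤ 1 := by
  cases x with
  | front b p =>
    exact ⟨floorPt p, by simp, (dist_front_floor b p).trans (by linarith [height_le_third p])⟩
  | back p =>
    refine ⟨floorPt p, by simp, (dist_back_le _ _).trans ?_⟩
    simp only [floorPt_zero, floorPt_one, sub_self, abs_zero, zero_add, sub_zero]
    rw [abs_of_nonneg (height_nonneg p)]
    linarith [height_le_third p]
  | pillow d b q =>
    exact ⟨d.foot, by simp, (dist_pillow_foot_le_side d b q).trans (by linarith [d.side_le_half])⟩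

theorem piece_dist_le_three (x y : Piece) : dist x y ≤ 3 := by
  obtain ⟨p, hp, hxp⟩ := exists_dist_floor_le x
  obtain ⟨q, hq, hyq⟩ := exists_dist_floor_le y
  have h := dist_back_le p q
  rw [hp, hq, sub_self, abs_zero, add_zero] at h
  have h' : |p.1 0 - q.1 0| ≤ 1 := by
    rw [abs_le]
    constructor <;> linarith [base_nonneg p, base_nonneg q, base_lt_one p, base_lt_one q]
  have h1 := dist_triangle x (.back p) y
  have h2 := dist_triangle (Piece.back p) (.back q) y
  rw [dist_comm y] at hyq
  linarith

/-! ### The surface and the product space -/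

/-- The projection of the pieces to the surface. -/
def Surface.mk (x : Piece) : Surface := SeparationQuotient.mk x

theorem Surface.surjective_mk : Function.Surjective Surface.mk := SeparationQuotient.surjective_mk

theorem Surface.dist_mk (x y : Piece) : dist (Surface.mk x) (Surface.mk y) = dist x y :=
  SeparationQuotient.dist_mk x y

theorem Surface.mk_eq_mk {x y : Piece} : Surface.mk x = Surface.mk y ↔ dist x y = 0 := by
  rw [← dist_eq_zero, Surface.dist_mk]

theorem Surface.isometry_mk : Isometry Surface.mk := Isometry.of_dist_eq Surface.dist_mk

theorem Surface.continuous_mk : Continuous Surface.mk := Surface.isometry_mk.continuous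

theorem cusp_eq : cusp = Surface.mk (.back tip) := rfl

/-- A Lipschitz function on the pieces descends to the surface. -/
theorem exists_lift {E : Type*} [MetricSpace E] {h : Piece → E} {K : NNReal}
    (hK : LipschitzWith K h) :
    ∃ g : Surface → E, LipschitzWith K g ∧ ∀ x, g (Surface.mk x) = h x := by
  have hc : ∀ x y, Surface.mk x = Surface.mk y → h x = h y := fun x y hxy => by
    rw [Surface.mk_eq_mk] at hxy
    have := hK.dist_le_mul x y
    rw [hxy, mul_zero] at this
    exact dist_le_zero.1 this
  have hg : ∀ x, h (Function.surjInv Surface.surjective_mk (Surface.mk x)) = h x := fun x =>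
    hc _ _ (Function.surjInv_eq _ _)
  refine ⟨fun y => h (Function.surjInv Surface.surjective_mk y), ?_, hg⟩
  refine LipschitzWith.of_dist_le_mul fun y z => ?_
  obtain ⟨y, rfl⟩ := Surface.surjective_mk y
  obtain ⟨z, rfl⟩ := Surface.surjective_mk z
  rw [hg, hg, Surface.dist_mk]
  exact hK.dist_le_mul y z

theorem lipschitzWith_base : LipschitzWith 1 Piece.base :=
  LipschitzWith.of_dist_le_mul fun x y => by
    simpa [Real.dist_eq] using abs_base_sub_le x y

theorem lipschitzWith_height : LipschitzWith 1 Piece.height :=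
  LipschitzWith.of_dist_le_mul fun x y => by
    simpa [Real.dist_eq] using abs_height_sub_le x y

/-- The first coordinate of the folding map, on the surface. -/
def Surface.base : Surface → ℝ := (exists_lift lipschitzWith_base).choose

theorem Surface.lipschitzWith_base : LipschitzWith 1 Surface.base :=
  (exists_lift CuspExample.lipschitzWith_base).choose_spec.1

@[simp] theorem Surface.base_mk (x : Piece) : (Surface.mk x).base = x.base :=
  (exists_lift CuspExample.lipschitzWith_base).choose_spec.2 x

theorem Surface.abs_base_sub_le (x y : Surface) : |x.base - y.base| ≤ dist x y := by
  simpa [Real.dist_eq] using Surface.lipschitzWith_base.dist_le_mul x y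

theorem Surface.dist_le_three (x y : Surface) : dist x y ≤ 3 := by
  obtain ⟨x, rfl⟩ := Surface.surjective_mk x
  obtain ⟨y, rfl⟩ := Surface.surjective_mk y
  exact (Surface.dist_mk x y).trans_le (piece_dist_le_three x y)

namespace Space

/-- The point `(y, s)` of the product space. -/
def pt (y : Surface) (s : Ioo (-2 : ℝ) 2) : Space := WithLp.toLp 2 (y, s)

/-- The surface component. -/
def fst (x : Space) : Surface := WithLp.fst (p := 2) (α := Surface) (β := Ioo (-2 : ℝ) 2) x

/-- The interval component. -/
def snd (x : Space) : Ioo (-2 : ℝ) 2 := WithLp.snd (p := 2) (α := Surface) (β := Ioo (-2 : ℝ) 2) x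

@[simp] theorem fst_pt (y : Surface) (s : Ioo (-2 : ℝ) 2) : (pt y s).fst = y := rfl
@[simp] theorem snd_pt (y : Surface) (s : Ioo (-2 : ℝ) 2) : (pt y s).snd = s := rfl

theorem dist_eq (x y : Space) :
    dist x y = √(dist x.fst y.fst ^ 2 + dist (x.snd : ℝ) y.snd ^ 2) := by
  have h := WithLp.prod_dist_eq_add (p := 2) (α := Surface) (β := Ioo (-2 : ℝ) 2) (by simp) x y
  rw [ENNReal.toReal_ofNat, ← Real.sqrt_eq_rpow] at h
  simp only [Real.rpow_ofNat] at h
  exact h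

theorem dist_fst_le (x y : Space) : dist x.fst y.fst ≤ dist x y := by
  rw [dist_eq]; exact Real.le_sqrt_of_sq_le (by nlinarith [sq_nonneg (dist (x.snd : ℝ) y.snd)])

theorem dist_snd_le (x y : Space) : dist (x.snd : ℝ) y.snd ≤ dist x y := by
  rw [dist_eq]; exact Real.le_sqrt_of_sq_le (by nlinarith [sq_nonneg (dist x.fst y.fst)])

theorem dist_le_add (x y : Space) :
    dist x y ≤ dist x.fst y.fst + dist (x.snd : ℝ) y.snd := by
  rw [dist_eq, Real.sqrt_le_iff]
  have h1 : 0 ≤ dist x.fst y.fst := dist_nonneg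
  have h2 : 0 ≤ dist (x.snd : ℝ) y.snd := dist_nonneg
  exact ⟨by positivity, by nlinarith⟩

/-- The product space is homeomorphic to the topological product. -/
def homeomorphProd : Space ≃ₜ Surface × Ioo (-2 : ℝ) 2 :=
  WithLp.homeomorphProd 2 Surface (Ioo (-2 : ℝ) 2)

theorem continuous_fst : Continuous fst :=
  (LipschitzWith.of_dist_le_mul (K := 1) fun x y => by
    simpa using dist_fst_le x y).continuous

theorem continuous_pt : Continuous fun z : Surface × Ioo (-2 : ℝ) 2 => pt z.1 z.2 :=
  homeomorphProd.symm.continuous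

theorem dist_le_seven (x y : Space) : dist x y ≤ 7 := by
  have h1 := dist_le_add x y
  have h2 := Surface.dist_le_three x.fst y.fst
  have h3 : dist (x.snd : ℝ) y.snd ≤ 4 := by
    rw [Real.dist_eq, abs_le]
    constructor <;> linarith [x.snd.2.1, x.snd.2.2, y.snd.2.1, y.snd.2.2]
  linarith

end Space

/-! ### Continua and linear local connectivity -/

/-- The points `a` and `b` lie in a continuum contained in `A`. -/
def JoinedByContinuum {Z : Type*} [TopologicalSpace Z] (A : Set Z) (a b : Z) : Prop :=
  ∃ K : Set Z, IsContinuumSet K ∧ K ⊆ A ∧ a ∈ K ∧ b ∈ K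

namespace JoinedByContinuum

variable {Z W : Type*} [TopologicalSpace Z] [TopologicalSpace W] {A B : Set Z} {a b c : Z}

theorem refl (ha : a ∈ A) : JoinedByContinuum A a a :=
  ⟨{a}, ⟨isCompact_singleton, isConnected_singleton⟩, by simpa, rfl, rfl⟩

theorem symm : JoinedByContinuum A a b → JoinedByContinuum A b a :=
  fun ⟨K, hK, hA, ha, hb⟩ => ⟨K, hK, hA, hb, ha⟩

theorem trans : JoinedByContinuum A a b → JoinedByContinuum A b c → JoinedByContinuum A a c :=
  fun ⟨K, hK, hA, ha, hb⟩ ⟨K', hK', hA', hb', hc⟩ =>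
    ⟨K ∪ K', ⟨hK.1.union hK'.1, hK.2.union ⟨b, hb, hb'⟩ hK'.2⟩, union_subset hA hA', .inl ha,
      .inr hc⟩

theorem mono (hAB : A ⊆ B) : JoinedByContinuum A a b → JoinedByContinuum B a b :=
  fun ⟨K, hK, hA, ha, hb⟩ => ⟨K, hK, hA.trans hAB, ha, hb⟩

theorem map {f : Z → W} (hf : Continuous f) {B : Set W} (hB : MapsTo f A B) :
    JoinedByContinuum A a b → JoinedByContinuum B (f a) (f b) :=
  fun ⟨K, hK, hA, ha, hb⟩ => ⟨f '' K, ⟨hK.1.image hf, hK.2.image f hf.continuousOn⟩,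
    (image_mono hA).trans (image_subset_iff.2 hB), mem_image_of_mem f ha, mem_image_of_mem f hb⟩

theorem of_unitInterval {γ : unitInterval → Z} (hγ : Continuous γ) (hA : ∀ s, γ s ∈ A) :
    JoinedByContinuum A (γ 0) (γ 1) :=
  ⟨range γ, ⟨isCompact_range hγ, isConnected_range hγ⟩, range_subset_iff.2 hA, mem_range_self _,
    mem_range_self _⟩

end JoinedByContinuum

theorem coord_lineMap (p q : Plane) (s : ℝ) (i : Fin 2) :
    (AffineMap.lineMap p q s : Plane) i = p i + s * (q i - p i) := by
  simp [AffineMap.lineMap_apply]; ring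

theorem lineMap_mem_segment' (p q : Plane) (s : unitInterval) :
    (AffineMap.lineMap p q (s : ℝ) : Plane) ∈ segment ℝ p q := by
  rw [segment_eq_image_lineMap]; exact mem_image_of_mem _ s.2

/-- A segment is the image of the unit interval under a Lipschitz map. -/
theorem Seg.exists_param {x y : Piece} {L : ℝ} (h : Seg x y L) :
    ∃ γ : unitInterval → Piece, γ 0 = x ∧ γ 1 = y ∧
      ∀ s t, s ≤ t → dist (γ s) (γ t) ≤ L * (t - s) := by
  have hlen : ∀ (p q : Plane) (s t : unitInterval), s ≤ t →
      dist (AffineMap.lineMap p q (s : ℝ) : Plane) (AffineMap.lineMap p q (t : ℝ)) =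
        dist p q * (t - s) := fun p q s t hst => by
    rw [dist_lineMap_lineMap, Real.dist_eq, abs_sub_comm,
      abs_of_nonneg (sub_nonneg.2 (by exact_mod_cast hst)), mul_comm]
  have hsub : ∀ (p q : Plane) (s t : unitInterval),
      segment ℝ (AffineMap.lineMap p q (s : ℝ) : Plane) (AffineMap.lineMap p q (t : ℝ)) ⊆
        segment ℝ p q := fun p q s t =>
    (convex_segment p q).segment_subset (lineMap_mem_segment' _ _ s) (lineMap_mem_segment' _ _ t)
  cases h with
  | frontTransverse p q hpq hseg hslit =>
    let P : unitInterval → region := fun s =>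
      ⟨AffineMap.lineMap p.1 q.1 (s : ℝ), hseg (lineMap_mem_segment' _ _ s)⟩
    have hP0 : P 0 = p := Subtype.ext (by simp [P])
    have hP1 : P 1 = q := Subtype.ext (by simp [P])
    refine ⟨fun s => .front (decide (s = 0)) (P s), by simp [hP0], by simp [hP1], ?_⟩
    intro s t hst
    rcases hst.eq_or_lt with rfl | hst'
    · simp
    have hs1 : (s : ℝ) < t := by exact_mod_cast hst'
    have ht1 : (t : ℝ) ≤ 1 := t.2.2
    have ht0 : t ≠ 0 := (lt_of_le_of_lt (show 0 ≤ s from s.2.1) hst').ne'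
    have h1 : dist (Piece.front true (P s)) (.front false (P t)) ≤ dist p.1 q.1 * (t - s) := by
      rw [← hlen p.1 q.1 s t hst]
      refine (Seg.frontTransverse (P s) (P t) ?_ ((hsub _ _ s t).trans hseg) ?_).dist_le
      · simp only [P, coord_lineMap]; nlinarith
      · intro z hz
        refine hslit z ?_
        obtain ⟨u, hu0, hu1, hu⟩ := mem_openSegment_coord hz
        rw [openSegment_eq_image_lineMap]
        have hs0 : (0 : ℝ) ≤ s := s.2.1
        refine ⟨s + u * (t - s), ⟨by nlinarith, by nlinarith⟩, ?_⟩
        ext i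
        rw [hu i]
        simp only [P, coord_lineMap]
        ring
    by_cases hs0 : s = 0
    · simpa [hs0, ht0] using h1
    · have hs0' : (0 : ℝ) < s := by
        rcases (show (0 : ℝ) ≤ s from s.2.1).eq_or_lt with h | h
        · exact absurd (Subtype.ext h.symm) hs0
        · exact h
      have h2 : dist (Piece.front false (P s)) (.front true (P s)) = 0 :=
        (Glue.unslit _ (hslit _ (by
          rw [openSegment_eq_image_lineMap]
          exact mem_image_of_mem _ ⟨hs0', hs1.trans_le ht1⟩))).dist_eq
      have h3 := dist_triangle (Piece.front false (P s)) (.front true (P s)) (.front false (P t))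
      simp only [hs0, ht0, decide_false]
      linarith
  | frontVertical b p q hpq =>
    let P : unitInterval → region := fun s => ⟨AffineMap.lineMap p.1 q.1 (s : ℝ),
      segment_subset_of_vertical hpq (lineMap_mem_segment' _ _ s)⟩
    refine ⟨fun s => .front b (P s), ?_, ?_, fun s t hst => ?_⟩
    · exact congrArg _ (Subtype.ext (by simp [P]))
    · exact congrArg _ (Subtype.ext (by simp [P]))
    · rw [← hlen p.1 q.1 s t hst]
      exact (Seg.frontVertical b (P s) (P t) (by simp [P, coord_lineMap, hpq])).dist_le
  | back p q hseg =>
    let P : unitInterval → region := fun s => ⟨AffineMap.lineMap p.1 q.1 (s : ℝ),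
      hseg (lineMap_mem_segment' _ _ s)⟩
    refine ⟨fun s => .back (P s), ?_, ?_, fun s t hst => ?_⟩
    · exact congrArg _ (Subtype.ext (by simp [P]))
    · exact congrArg _ (Subtype.ext (by simp [P]))
    · rw [← hlen p.1 q.1 s t hst]
      exact (Seg.back (P s) (P t) ((hsub _ _ s t).trans hseg)).dist_le
  | pillow d b p q =>
    have hP : ∀ s : unitInterval, (AffineMap.lineMap p.1 q.1 (s : ℝ) : Plane) ∈ d.square := by
      intro s
      have hs0 : (0 : ℝ) ≤ s := s.2.1
      have hs1 : (s : ℝ) ≤ 1 := s.2.2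
      have hp := p.2
      have hq := q.2
      refine ⟨⟨?_, ?_⟩, ?_, ?_⟩ <;> rw [coord_lineMap] <;>
        nlinarith [hp.1.1, hp.1.2, hp.2.1, hp.2.2, hq.1.1, hq.1.2, hq.2.1, hq.2.2]
    let P : unitInterval → d.square := fun s => ⟨_, hP s⟩
    refine ⟨fun s => .pillow d b (P s), ?_, ?_, fun s t hst => ?_⟩
    · exact congrArg _ (Subtype.ext (by simp [P]))
    · exact congrArg _ (Subtype.ext (by simp [P]))
    · rw [← hlen p.1 q.1 s t hst]
      exact (Seg.pillow d b (P s) (P t)).dist_le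

theorem Seg.joinedByContinuum {x y : Piece} {L : ℝ} (h : Seg x y L) :
    JoinedByContinuum {z | dist z (Surface.mk x) ≤ L ∧ dist z (Surface.mk y) ≤ L}
      (Surface.mk x) (Surface.mk y) := by
  obtain ⟨γ, rfl, rfl, hγ⟩ := h.exists_param
  have hL := h.nonneg
  have hlip : ∀ s t, dist (γ s) (γ t) ≤ L * dist s t := fun s t => by
    rcases le_total s t with hst | hst
    · rw [Subtype.dist_eq, Real.dist_eq, abs_sub_comm,
        abs_of_nonneg (sub_nonneg.2 (by exact_mod_cast hst))]
      exact hγ s t hst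
    · rw [dist_comm, Subtype.dist_eq, Real.dist_eq,
        abs_of_nonneg (sub_nonneg.2 (by exact_mod_cast hst))]
      exact hγ t s hst
  have hcont : Continuous γ := (LipschitzWith.of_dist_le_mul (K := ⟨L, hL⟩) hlip).continuous
  have hd1 : ∀ s t : unitInterval, dist s t ≤ 1 := fun s t => by
    rw [Subtype.dist_eq, Real.dist_eq, abs_le]
    constructor <;> linarith [s.2.1, s.2.2, t.2.1, t.2.2]
  refine JoinedByContinuum.of_unitInterval (Surface.continuous_mk.comp hcont) fun s => ⟨?_, ?_⟩ <;>
    exact (Surface.dist_mk _ _).trans_le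
      ((hlip _ _).trans (mul_le_of_le_one_right hL (hd1 _ _)))

/-- The endpoints of a polygonal path lie in a continuum that stays within the length of the path
from its starting point. -/
theorem PolyPath.joinedByContinuum {x y : Piece} {L : ℝ} (h : PolyPath x y L) :
    JoinedByContinuum (Metric.closedBall (Surface.mk x) L) (Surface.mk x) (Surface.mk y) := by
  induction h with
  | refl x => exact .refl (Metric.mem_closedBall_self le_rfl)
  | @glue x y z L h hL ih =>
    have : Surface.mk x = Surface.mk y := by
      rw [Surface.mk_eq_mk]
      rcases h with h | h
      · exact h.dist_eq
      · rw [dist_comm]; exact h.dist_eq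
    rwa [this]
  | @seg x y z K L h hL ih =>
    have hL0 := hL.nonneg
    have h1 : JoinedByContinuum (Metric.closedBall (Surface.mk x) K) (Surface.mk x)
        (Surface.mk y) := by
      rcases h with h | h
      · exact h.joinedByContinuum.mono fun z hz => hz.1
      · exact h.joinedByContinuum.symm.mono fun z hz => hz.2
    have h2 : dist (Surface.mk x) (Surface.mk y) ≤ K := by
      rw [Surface.dist_mk]
      rcases h with h | h
      · exact h.dist_le
      · rw [dist_comm]; exact h.dist_le
    refine (h1.mono (Metric.closedBall_subset_closedBall (by linarith))).trans
      (ih.mono fun w hw => ?_)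
    rw [Metric.mem_closedBall] at hw ⊢
    linarith [dist_triangle w (Surface.mk y) (Surface.mk x), dist_comm (Surface.mk x) (Surface.mk y)]

theorem Surface.joinedByContinuum_ball {x y : Surface} {r : ℝ} (h : dist x y < r) :
    JoinedByContinuum (Metric.ball x r) x y := by
  obtain ⟨x, rfl⟩ := Surface.surjective_mk x
  obtain ⟨y, rfl⟩ := Surface.surjective_mk y
  rw [Surface.dist_mk] at h
  obtain ⟨L, hL, hr⟩ := exists_polyPath_lt h
  exact hL.joinedByContinuum.mono (Metric.closedBall_subset_ball hr)

theorem Surface.joinedByContinuum_univ (x y : Surface) : JoinedByContinuum univ x y :=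
  (Surface.joinedByContinuum_ball (lt_add_one (dist x y))).mono (subset_univ _)

namespace Space

theorem joined_slice {B : Set Surface} {A : Set Space} {y z : Surface} (s : Ioo (-2 : ℝ) 2)
    (h : JoinedByContinuum B y z) (hA : ∀ w ∈ B, pt w s ∈ A) :
    JoinedByContinuum A (pt y s) (pt z s) :=
  h.map (f := fun w => pt w s) (continuous_pt.comp (continuous_id.prodMk continuous_const)) hA

theorem joined_vertical {A : Set Space} (y : Surface) (s t : Ioo (-2 : ℝ) 2)
    (hA : ∀ u : Ioo (-2 : ℝ) 2, (u : ℝ) ∈ uIcc (s : ℝ) t → pt y u ∈ A) :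
    JoinedByContinuum A (pt y s) (pt y t) := by
  have hmem : ∀ u : unitInterval, (s : ℝ) + u * (t - s) ∈ uIcc (s : ℝ) t := fun u => by
    rw [← segment_eq_uIcc, segment_eq_image']
    exact ⟨u, u.2, by simp⟩
  have hsub : uIcc (s : ℝ) t ⊆ Ioo (-2) 2 := ordConnected_Ioo.uIcc_subset s.2 t.2
  let γ : unitInterval → Ioo (-2 : ℝ) 2 := fun u => ⟨_, hsub (hmem u)⟩
  have hγ : Continuous γ := by fun_prop
  have := JoinedByContinuum.of_unitInterval (A := A) (γ := fun u => pt y (γ u))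
    (continuous_pt.comp (continuous_const.prodMk hγ)) fun u => hA _ (hmem u)
  have h0 : γ 0 = s := Subtype.ext (by simp [γ])
  have h1 : γ 1 = t := Subtype.ext (by simp [γ])
  rwa [h0, h1] at this

end Space

theorem exists_surface_far (x : Surface) : ∃ y : Surface, 1 / 4 ≤ dist y x := by
  let y₀ : Surface := Surface.mk (.back tip)
  let y₁ : Surface := Surface.mk
    (.back ⟨!₂[1 / 2, 0], floor_mem (by norm_num) (by norm_num)⟩)
  have h : 1 / 2 ≤ dist y₀ y₁ := by
    have := Surface.abs_base_sub_le y₀ y₁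
    simp only [y₀, y₁, Surface.base_mk, Piece.base, tip] at this
    norm_num [abs_of_neg] at this ⊢
    exact this
  by_contra! hcon
  linarith [hcon y₀, hcon y₁, dist_triangle_right y₀ y₁ x]

theorem isLinearlyLocallyConnected_space : IsLinearlyLocallyConnected Space := by
  -- As `X` has diameter at most `7`, the complement of a ball is only nonempty for `r ≤ 7`, so `r / 40`
  -- is small compared with the size of both factors.
  refine ⟨40, by norm_num, fun x r hr => ⟨?_, ?_⟩⟩
  · have key : ∀ y ∈ Metric.ball x r,
        JoinedByContinuum (Metric.ball x (40 * r)) x y := by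
      intro y hy
      rw [Metric.mem_ball, dist_comm] at hy
      have h1 := (Space.dist_fst_le x y).trans_lt hy
      have h2 := (Space.dist_snd_le x y).trans_lt hy
      refine JoinedByContinuum.trans (b := Space.pt x.fst y.snd) ?_ ?_
      · refine Space.joined_vertical x.fst x.snd y.snd fun u hu => ?_
        rw [Metric.mem_ball]
        have h3 := Space.dist_le_add (Space.pt x.fst u) x
        have h4 : |(u : ℝ) - x.snd| ≤ |(y.snd : ℝ) - x.snd| := abs_sub_left_of_mem_uIcc hu
        rw [dist_comm, Real.dist_eq] at h2
        simp only [Space.fst_pt, Space.snd_pt, dist_self, zero_add, Real.dist_eq] at h3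
        linarith
      · refine Space.joined_slice y.snd (Surface.joinedByContinuum_ball h1) fun w hw => ?_
        rw [Metric.mem_ball] at hw ⊢
        have h3 := Space.dist_le_add (Space.pt w y.snd) x
        rw [dist_comm] at h2
        simp only [Space.fst_pt, Space.snd_pt] at h3
        linarith
    exact fun y hy z hz => (key y hy).symm.trans (key z hz)
  · obtain ⟨s, hs⟩ : ∃ s : Ioo (-2 : ℝ) 2, 1 ≤ |(s : ℝ) - x.snd| := by
      rcases le_total 0 (x.snd : ℝ) with h | h
      · exact ⟨⟨-1, by norm_num⟩, by rw [abs_of_neg] <;> dsimp only <;> linarith⟩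
      · exact ⟨⟨1, by norm_num⟩, by rw [abs_of_pos] <;> dsimp only <;> linarith⟩
    have key : ∀ y ∈ (Metric.ball x r)ᶜ,
        JoinedByContinuum (Metric.ball x (r / 40))ᶜ (Space.pt cusp s) y := by
      intro y hy
      rw [mem_compl_iff, Metric.mem_ball, not_lt] at hy
      have hr7 := hy.trans (Space.dist_le_seven y x)
      have hfst : ∀ (w : Surface) (u : Ioo (-2 : ℝ) 2), r / 40 ≤ dist w x.fst →
          Space.pt w u ∈ (Metric.ball x (r / 40))ᶜ := fun w u hw => by
        rw [mem_compl_iff, Metric.mem_ball, not_lt]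
        exact hw.trans (Space.dist_fst_le (Space.pt w u) x)
      have hsnd : ∀ (w : Surface) (u : Ioo (-2 : ℝ) 2), r / 40 ≤ |(u : ℝ) - x.snd| →
          Space.pt w u ∈ (Metric.ball x (r / 40))ᶜ := fun w u hw => by
        rw [mem_compl_iff, Metric.mem_ball, not_lt]
        exact hw.trans (Space.dist_snd_le (Space.pt w u) x)
      -- every slice at height `s` and every vertical line far from `x` avoids the ball
      have hline : ∀ (w : Surface) (u : Ioo (-2 : ℝ) 2), r / 40 ≤ dist w x.fst →
          JoinedByContinuum (Metric.ball x (r / 40))ᶜ (Space.pt cusp s) (Space.pt w u) :=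
        fun w u hw => (Space.joined_slice s (Surface.joinedByContinuum_univ cusp w)
          fun v _ => hsnd v s (by linarith)).trans
          (Space.joined_vertical w s u fun v _ => hfst w v hw)
      have hyx := Space.dist_le_add y x
      rw [Real.dist_eq] at hyx
      rcases le_or_gt (r / 40) (dist y.fst x.fst) with h | h
      · exact hline y.fst y.snd h
      · obtain ⟨w, hw⟩ := exists_surface_far x.fst
        refine (hline w y.snd (by linarith)).trans ?_
        exact Space.joined_slice y.snd (Surface.joinedByContinuum_univ w y.fst)
          fun v _ => hsnd v _ (by linarith)
    exact fun y hy z hz => (key y hy).symm.trans (key z hz)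

/-! ### The set `E` -/

theorem mem_cuspSet {x : Space} : x ∈ cuspSet ↔ x.fst = cusp ∧ (x.snd : ℝ) ∈ Icc (-1 : ℝ) 1 :=
  Iff.rfl

theorem isContinuumSet_cuspSet : IsContinuumSet cuspSet := by
  have hsub : Icc (-1 : ℝ) 1 ⊆ Ioo (-2) 2 := Icc_subset_Ioo (by norm_num) (by norm_num)
  let g : Icc (-1 : ℝ) 1 → Space := fun s => Space.pt cusp (inclusion hsub s)
  have hg : Continuous g :=
    Space.continuous_pt.comp (continuous_const.prodMk (continuous_inclusion hsub))
  have he : cuspSet = range g := by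
    ext x
    constructor
    · rintro ⟨h1, h2⟩
      exact ⟨⟨_, h2⟩, congrArg (fun w => Space.pt w x.snd) h1.symm⟩
    · rintro ⟨s, rfl⟩
      exact ⟨rfl, s.2⟩
  have : ConnectedSpace (Icc (-1 : ℝ) 1) :=
    isConnected_iff_connectedSpace.1 (isConnected_Icc (by norm_num))
  rw [he]
  exact ⟨isCompact_range hg, isConnected_range hg⟩

theorem nontrivial_cuspSet : cuspSet.Nontrivial := by
  refine ⟨Space.pt cusp ⟨0, by norm_num⟩, ⟨rfl, by norm_num [Space.pt]⟩,
    Space.pt cusp ⟨1, by norm_num⟩, ⟨rfl, by norm_num [Space.pt]⟩, fun h => ?_⟩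
  have := congrArg (fun x : Space => (x.snd : ℝ)) h
  simp at this

/-! ### A homeomorphism from the square onto a trapezoid -/

/-- The trapezoidal tent over `[0, ℓ]` of height `ℓ / 4`, with slopes `±1`. -/
def tent (ℓ s : ℝ) : ℝ := max 0 (min (min s (ℓ - s)) (ℓ / 4))

theorem tent_nonneg (ℓ s : ℝ) : 0 ≤ tent ℓ s := le_max_left _ _

theorem tent_le {ℓ s : ℝ} (hℓ : 0 ≤ ℓ) : tent ℓ s ≤ ℓ / 4 :=
  max_le (by linarith) (min_le_right _ _)

theorem le_tent {ℓ s v : ℝ} (h1 : v ≤ s) (h2 : v ≤ ℓ - s) (h3 : v ≤ ℓ / 4) : v ≤ tent ℓ s :=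
  (le_min (le_min h1 h2) h3).trans (le_max_right _ _)

theorem tent_eq_zero {ℓ s : ℝ} (h : s ≤ 0 ∨ ℓ ≤ s) : tent ℓ s = 0 := by
  refine max_eq_left ((min_le_left _ _).trans ?_)
  rcases h with h | h
  · exact (min_le_left _ _).trans h
  · exact (min_le_right _ _).trans (by linarith)

theorem tent_pos {ℓ s : ℝ} (h0 : 0 < s) (h1 : s < ℓ) : 0 < tent ℓ s :=
  (lt_min (lt_min h0 (by linarith)) (by linarith)).trans_le (le_max_right _ _)

theorem le_of_le_tent {ℓ s v : ℝ} (hv : 0 < v) (h : v ≤ tent ℓ s) :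
    v ≤ s ∧ v ≤ ℓ - s ∧ v ≤ ℓ / 4 := by
  unfold tent at h
  rcases le_max_iff.1 h with h | h
  · linarith
  · exact ⟨(le_min_iff.1 (le_min_iff.1 h).1).1, (le_min_iff.1 (le_min_iff.1 h).1).2,
      (le_min_iff.1 h).2⟩

theorem abs_tent_sub_le (ℓ s s' : ℝ) : |tent ℓ s - tent ℓ s'| ≤ |s - s'| := by
  unfold tent
  have h1 : |min s (ℓ - s) - min s' (ℓ - s')| ≤ |s - s'| := by
    refine (abs_min_sub_min_le_max _ _ _ _).trans (max_le le_rfl ?_)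
    rw [show ℓ - s - (ℓ - s') = -(s - s') by ring, abs_neg]
  have h2 := (abs_min_sub_min_le_max (min s (ℓ - s)) (ℓ / 4) (min s' (ℓ - s')) (ℓ / 4))
  have h3 := abs_max_sub_max_le_max 0 (min (min s (ℓ - s)) (ℓ / 4)) 0
    (min (min s' (ℓ - s')) (ℓ / 4))
  rw [sub_self, abs_zero] at h2 h3
  exact h3.trans (max_le (abs_nonneg _) (h2.trans (max_le h1 (abs_nonneg _))))

/-- The lift of the part `[ℓ, a] × {0}` of the lower edge of the square `[0, a]²`. -/
def ledge (ℓ x : ℝ) : ℝ := max 0 (x - ℓ)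

/-- First step: shear the square vertically so that the edge `[ℓ, a] × {0}` becomes the diagonal
`y = x - ℓ`, while the slit `[0, ℓ] × {0}` stays fixed. -/
def rise (a ℓ x y : ℝ) : ℝ := y * (1 - ledge ℓ x / a) + ledge ℓ x

/-- The length of the horizontal fibre of the sheared square at height `h`. -/
def fibre (a ℓ h : ℝ) : ℝ := min a (ℓ + h)

/-- Second step: rescale the horizontal fibres so that the sheared square becomes a trapezoid
`{v ≤ s ≤ ℓ - v, 0 ≤ v ≤ ℓ / 4}`; this is its first coordinate `s`. -/
def level (a ℓ x y : ℝ) : ℝ :=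
  ℓ * (rise a ℓ x y / a / 4 + x / fibre a ℓ (rise a ℓ x y) * (1 - rise a ℓ x y / a / 2))

/-- The second coordinate of the map from the square onto the trapezoid. -/
def depth (a ℓ x y : ℝ) : ℝ := ℓ * (rise a ℓ x y / a) / 4

section Square

variable {a ℓ x y x' y' : ℝ}

theorem ledge_nonneg : 0 ≤ ledge ℓ x := le_max_left _ _

theorem ledge_le (hℓa : ℓ ≤ a) (hx : x ≤ a) : ledge ℓ x ≤ a - ℓ :=
  max_le (by linarith) (by linarith)

theorem abs_ledge_sub_le : |ledge ℓ x - ledge ℓ x'| ≤ |x - x'| := by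
  have := abs_max_sub_max_le_max 0 (x - ℓ) 0 (x' - ℓ)
  rw [sub_self, abs_zero, sub_sub_sub_cancel_right] at this
  exact this.trans (max_le (abs_nonneg _) le_rfl)

theorem one_sub_ledge_pos (hℓ : 0 < ℓ) (hℓa : ℓ ≤ a) (hx : x ≤ a) : 0 < 1 - ledge ℓ x / a := by
  rw [sub_pos, div_lt_one (by linarith)]
  linarith [ledge_le hℓa hx]

theorem ledge_le_rise (hℓ : 0 < ℓ) (hℓa : ℓ ≤ a) (hx : x ≤ a) (hy : 0 ≤ y) :
    ledge ℓ x ≤ rise a ℓ x y := by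
  unfold rise
  linarith [mul_nonneg hy (one_sub_ledge_pos hℓ hℓa hx).le]

theorem rise_nonneg (hℓ : 0 < ℓ) (hℓa : ℓ ≤ a) (hx : x ≤ a) (hy : 0 ≤ y) : 0 ≤ rise a ℓ x y :=
  ledge_nonneg.trans (ledge_le_rise hℓ hℓa hx hy)

theorem sub_rise (ha : 0 < a) : a - rise a ℓ x y = (a - y) * (1 - ledge ℓ x / a) := by
  unfold rise; field_simp; ring

theorem rise_le (hℓ : 0 < ℓ) (hℓa : ℓ ≤ a) (hx : x ≤ a) (hy : y ≤ a) : rise a ℓ x y ≤ a := by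
  have := sub_rise (ℓ := ℓ) (x := x) (y := y) (hℓ.trans_le hℓa)
  have := mul_nonneg (sub_nonneg.2 hy) (one_sub_ledge_pos hℓ hℓa hx).le
  linarith

theorem le_fibre {h : ℝ} (hℓa : ℓ ≤ a) (hh : 0 ≤ h) : ℓ ≤ fibre a ℓ h :=
  le_min hℓa (by linarith)

theorem le_fibre_rise (hℓ : 0 < ℓ) (hℓa : ℓ ≤ a) (hx : x ≤ a) (hy : 0 ≤ y) :
    x ≤ fibre a ℓ (rise a ℓ x y) := by
  refine le_min hx ?_
  have h1 := ledge_le_rise hℓ hℓa hx hy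
  have h2 : x - ℓ ≤ ledge ℓ x := le_max_right _ _
  linarith

theorem rise_div_mem (hℓ : 0 < ℓ) (hℓa : ℓ ≤ a) (hx : x ≤ a) (hy : y ∈ Icc 0 a) :
    0 ≤ rise a ℓ x y / a ∧ rise a ℓ x y / a ≤ 1 := by
  have ha := hℓ.trans_le hℓa
  exact ⟨div_nonneg (rise_nonneg hℓ hℓa hx hy.1) ha.le,
    (div_le_one ha).2 (rise_le hℓ hℓa hx hy.2)⟩

theorem div_fibre_mem (hℓ : 0 < ℓ) (hℓa : ℓ ≤ a) (hx : x ∈ Icc 0 a) (hy : 0 ≤ y) :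
    0 ≤ x / fibre a ℓ (rise a ℓ x y) ∧ x / fibre a ℓ (rise a ℓ x y) ≤ 1 := by
  have h1 := hℓ.trans_le (le_fibre hℓa (rise_nonneg hℓ hℓa hx.2 hy))
  exact ⟨div_nonneg hx.1 h1.le, (div_le_one h1).2 (le_fibre_rise hℓ hℓa hx.2 hy)⟩

theorem level_sub_depth : level a ℓ x y - depth a ℓ x y =
    ℓ * (x / fibre a ℓ (rise a ℓ x y)) * (1 - rise a ℓ x y / a / 2) := by
  unfold level depth; ring

theorem sub_level_sub_depth : ℓ - level a ℓ x y - depth a ℓ x y =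
    ℓ * (1 - x / fibre a ℓ (rise a ℓ x y)) * (1 - rise a ℓ x y / a / 2) := by
  unfold level depth; ring

theorem depth_nonneg (hℓ : 0 < ℓ) (hℓa : ℓ ≤ a) (hx : x ≤ a) (hy : y ∈ Icc 0 a) :
    0 ≤ depth a ℓ x y := by
  have := (rise_div_mem hℓ hℓa hx hy).1
  unfold depth; positivity

theorem depth_le_level (hℓ : 0 < ℓ) (hℓa : ℓ ≤ a) (hx : x ∈ Icc 0 a) (hy : y ∈ Icc 0 a) :
    depth a ℓ x y ≤ level a ℓ x y := by
  rw [← sub_nonneg, level_sub_depth]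
  have h1 := rise_div_mem hℓ hℓa hx.2 hy
  have h2 := div_fibre_mem hℓ hℓa hx hy.1
  exact mul_nonneg (mul_nonneg hℓ.le h2.1) (by linarith)

theorem depth_le_sub_level (hℓ : 0 < ℓ) (hℓa : ℓ ≤ a) (hx : x ∈ Icc 0 a) (hy : y ∈ Icc 0 a) :
    depth a ℓ x y ≤ ℓ - level a ℓ x y := by
  rw [← sub_nonneg, sub_level_sub_depth]
  have h1 := rise_div_mem hℓ hℓa hx.2 hy
  have h2 := div_fibre_mem hℓ hℓa hx hy.1
  exact mul_nonneg (mul_nonneg hℓ.le (by linarith)) (by linarith)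

theorem depth_le_quarter (hℓ : 0 < ℓ) (hℓa : ℓ ≤ a) (hx : x ≤ a) (hy : y ∈ Icc 0 a) :
    depth a ℓ x y ≤ ℓ / 4 := by
  have h1 := (rise_div_mem hℓ hℓa hx hy).2
  unfold depth
  nlinarith

theorem depth_le_tent (hℓ : 0 < ℓ) (hℓa : ℓ ≤ a) (hx : x ∈ Icc 0 a) (hy : y ∈ Icc 0 a) :
    depth a ℓ x y ≤ tent ℓ (level a ℓ x y) :=
  le_tent (depth_le_level hℓ hℓa hx hy) (depth_le_sub_level hℓ hℓa hx hy)
    (depth_le_quarter hℓ hℓa hx.2 hy)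

theorem level_nonneg (hℓ : 0 < ℓ) (hℓa : ℓ ≤ a) (hx : x ∈ Icc 0 a) (hy : y ∈ Icc 0 a) :
    0 ≤ level a ℓ x y :=
  (depth_nonneg hℓ hℓa hx.2 hy).trans (depth_le_level hℓ hℓa hx hy)

theorem level_le (hℓ : 0 < ℓ) (hℓa : ℓ ≤ a) (hx : x ∈ Icc 0 a) (hy : y ∈ Icc 0 a) :
    level a ℓ x y ≤ ℓ := by
  linarith [depth_nonneg hℓ hℓa hx.2 hy, depth_le_sub_level hℓ hℓa hx hy]

theorem rise_slit (hx : x ≤ ℓ) : rise a ℓ x 0 = 0 := by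
  simp [rise, ledge, hx]

theorem level_slit (hℓ : 0 < ℓ) (hℓa : ℓ ≤ a) (hx : x ≤ ℓ) : level a ℓ x 0 = x := by
  simp only [level, rise_slit hx, fibre, add_zero, min_eq_right hℓa]
  field_simp; ring

theorem depth_slit (hx : x ≤ ℓ) : depth a ℓ x 0 = 0 := by
  simp [depth, rise_slit hx]

theorem depth_eq_tent_of_edge (hℓ : 0 < ℓ) (hℓa : ℓ ≤ a) (hx : x ∈ Icc 0 a) (hy : y ∈ Icc 0 a)
    (hq : x = 0 ∨ x = a ∨ y = 0 ∨ y = a) (hJ : ¬ (y = 0 ∧ 0 < x ∧ x < ℓ)) :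
    depth a ℓ x y = tent ℓ (level a ℓ x y) := by
  have ha := hℓ.trans_le hℓa
  have hle := depth_le_tent hℓ hℓa hx hy
  have h0 := depth_nonneg hℓ hℓa hx.2 hy
  have key : level a ℓ x y ≤ depth a ℓ x y ∨ ℓ - level a ℓ x y ≤ depth a ℓ x y ∨
      ℓ / 4 ≤ depth a ℓ x y := by
    have hfib : x = fibre a ℓ (rise a ℓ x y) → ℓ - level a ℓ x y ≤ depth a ℓ x y := fun h => by
      rw [← sub_nonpos, sub_level_sub_depth, ← h, div_self
        ((hℓ.trans_le (le_fibre hℓa (rise_nonneg hℓ hℓa hx.2 hy.1))).trans_eq h.symm).ne']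
      simp
    by_cases hx0 : x = 0
    · left; rw [← sub_nonpos, level_sub_depth, hx0]; simp
    have hx0' : 0 < x := lt_of_le_of_ne hx.1 (Ne.symm hx0)
    rcases hq with h | h | h | h
    · exact absurd h hx0
    · right; left; apply hfib
      refine le_antisymm (le_fibre_rise hℓ hℓa hx.2 hy.1) ?_
      exact (min_le_left _ _).trans h.ge
    · right; left; apply hfib
      refine le_antisymm (le_fibre_rise hℓ hℓa hx.2 hy.1) ((min_le_right _ _).trans ?_)
      have hxl : ℓ ≤ x := not_lt.1 fun h' => hJ ⟨h, hx0', h'⟩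
      simp [rise, h, ledge, hxl]
    · right; right
      have h3 : rise a ℓ x y = a := by
        have := sub_rise (ℓ := ℓ) (x := x) (y := y) ha
        rw [h, sub_self, zero_mul] at this
        rw [h]; linarith
      unfold depth; rw [h3, div_self ha.ne']; linarith
  refine le_antisymm hle (max_le h0 ?_)
  rcases key with h | h | h
  · exact ((min_le_left _ _).trans (min_le_left _ _)).trans h
  · exact ((min_le_left _ _).trans (min_le_right _ _)).trans h
  · exact (min_le_right _ _).trans h

theorem edge_of_depth_eq_tent (hℓ : 0 < ℓ) (hℓa : ℓ ≤ a) (hx : x ∈ Icc 0 a) (hy : y ∈ Icc 0 a)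
    (h : depth a ℓ x y = tent ℓ (level a ℓ x y)) :
    (x = 0 ∨ x = a ∨ y = 0 ∨ y = a) ∧ ¬ (y = 0 ∧ 0 < x ∧ x < ℓ) := by
  have ha := hℓ.trans_le hℓa
  constructor
  · by_contra! hcon
    obtain ⟨hx0, hxa, hy0, hya⟩ := hcon
    have hx0' : 0 < x := lt_of_le_of_ne hx.1 (Ne.symm hx0)
    have hxa' : x < a := lt_of_le_of_ne hx.2 hxa
    have hy0' : 0 < y := lt_of_le_of_ne hy.1 (Ne.symm hy0)
    have hya' : y < a := lt_of_le_of_ne hy.2 hya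
    have hled := one_sub_ledge_pos hℓ hℓa hx.2
    have hfpos := hℓ.trans_le (le_fibre hℓa (rise_nonneg hℓ hℓa hx.2 hy.1))
    have h1 : rise a ℓ x y / a < 1 := by
      rw [div_lt_one ha]
      have := sub_rise (ℓ := ℓ) (x := x) (y := y) ha
      have := mul_pos (sub_pos.2 hya') hled
      linarith
    have h2 : x < fibre a ℓ (rise a ℓ x y) := by
      refine lt_min hxa' ?_
      have h3 : x - ℓ ≤ ledge ℓ x := le_max_right _ _
      unfold rise
      linarith [mul_pos hy0' hled]
    have h3 : depth a ℓ x y < level a ℓ x y := by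
      rw [← sub_pos, level_sub_depth]
      exact mul_pos (mul_pos hℓ (div_pos hx0' hfpos)) (by linarith)
    have h4 : depth a ℓ x y < ℓ - level a ℓ x y := by
      rw [← sub_pos, sub_level_sub_depth]
      exact mul_pos (mul_pos hℓ (sub_pos.2 ((div_lt_one hfpos).2 h2))) (by linarith)
    have h5 : depth a ℓ x y < ℓ / 4 := by unfold depth; nlinarith
    exact absurd h ((lt_min (lt_min h3 h4) h5).trans_le (le_max_right _ _)).ne
  · rintro ⟨rfl, h0, h1⟩
    rw [depth_slit h1.le, level_slit hℓ hℓa h1.le] at h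
    exact (tent_pos h0 h1).ne h

theorem level_depth_injOn (hℓ : 0 < ℓ) (hℓa : ℓ ≤ a) (hx : x ∈ Icc 0 a) (hy : y ∈ Icc 0 a)
    (h1 : level a ℓ x y = level a ℓ x' y')
    (h2 : depth a ℓ x y = depth a ℓ x' y') : x = x' ∧ y = y' := by
  have ha := hℓ.trans_le hℓa
  have hr : rise a ℓ x y = rise a ℓ x' y' := by
    unfold depth at h2
    field_simp at h2
    exact h2
  have hp := rise_div_mem hℓ hℓa hx.2 hy
  have hf := hℓ.trans_le (le_fibre hℓa (rise_nonneg hℓ hℓa hx.2 hy.1))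
  have hxx : x = x' := by
    unfold level at h1
    rw [← hr] at h1
    have h3 := mul_left_cancel₀ hℓ.ne' h1
    have h4 : x / fibre a ℓ (rise a ℓ x y) = x' / fibre a ℓ (rise a ℓ x y) :=
      mul_right_cancel₀ (b := 1 - rise a ℓ x y / a / 2) (by linarith [hp.2]) (by linarith)
    exact (div_left_inj' hf.ne').1 h4
  refine ⟨hxx, ?_⟩
  subst hxx
  unfold rise at hr
  exact mul_right_cancel₀ (one_sub_ledge_pos hℓ hℓa hx.2).ne' (by linarith)

theorem exists_level_depth {s v : ℝ} (hℓ : 0 < ℓ) (hℓa : ℓ ≤ a) (hv : 0 ≤ v) (h1 : v ≤ s)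
    (h2 : v ≤ ℓ - s) (h3 : v ≤ ℓ / 4) :
    ∃ x ∈ Icc 0 a, ∃ y ∈ Icc 0 a, level a ℓ x y = s ∧ depth a ℓ x y = v := by
  have ha := hℓ.trans_le hℓa
  set h := 4 * a * v / ℓ with hh
  have hh0 : 0 ≤ h := by positivity
  have hha : h ≤ a := by rw [hh, div_le_iff₀ hℓ]; nlinarith
  set D := fibre a ℓ h with hD
  have hDℓ : ℓ ≤ D := le_fibre hℓa hh0
  have hD0 := hℓ.trans_le hDℓ
  have hDa : D ≤ a := min_le_left _ _
  have hDh : D ≤ ℓ + h := min_le_right _ _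
  have hden : 0 < ℓ - 2 * v := by linarith
  set x := D * ((s - v) / (ℓ - 2 * v)) with hx
  have hq0 : 0 ≤ (s - v) / (ℓ - 2 * v) := div_nonneg (by linarith) hden.le
  have hq1 : (s - v) / (ℓ - 2 * v) ≤ 1 := (div_le_one hden).2 (by linarith)
  have hx0 : 0 ≤ x := mul_nonneg hD0.le hq0
  have hxD : x ≤ D := mul_le_of_le_one_right hD0.le hq1
  have hxa : x ≤ a := hxD.trans hDa
  have hbh : ledge ℓ x ≤ h := max_le hh0 (by linarith)
  have hled := one_sub_ledge_pos hℓ hℓa hxa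
  set y := (h - ledge ℓ x) / (1 - ledge ℓ x / a) with hy
  have hrise : rise a ℓ x y = h := by
    unfold rise; rw [hy, div_mul_cancel₀ _ hled.ne']; ring
  have hpa : h / a = 4 * v / ℓ := by rw [hh]; field_simp
  refine ⟨x, ⟨hx0, hxa⟩, y, ⟨div_nonneg (by linarith) hled.le, ?_⟩, ?_, ?_⟩
  · rw [hy, div_le_iff₀ hled, mul_sub, mul_div_cancel₀ _ ha.ne']; linarith
  · unfold level
    have e : (s - v) / (ℓ - 2 * v) * (1 - 4 * v / ℓ / 2) = (s - v) / ℓ := by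
      rw [show 1 - 4 * v / ℓ / 2 = (ℓ - 2 * v) / ℓ by field_simp; ring, div_mul_div_cancel₀ hden.ne']
    rw [hrise, ← hD, hpa, hx, mul_div_cancel_left₀ _ hD0.ne', e]
    field_simp
    ring
  · unfold depth; rw [hrise, hpa]; field_simp

theorem abs_rise_sub_le (hℓ : 0 < ℓ) (hℓa : ℓ ≤ a) (hx : x ≤ a) (hy' : y' ∈ Icc 0 a) :
    |rise a ℓ x y - rise a ℓ x' y'| ≤ |x - x'| + |y - y'| := by
  have ha := hℓ.trans_le hℓa
  have e : rise a ℓ x y - rise a ℓ x' y' =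
      (ledge ℓ x - ledge ℓ x') * (1 - y' / a) + (y - y') * (1 - ledge ℓ x / a) := by
    unfold rise; ring
  have h1 := one_sub_ledge_pos hℓ hℓa hx
  have h2 : ledge ℓ x / a ≥ 0 := div_nonneg ledge_nonneg ha.le
  have h3 : 0 ≤ y' / a := div_nonneg hy'.1 ha.le
  have h4 : y' / a ≤ 1 := (div_le_one ha).2 hy'.2
  rw [e]
  refine (abs_add_le _ _).trans (add_le_add ?_ ?_)
  · rw [abs_mul, abs_of_nonneg (sub_nonneg.2 h4)]
    exact (mul_le_of_le_one_right (abs_nonneg _) (by linarith)).trans abs_ledge_sub_le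
  · rw [abs_mul, abs_of_nonneg h1.le]
    exact mul_le_of_le_one_right (abs_nonneg _) (by linarith)

theorem abs_mul_div_sub_le (hℓ : 0 < ℓ) (hℓa : ℓ ≤ a) (h : ℝ) :
    |ℓ * (h / a) - ℓ * (x / a)| ≤ |h - x| := by
  have ha := hℓ.trans_le hℓa
  rw [show ℓ * (h / a) - ℓ * (x / a) = (h - x) * (ℓ / a) by ring, abs_mul,
    abs_of_pos (div_pos hℓ ha)]
  exact mul_le_of_le_one_right (abs_nonneg _) ((div_le_one ha).2 hℓa)

theorem abs_depth_sub_le (hℓ : 0 < ℓ) (hℓa : ℓ ≤ a) (hx : x ≤ a) (hy' : y' ∈ Icc 0 a) :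
    |depth a ℓ x y - depth a ℓ x' y'| ≤ |x - x'| + |y - y'| := by
  have h1 := abs_rise_sub_le (y := y) (x' := x') hℓ hℓa hx hy'
  have h2 := abs_mul_div_sub_le hℓ hℓa (x := rise a ℓ x' y') (rise a ℓ x y)
  unfold depth
  rw [← sub_div, abs_div, abs_of_pos (by norm_num : (0 : ℝ) < 4)]
  linarith [abs_nonneg (ℓ * (rise a ℓ x y / a) - ℓ * (rise a ℓ x' y' / a))]

/-- The first coordinate of the trapezoid map is Lipschitz with a constant that does not depend on
the proportion of the slit to the square. -/
theorem abs_level_sub_le (hℓ : 0 < ℓ) (hℓa : ℓ ≤ a) (hx : x ∈ Icc 0 a) (hy : y ∈ Icc 0 a)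
    (hx' : x' ∈ Icc 0 a) (hy' : y' ∈ Icc 0 a) :
    |level a ℓ x y - level a ℓ x' y'| ≤ 3 * (|x - x'| + |y - y'|) := by
  have hr := abs_rise_sub_le (y := y) (x' := x') hℓ hℓa hx.2 hy'
  have hp := abs_mul_div_sub_le hℓ hℓa (x := rise a ℓ x' y') (rise a ℓ x y)
  have hm := rise_div_mem hℓ hℓa hx.2 hy
  have hq' := div_fibre_mem hℓ hℓa hx' hy'.1
  set r := rise a ℓ x y
  set r' := rise a ℓ x' y'
  have hD := le_fibre hℓa (rise_nonneg hℓ hℓa hx.2 hy.1)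
  have hD' := le_fibre hℓa (rise_nonneg hℓ hℓa hx'.2 hy'.1)
  have hDD : |fibre a ℓ r - fibre a ℓ r'| ≤ |r - r'| := by
    have := abs_min_sub_min_le_max a (ℓ + r) a (ℓ + r')
    rw [sub_self, abs_zero, add_sub_add_left_eq_sub] at this
    exact this.trans (max_le (abs_nonneg _) le_rfl)
  set D := fibre a ℓ r
  set D' := fibre a ℓ r'
  have hD0 : 0 < D := hℓ.trans_le hD
  have hD0' : 0 < D' := hℓ.trans_le hD'
  have hquot : |ℓ * (x / D) - ℓ * (x' / D')| ≤ |x - x'| + |r - r'| := by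
    have e : ℓ * (x / D) - ℓ * (x' / D') =
        (ℓ / D) * ((x - x') - (x' / D') * (D - D')) := by field_simp; ring
    rw [e, abs_mul, abs_of_pos (div_pos hℓ hD0)]
    refine (mul_le_of_le_one_left (abs_nonneg _) ((div_le_one hD0).2 hD)).trans ?_
    refine (abs_sub _ _).trans (add_le_add le_rfl ?_)
    rw [abs_mul, abs_of_nonneg hq'.1]
    exact (mul_le_of_le_one_left (abs_nonneg _) hq'.2).trans hDD
  have e : level a ℓ x y - level a ℓ x' y' =
      (ℓ * (r / a) - ℓ * (r' / a)) / 4 + (ℓ * (x / D) - ℓ * (x' / D')) * (1 - r / a / 2)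
        - (x' / D') * (ℓ * (r / a) - ℓ * (r' / a)) / 2 := by
    change ℓ * (r / a / 4 + x / D * (1 - r / a / 2)) -
      ℓ * (r' / a / 4 + x' / D' * (1 - r' / a / 2)) = _
    ring
  set u := ℓ * (r / a) - ℓ * (r' / a)
  set w := ℓ * (x / D) - ℓ * (x' / D')
  have h1 : |w * (1 - r / a / 2)| ≤ |w| := by
    rw [abs_mul, abs_of_nonneg (by linarith : 0 ≤ 1 - r / a / 2)]
    exact mul_le_of_le_one_right (abs_nonneg _) (by linarith)
  have h2 : |(x' / D') * u| ≤ |u| := by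
    rw [abs_mul, abs_of_nonneg hq'.1]
    exact mul_le_of_le_one_left (abs_nonneg _) hq'.2
  rw [e, abs_le]
  have := abs_le.1 h1
  have := abs_le.1 h2
  have := abs_le.1 (le_refl |u|)
  have := abs_nonneg (y - y')
  have := abs_nonneg (x - x')
  constructor <;> linarith

end Square

/-! ### Widening the slits -/

instance : Encodable Dyadic := Encodable.ofCountable Dyadic

/-- Positive summable weights on the dyadic positions. -/
def weight (d : Dyadic) : ℝ := (1 / 2) ^ Encodable.encode d

theorem weight_pos (d : Dyadic) : 0 < weight d := by unfold weight; positivity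

theorem summable_weight : Summable weight := summable_geometric_two_encode

/-- The sum of all weights. -/
def totalWeight : ℝ := ∑' d, weight d

theorem weight_le_total (d : Dyadic) : weight d ≤ totalWeight :=
  summable_weight.le_tsum d fun e _ => (weight_pos e).le

theorem totalWeight_nonneg : 0 ≤ totalWeight := tsum_nonneg fun d => (weight_pos d).le

/-- The width at height `y` of the lens that replaces a slit. -/
def width (d : Dyadic) (y : ℝ) : ℝ := weight d * (2 * tent d.slitLength y)

theorem width_nonneg (d : Dyadic) (y : ℝ) : 0 ≤ width d y :=
  mul_nonneg (weight_pos d).le (mul_nonneg zero_le_two (tent_nonneg _ _))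

theorem width_le_weight (d : Dyadic) (y : ℝ) : width d y ≤ weight d := by
  refine mul_le_of_le_one_right (weight_pos d).le ?_
  have := tent_le (s := y) d.slitLength_pos.le
  linarith [d.slitLength_le_side, d.side_le_half]

theorem abs_width_sub_le (d : Dyadic) (y y' : ℝ) :
    |width d y - width d y'| ≤ weight d * (2 * |y - y'|) := by
  rw [width, width, ← mul_sub, ← mul_sub, abs_mul, abs_mul, abs_of_pos (weight_pos d), abs_two]
  exact mul_le_mul_of_nonneg_left (mul_le_mul_of_nonneg_left (abs_tent_sub_le _ _ _) zero_le_two)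
    (weight_pos d).le

theorem width_eq_zero {d : Dyadic} {y : ℝ} (h : y ≤ 0 ∨ d.slitLength ≤ y) : width d y = 0 := by
  rw [width, tent_eq_zero h, mul_zero, mul_zero]

theorem abs_tsum_sub_le {a b : Dyadic → ℝ} {K : ℝ} (ha : Summable a) (hb : Summable b)
    (h : ∀ d, |a d - b d| ≤ weight d * K) : |∑' d, a d - ∑' d, b d| ≤ totalWeight * K := by
  rw [← ha.tsum_sub hb, totalWeight, ← tsum_mul_right]
  exact tsum_of_norm_bounded (f := fun d => a d - b d) (summable_weight.mul_right K).hasSum h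

/-- The total width at height `y` of the lenses in `P`. -/
def stack (P : Set Dyadic) (y : ℝ) : ℝ := ∑' d, P.indicator (fun e => width e y) d

theorem indicator_width_le (P : Set Dyadic) (y : ℝ) (d : Dyadic) :
    P.indicator (fun e => width e y) d ≤ weight d :=
  (indicator_le_self' (fun e _ => width_nonneg e y) d).trans (width_le_weight d y)

theorem indicator_width_nonneg (P : Set Dyadic) (y : ℝ) (d : Dyadic) :
    0 ≤ P.indicator (fun e => width e y) d :=
  indicator_nonneg (fun e _ => width_nonneg e y) d

theorem summable_stack (P : Set Dyadic) (y : ℝ) :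
    Summable fun d => P.indicator (fun e => width e y) d :=
  Summable.of_nonneg_of_le (indicator_width_nonneg P y) (indicator_width_le P y) summable_weight

theorem stack_nonneg (P : Set Dyadic) (y : ℝ) : 0 ≤ stack P y :=
  tsum_nonneg (indicator_width_nonneg P y)

theorem stack_mono {P Q : Set Dyadic} (h : P ⊆ Q) (y : ℝ) : stack P y ≤ stack Q y :=
  (summable_stack P y).tsum_le_tsum
    (fun d => indicator_le_indicator_of_subset h (fun e => width_nonneg e y) d) (summable_stack Q y)

theorem abs_stack_sub_le (P : Set Dyadic) (y y' : ℝ) :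
    |stack P y - stack P y'| ≤ totalWeight * (2 * |y - y'|) := by
  refine abs_tsum_sub_le (summable_stack P y) (summable_stack P y') fun d => ?_
  by_cases hd : d ∈ P
  · simpa [hd] using abs_width_sub_le d y y'
  · simp only [indicator_of_notMem hd, sub_self, abs_zero]
    have := (weight_pos d).le
    positivity

theorem stack_congr {P Q : Set Dyadic} {y : ℝ}
    (h : ∀ d, P.indicator (fun e => width e y) d = Q.indicator (fun e => width e y) d) :
    stack P y = stack Q y := tsum_congr h

theorem stack_eq_zero {P : Set Dyadic} {y : ℝ} (h : ∀ d ∈ P, width d y = 0) : stack P y = 0 := by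
  unfold stack
  rw [← tsum_zero (α := ℝ) (β := Dyadic)]
  exact tsum_congr fun d => by by_cases hd : d ∈ P <;> simp [hd, h]

/-- The dyadic positions to the left of `t`, including `t` itself if `b = true`. -/
def cut (b : Bool) (t : ℝ) : Set Dyadic := {d | d.pos < t ∨ b = true ∧ d.pos = t}

theorem cut_true_subset {t t' : ℝ} (b : Bool) (h : t < t') : cut true t ⊆ cut b t' := by
  rintro d (hd | hd)
  · exact .inl (hd.trans h)
  · exact .inl (hd.2.trans_lt h)

theorem cut_subset_true (b : Bool) (t : ℝ) : cut b t ⊆ cut true t := by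
  rintro d (hd | hd)
  · exact .inl hd
  · exact .inr ⟨rfl, hd.2⟩

theorem cut_false_subset (b : Bool) (t : ℝ) : cut false t ⊆ cut b t := by
  rintro d (hd | hd)
  · exact .inl hd
  · exact absurd hd.1 (by simp)

theorem stack_cut_true (d : Dyadic) (y : ℝ) :
    stack (cut true d.pos) y = stack (cut false d.pos) y + width d y := by
  have h : ∑' e, ({d} : Set Dyadic).indicator (fun e => width e y) e = width d y := by
    refine (tsum_eq_single d fun e he => ?_).trans (by simp)
    exact indicator_of_notMem (by simpa using he) _
  unfold stack
  rw [← h, ← (summable_stack (cut false d.pos) y).tsum_add (summable_stack {d} y)]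
  refine tsum_congr fun e => ?_
  by_cases he : e = d
  · subst he
    have h1 : e ∈ cut true e.pos := .inr ⟨rfl, rfl⟩
    have h2 : e ∉ cut false e.pos := by simp [cut]
    rw [indicator_of_mem h1, indicator_of_notMem h2, indicator_of_mem (mem_singleton e), zero_add]
  · have hne : e.pos ≠ d.pos := fun h => he (Dyadic.pos_injective h)
    have h1 : e ∈ cut true d.pos ↔ e ∈ cut false d.pos := by simp [cut, hne]
    rw [indicator_of_notMem (by simpa using he : e ∉ ({d} : Set Dyadic)), add_zero]
    by_cases h2 : e ∈ cut false d.pos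
    · rw [indicator_of_mem h2, indicator_of_mem (h1.2 h2)]
    · rw [indicator_of_notMem h2, indicator_of_notMem fun h3 => h2 (h1.1 h3)]

theorem stack_cut_top {b : Bool} {t y : ℝ}
    (hy : y = 0 ∨ profile t ≤ y) : stack (cut b t) y = 0 := by
  refine stack_eq_zero fun d hd => width_eq_zero ?_
  rcases hy with rfl | hy
  · exact .inl le_rfl
  · refine .inr (d.slitLength_le_profile.trans ((profile_mono ?_).trans hy))
    rcases hd with hd | hd
    · exact hd.le
    · exact hd.2.le

/-! ### The coordinates on the surface -/

/-- The height of a point after each pillowcase has been flattened into a lens. -/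
def Piece.level : Piece → ℝ
  | .front _ p => p.1 1
  | .back p => p.1 1
  | .pillow d _ q => CuspExample.level d.side d.slitLength (q.1 0) (q.1 1)

/-- The amount by which a point is moved to the right when the slits are widened to lenses. -/
def Piece.shift : Piece → ℝ
  | .front b p => stack (cut b (p.1 0)) (p.1 1)
  | .back _ => 0
  | .pillow d false q =>
      stack (cut false d.pos) (CuspExample.level d.side d.slitLength (q.1 0) (q.1 1)) +
        weight d * depth d.side d.slitLength (q.1 0) (q.1 1)
  | .pillow d true q =>
      stack (cut true d.pos) (CuspExample.level d.side d.slitLength (q.1 0) (q.1 1)) -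
        weight d * depth d.side d.slitLength (q.1 0) (q.1 1)

/-- The sheet: `-1` on the bottom copy and `1` on the rest. -/
def Piece.sheet : Piece → ℝ
  | .back _ => -1
  | _ => 1

section Pillow

variable (d : Dyadic) (q q' : d.square)

theorem sq0 : q.1 0 ∈ Icc 0 d.side := q.2.1
theorem sq1 : q.1 1 ∈ Icc 0 d.side := q.2.2

theorem pillow_level_nonneg : 0 ≤ CuspExample.level d.side d.slitLength (q.1 0) (q.1 1) :=
  level_nonneg d.slitLength_pos d.slitLength_le_side (sq0 d q) (sq1 d q)

theorem pillow_level_le : CuspExample.level d.side d.slitLength (q.1 0) (q.1 1) ≤ d.slitLength :=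
  level_le d.slitLength_pos d.slitLength_le_side (sq0 d q) (sq1 d q)

theorem abs_pillow_level_sub_le :
    |CuspExample.level d.side d.slitLength (q.1 0) (q.1 1) -
      CuspExample.level d.side d.slitLength (q'.1 0) (q'.1 1)| ≤ 6 * dist q.1 q'.1 := by
  have := abs_level_sub_le d.slitLength_pos d.slitLength_le_side (sq0 d q) (sq1 d q)
    (sq0 d q') (sq1 d q')
  linarith [abs_coord_sub_le q.1 q'.1 0, abs_coord_sub_le q.1 q'.1 1]

theorem abs_pillow_depth_sub_le :
    |depth d.side d.slitLength (q.1 0) (q.1 1) -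
      depth d.side d.slitLength (q'.1 0) (q'.1 1)| ≤ 2 * dist q.1 q'.1 := by
  have := abs_depth_sub_le (y := q.1 1) (x' := q'.1 0) d.slitLength_pos d.slitLength_le_side
    (sq0 d q).2 (sq1 d q')
  linarith [abs_coord_sub_le q.1 q'.1 0, abs_coord_sub_le q.1 q'.1 1]

theorem pillow_depth_nonneg : 0 ≤ depth d.side d.slitLength (q.1 0) (q.1 1) :=
  depth_nonneg d.slitLength_pos d.slitLength_le_side (sq0 d q).2 (sq1 d q)

theorem pillow_depth_le : weight d * depth d.side d.slitLength (q.1 0) (q.1 1) ≤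
    weight d * tent d.slitLength (CuspExample.level d.side d.slitLength (q.1 0) (q.1 1)) :=
  mul_le_mul_of_nonneg_left
    (depth_le_tent d.slitLength_pos d.slitLength_le_side (sq0 d q) (sq1 d q)) (weight_pos d).le

end Pillow

theorem Piece.level_nonneg (x : Piece) : 0 ≤ x.level := by
  cases x with
  | front b p => exact height_nonneg p
  | back p => exact height_nonneg p
  | pillow d b q => exact pillow_level_nonneg d q

theorem Piece.level_le_profile (x : Piece) : x.level ≤ profile x.base := by
  cases x with
  | front b p => exact height_le_profile p
  | back p => exact height_le_profile p
  | pillow d b q => exact (pillow_level_le d q).trans d.slitLength_le_profile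

/-- Off the bottom copy, the shift lies between the total widths of the lenses strictly to the left
and of those weakly to the left. -/
theorem Piece.shift_mem {x : Piece} (hx : x.sheet = 1) :
    stack (cut false x.base) x.level ≤ x.shift ∧ x.shift ≤ stack (cut true x.base) x.level := by
  cases x with
  | front b p =>
    exact ⟨stack_mono (cut_false_subset _ _) _, stack_mono (cut_subset_true _ _) _⟩
  | back p => norm_num [Piece.sheet] at hx
  | pillow d b q =>
    have h1 := mul_nonneg (weight_pos d).le (pillow_depth_nonneg d q)
    have h2 := pillow_depth_le d q
    have h3 := stack_cut_true d (CuspExample.level d.side d.slitLength (q.1 0) (q.1 1))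
    have h4 := mul_nonneg (weight_pos d).le (tent_nonneg d.slitLength
      (CuspExample.level d.side d.slitLength (q.1 0) (q.1 1)))
    rw [width] at h3
    cases b <;> simp only [Piece.base, Piece.level, Piece.shift] <;> constructor <;> linarith

theorem Piece.sheet_cases (x : Piece) : x.sheet = 1 ∨ ∃ p, x = .back p := by
  cases x <;> simp [Piece.sheet]

theorem Piece.shift_nonneg (x : Piece) : 0 ≤ x.shift := by
  rcases x.sheet_cases with h | ⟨p, rfl⟩
  · exact (stack_nonneg _ _).trans (Piece.shift_mem h).1
  · exact le_rfl

theorem Glue.level_eq {x y : Piece} (h : Glue x y) : x.level = y.level := by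
  cases h with
  | slit b d p q hp h0 h1 =>
    simp only [Piece.level]
    rw [h0, h1, CuspExample.level_slit d.slitLength_pos d.slitLength_le_side hp.2.2]
  | _ => rfl

theorem Glue.shift_eq {x y : Piece} (h : Glue x y) : x.shift = y.shift := by
  cases h with
  | unslit p hp =>
    simp only [Piece.shift]
    refine stack_congr fun d => ?_
    by_cases hd : d.pos = p.1 0
    · have : width d (p.1 1) = 0 := by
        refine width_eq_zero (.inr (le_of_not_ge fun h => hp d ⟨hd.symm, height_nonneg p, h⟩))
      simp [indicator, this]
    · simp [indicator, cut, hd]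
  | seam b p hp =>
    exact stack_cut_top (hp.imp_right fun h => h.ge)
  | slit b d p q hp h0 h1 =>
    have hl := CuspExample.level_slit d.slitLength_pos d.slitLength_le_side hp.2.2
    have hd := depth_slit (a := d.side) hp.2.2
    cases b <;> simp [Piece.shift, h0, h1, hl, hd, hp.1]
  | edge d q hq hJ =>
    have := depth_eq_tent_of_edge d.slitLength_pos d.slitLength_le_side (sq0 d q) (sq1 d q) hq hJ
    simp only [Piece.shift]
    rw [stack_cut_true, width, this]
    ring

theorem Seg.sheet_eq {x y : Piece} {L : ℝ} (h : Seg x y L) : x.sheet = y.sheet := by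
  cases h <;> rfl

theorem Seg.abs_level_sub_le {x y : Piece} {L : ℝ} (h : Seg x y L) :
    |x.level - y.level| ≤ 6 * L := by
  cases h with
  | pillow d b q q' => exact abs_pillow_level_sub_le d q q'
  | _ =>
    exact (abs_coord_sub_le _ _ 1).trans (le_mul_of_one_le_left dist_nonneg (by norm_num))

theorem Seg.abs_shift_sub_le {x y : Piece} {L : ℝ} (h : Seg x y L) :
    |x.shift - y.shift| ≤ 14 * totalWeight * L := by
  have htot := totalWeight_nonneg
  have hL := h.nonneg
  cases h with
  | frontTransverse p q hpq hseg hslit =>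
    have h2 : |p.1 1 - q.1 1| ≤ dist p.1 q.1 := abs_coord_sub_le _ _ 1
    have key : |stack (cut true (p.1 0)) (p.1 1) - stack (cut false (q.1 0)) (q.1 1)| ≤
        totalWeight * (2 * |p.1 1 - q.1 1|) := by
      refine abs_tsum_sub_le (summable_stack _ _) (summable_stack _ _) fun d => ?_
      rcases le_or_gt d.pos (p.1 0) with hd | hd
      · have h3 : d ∈ cut true (p.1 0) := hd.lt_or_eq.imp_right fun h => ⟨rfl, h⟩
        have h4 : d ∈ cut false (q.1 0) := .inl (hd.trans_lt hpq)
        rw [indicator_of_mem h3, indicator_of_mem h4]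
        exact abs_width_sub_le _ _ _
      · have h3 : d ∉ cut true (p.1 0) := fun h => h.elim hd.not_gt fun h => hd.ne' h.2
        rw [indicator_of_notMem h3]
        rcases lt_or_ge d.pos (q.1 0) with hd' | hd'
        · have h4 : d ∈ cut false (q.1 0) := .inl hd'
          rw [indicator_of_mem h4]
          -- the segment passes above the slit, where the width of the lens vanishes
          set u := (d.pos - p.1 0) / (q.1 0 - p.1 0) with hu
          have hu0 : 0 < u := div_pos (by linarith) (by linarith)
          have hu1 : u < 1 := (div_lt_one (by linarith)).2 (by linarith)
          have hz : AffineMap.lineMap p.1 q.1 u ∈ openSegment ℝ p.1 q.1 := by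
            rw [openSegment_eq_image_lineMap]; exact mem_image_of_mem _ ⟨hu0, hu1⟩
          have hz0 : (AffineMap.lineMap p.1 q.1 u : Plane) 0 = d.pos := by
            rw [coord_lineMap, hu, div_mul_cancel₀ _ (by linarith)]; ring
          have hzr := hseg (openSegment_subset_segment ℝ _ _ hz)
          have hz1 : d.slitLength ≤ (AffineMap.lineMap p.1 q.1 u : Plane) 1 :=
            le_of_not_ge fun h => hslit _ hz d ⟨hz0, hzr.2.2.1, h⟩
          rw [← width_eq_zero (.inr hz1)]
          refine (abs_width_sub_le _ _ _).trans ?_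
          refine mul_le_mul_of_nonneg_left (mul_le_mul_of_nonneg_left ?_ zero_le_two)
            (weight_pos d).le
          rw [coord_lineMap, show p.1 1 + u * (q.1 1 - p.1 1) - q.1 1 =
            (1 - u) * (p.1 1 - q.1 1) by ring, abs_mul, abs_of_pos (by linarith)]
          exact mul_le_of_le_one_left (abs_nonneg _) (by linarith)
        · have h4 : d ∉ cut false (q.1 0) := fun h => h.elim hd'.not_gt fun h => by simp at h
          rw [indicator_of_notMem h4, sub_self, abs_zero]
          have := (weight_pos d).le
          positivity
    change |stack (cut true (p.1 0)) (p.1 1) - stack (cut false (q.1 0)) (q.1 1)| ≤ _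
    nlinarith
  | frontVertical b p q hpq =>
    have h2 : |p.1 1 - q.1 1| ≤ dist p.1 q.1 := abs_coord_sub_le _ _ 1
    have key := abs_stack_sub_le (cut b (p.1 0)) (p.1 1) (q.1 1)
    change |stack (cut b (p.1 0)) (p.1 1) - stack (cut b (q.1 0)) (q.1 1)| ≤ _
    rw [← hpq]
    nlinarith
  | back p q hseg =>
    simp only [Piece.shift, sub_self, abs_zero]
    positivity
  | pillow d b q q' =>
    have h1 := abs_pillow_level_sub_le d q q'
    have h2 := abs_pillow_depth_sub_le d q q'
    have h3 := abs_stack_sub_le (cut b d.pos)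
      (CuspExample.level d.side d.slitLength (q.1 0) (q.1 1))
      (CuspExample.level d.side d.slitLength (q'.1 0) (q'.1 1))
    have h4 : |weight d * depth d.side d.slitLength (q.1 0) (q.1 1) -
        weight d * depth d.side d.slitLength (q'.1 0) (q'.1 1)| ≤
          totalWeight * (2 * dist q.1 q'.1) := by
      rw [← mul_sub, abs_mul, abs_of_pos (weight_pos d)]
      exact mul_le_mul (weight_le_total d) h2 (abs_nonneg _) htot
    have h5 := mul_le_mul_of_nonneg_left h1 htot
    have h3' := abs_le.1 h3
    have h4' := abs_le.1 h4
    cases b <;> simp only [Piece.shift] <;> rw [abs_le] <;> constructor <;> linarith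

theorem lipschitzWith_level : LipschitzWith 6 Piece.level :=
  LipschitzWith.of_dist_le_mul fun x y => abs_sub_le_mul_dist (K := 6) (fun _ _ h => h.level_eq)
    (fun _ _ _ h => h.abs_level_sub_le) (by norm_num) x y

theorem lipschitzWith_shift :
    LipschitzWith ⟨14 * totalWeight, by have := totalWeight_nonneg; positivity⟩ Piece.shift :=
  LipschitzWith.of_dist_le_mul fun x y => abs_sub_le_mul_dist (K := 14 * totalWeight)
    (fun _ _ h => h.shift_eq) (fun _ _ _ h => h.abs_shift_sub_le)
    (by have := totalWeight_nonneg; positivity) x y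

/-- The radius in `[0, 1)` obtained from the radius `t` by adding `S` in the coordinate
`1 / (1 - t)`. -/
def outer (t S : ℝ) : ℝ := 1 - (1 - t) / (1 + S * (1 - t))

section Outer

variable {t t' S S' : ℝ}

theorem outer_zero : outer t 0 = t := by simp [outer]

theorem outer_lt_one (ht : t < 1) (hS : 0 ≤ S) : outer t S < 1 := by
  have : 0 < (1 - t) / (1 + S * (1 - t)) :=
    div_pos (by linarith) (by nlinarith [mul_nonneg hS (by linarith : 0 ≤ 1 - t)])
  unfold outer; linarith

theorem le_outer (ht : t ≤ 1) (hS : 0 ≤ S) : t ≤ outer t S := by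
  have h := mul_nonneg hS (by linarith : 0 ≤ 1 - t)
  have : (1 - t) / (1 + S * (1 - t)) ≤ 1 - t :=
    div_le_self (by linarith) (by linarith)
  unfold outer; linarith

theorem one_div_one_sub_outer (ht : t < 1) : 1 / (1 - outer t S) = 1 / (1 - t) + S := by
  have : 1 - t ≠ 0 := by linarith
  unfold outer
  rw [sub_sub_cancel, one_div_div]
  field_simp

theorem abs_outer_sub_le (ht0 : 0 ≤ t) (ht : t ≤ 1) (ht0' : 0 ≤ t') (ht' : t' ≤ 1) (hS : 0 ≤ S)
    (hS' : 0 ≤ S') : |outer t S - outer t' S'| ≤ |t - t'| + |S - S'| := by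
  have hu : 0 ≤ S * (1 - t) := mul_nonneg hS (by linarith)
  have hu' : 0 ≤ S' * (1 - t') := mul_nonneg hS' (by linarith)
  have e : outer t S - outer t' S' =
      ((t - t') + (1 - t) * (1 - t') * (S - S')) /
        ((1 + S * (1 - t)) * (1 + S' * (1 - t'))) := by
    have h1 : 1 + S * (1 - t) ≠ 0 := by linarith
    have h2 : 1 + S' * (1 - t') ≠ 0 := by linarith
    unfold outer
    generalize hA : 1 + S * (1 - t) = A at h1
    generalize hB : 1 + S' * (1 - t') = B at h2
    field_simp
    rw [← hA, ← hB]
    ring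
  have h3 : 0 ≤ (1 - t) * (1 - t') := mul_nonneg (by linarith) (by linarith)
  rw [e, abs_div, abs_of_pos (by positivity : 0 < (1 + S * (1 - t)) * (1 + S' * (1 - t')))]
  refine (div_le_self (abs_nonneg _) (by nlinarith)).trans ((abs_add_le _ _).trans ?_)
  rw [abs_mul, abs_of_nonneg h3]
  exact add_le_add le_rfl (mul_le_of_le_one_left (abs_nonneg _) (by nlinarith))

end Outer

/-- The radius of a point after the slits have been widened. -/
def Piece.radius (x : Piece) : ℝ := outer x.base x.shift

theorem Piece.base_le_radius (x : Piece) : x.base ≤ x.radius :=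
  le_outer x.base_mem.2.le x.shift_nonneg

theorem Piece.radius_lt_one (x : Piece) : x.radius < 1 :=
  outer_lt_one x.base_mem.2 x.shift_nonneg

theorem Piece.radius_nonneg (x : Piece) : 0 ≤ x.radius := x.base_mem.1.trans x.base_le_radius

theorem Piece.level_le_radius (x : Piece) : x.level ≤ profile x.radius :=
  x.level_le_profile.trans (profile_mono x.base_le_radius)

theorem Piece.radius_mem (x : Piece) : x.radius ∈ Icc (0 : ℝ) 1 :=
  ⟨x.radius_nonneg, x.radius_lt_one.le⟩

/-- A function that vanishes on the seam and is positive elsewhere. -/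
def Piece.bulge (x : Piece) : ℝ := x.level * (profile x.radius - x.level)

theorem Piece.bulge_nonneg (x : Piece) : 0 ≤ x.bulge :=
  mul_nonneg x.level_nonneg (sub_nonneg.2 x.level_le_radius)

theorem abs_bulge_sub_le (x y : Piece) :
    |x.bulge - y.bulge| ≤ |x.base - y.base| + |x.shift - y.shift| + |x.level - y.level| := by
  have h1 := abs_profile_sub_le x.radius_mem y.radius_mem
  have h2 : |x.radius - y.radius| ≤ |x.base - y.base| + |x.shift - y.shift| :=
    abs_outer_sub_le x.base_mem.1 x.base_mem.2.le y.base_mem.1 y.base_mem.2.le x.shift_nonneg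
      y.shift_nonneg
  have hF := profile_le_third y.radius_nonneg y.radius_lt_one.le
  have hF' := profile_le_third x.radius_nonneg x.radius_lt_one.le
  have hx := x.level_le_radius
  have hy := y.level_le_radius
  have hx0 := x.level_nonneg
  have hy0 := y.level_nonneg
  have e : x.bulge - y.bulge = x.level * (profile x.radius - profile y.radius) +
      (x.level - y.level) * (profile y.radius - x.level - y.level) := by
    unfold Piece.bulge; ring
  rw [e]
  refine (abs_add_le _ _).trans (add_le_add ?_ ?_)
  · rw [abs_mul, abs_of_nonneg hx0]
    exact (mul_le_of_le_one_left (abs_nonneg _) (by linarith)).trans (h1.trans h2)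
  · rw [abs_mul]
    exact mul_le_of_le_one_right (abs_nonneg _) (abs_le.2 ⟨by linarith, by linarith⟩)

/-- The bulge with the sign of the sheet: it separates the top from the bottom copy. -/
def Piece.signed (x : Piece) : ℝ := x.sheet * x.bulge

theorem Glue.radius_eq {x y : Piece} (h : Glue x y) : x.radius = y.radius := by
  rw [Piece.radius, Piece.radius, h.base_eq, h.shift_eq]

theorem Glue.bulge_eq {x y : Piece} (h : Glue x y) : x.bulge = y.bulge := by
  rw [Piece.bulge, Piece.bulge, h.level_eq, h.radius_eq]

theorem Piece.radius_back (p : region) : (Piece.back p).radius = p.1 0 := outer_zero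

theorem Glue.signed_eq {x y : Piece} (h : Glue x y) : x.signed = y.signed := by
  have hb := h.bulge_eq
  cases h with
  | seam b p hp =>
    have h0 : (Piece.back p).bulge = 0 := by
      rw [Piece.bulge, Piece.radius_back]
      rcases hp with hp | hp <;> simp [Piece.level, hp]
    rw [Piece.signed, Piece.signed, hb, h0, mul_zero, mul_zero]
  | _ => rw [Piece.signed, Piece.signed, hb]; rfl

theorem Seg.abs_signed_sub_le {x y : Piece} {L : ℝ} (h : Seg x y L) :
    |x.signed - y.signed| ≤ (7 + 14 * totalWeight) * L := by
  have hs : |y.sheet| = 1 := by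
    rcases y.sheet_cases with h | ⟨p, rfl⟩
    · rw [h, abs_one]
    · simp [Piece.sheet]
  rw [Piece.signed, Piece.signed, h.sheet_eq, ← mul_sub, abs_mul, hs, one_mul]
  have h1 := abs_bulge_sub_le x y
  have h2 := h.abs_base_sub_le
  have h3 := h.abs_shift_sub_le
  have h4 := h.abs_level_sub_le
  linarith

theorem lipschitzWith_signed :
    LipschitzWith ⟨7 + 14 * totalWeight, by have := totalWeight_nonneg; positivity⟩
      Piece.signed :=
  LipschitzWith.of_dist_le_mul fun x y => abs_sub_le_mul_dist (K := 7 + 14 * totalWeight)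
    (fun _ _ h => h.signed_eq) (fun _ _ _ h => h.abs_signed_sub_le)
    (by have := totalWeight_nonneg; positivity) x y

/-! ### The coordinates determine the point -/

theorem Piece.one_div_radius (x : Piece) : 1 / (1 - x.radius) = 1 / (1 - x.base) + x.shift :=
  one_div_one_sub_outer x.base_mem.2

theorem base_le_of_radius_eq {x y : Piece} (hx : x.sheet = 1) (hy : y.sheet = 1)
    (hr : x.radius = y.radius) (hl : x.level = y.level) : x.base ≤ y.base := by
  by_contra! h
  have h1 := x.one_div_radius
  rw [hr, y.one_div_radius] at h1
  have h2 := (Piece.shift_mem hx).1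
  have h3 := (Piece.shift_mem hy).2
  have h4 := stack_mono (cut_true_subset false h) x.level
  have h5 : 1 / (1 - y.base) < 1 / (1 - x.base) :=
    one_div_lt_one_div_of_lt (by linarith [x.base_mem.2]) (by linarith)
  rw [← hl] at h3
  linarith

theorem pillow_dist_eq_zero {d : Dyadic} {b b' : Bool} {q q' : d.square}
    (hl : (Piece.pillow d b q).level = (Piece.pillow d b' q').level)
    (hs : (Piece.pillow d b q).shift = (Piece.pillow d b' q').shift) :
    dist (Piece.pillow d b q) (.pillow d b' q') = 0 := by
  wlog hbb : b = b' ∨ b = false ∧ b' = true generalizing b b' q q'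
  · rw [dist_comm]
    refine this hl.symm hs.symm (.inr ?_)
    cases b <;> cases b' <;> simp_all
  have hw := weight_pos d
  have heq : depth d.side d.slitLength (q.1 0) (q.1 1) =
      depth d.side d.slitLength (q'.1 0) (q'.1 1) → q = q' := fun hd => by
    have := level_depth_injOn d.slitLength_pos d.slitLength_le_side (sq0 d q) (sq1 d q) hl hd
    exact square_ext this.1 this.2
  rcases hbb with rfl | ⟨rfl, rfl⟩
  · have : q = q' := by
      refine heq (mul_left_cancel₀ hw.ne' ?_)
      cases b <;> simp only [Piece.level] at hl <;> simp only [Piece.shift, hl] at hs <;> linarith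
    rw [this, dist_self]
  · simp only [Piece.level] at hl
    simp only [Piece.shift, stack_cut_true, width, hl] at hs
    have h1 := pillow_depth_le d q
    have h2 := pillow_depth_le d q'
    rw [hl] at h1
    have h3 : weight d * depth d.side d.slitLength (q.1 0) (q.1 1) =
      weight d * depth d.side d.slitLength (q'.1 0) (q'.1 1) := by linarith
    have hqq : q = q' := heq (mul_left_cancel₀ hw.ne' h3)
    subst hqq
    have h4 : depth d.side d.slitLength (q.1 0) (q.1 1) =
        tent d.slitLength (CuspExample.level d.side d.slitLength (q.1 0) (q.1 1)) :=
      mul_left_cancel₀ hw.ne' (by linarith)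
    have h5 := edge_of_depth_eq_tent d.slitLength_pos d.slitLength_le_side (sq0 d q) (sq1 d q) h4
    exact (Glue.edge d q h5.1 h5.2).dist_eq

theorem dist_eq_zero_of_glue {x x' y y' : Piece} (hx : dist x x' = 0) (hy : dist y y' = 0)
    (h : dist x' y' = 0) : dist x y = 0 := by
  refine le_antisymm ?_ dist_nonneg
  have h1 := dist_triangle x x' y
  have h2 := dist_triangle x' y' y
  rw [dist_comm y'] at h2
  linarith

/-- A point of a slit is glued to a point of the pillowcase. -/
theorem exists_glue_pillow {d : Dyadic} {p : region} (hp : p.1 ∈ d.slit) (b : Bool) :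
    ∃ q : d.square, Glue (.front b p) (.pillow d b q) :=
  ⟨⟨!₂[p.1 1, 0], by
    simpa [Dyadic.square, d.side_nonneg] using ⟨hp.2.1, hp.2.2.trans d.slitLength_le_side⟩⟩,
    .slit b d p _ hp (by simp) (by simp)⟩

theorem dist_eq_zero_of_top {x y : Piece} (hx : x.sheet = 1) (hy : y.sheet = 1)
    (hr : x.radius = y.radius) (hl : x.level = y.level) : dist x y = 0 := by
  have hb : x.base = y.base :=
    le_antisymm (base_le_of_radius_eq hx hy hr hl) (base_le_of_radius_eq hy hx hr.symm hl.symm)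
  have hs : x.shift = y.shift := by
    have h1 := x.one_div_radius
    rw [hr, y.one_div_radius, hb] at h1
    linarith
  -- move points on slits to the pillowcases
  have hpil : ∀ {d b q} {z : Piece}, z.sheet = 1 → z.base = d.pos →
      z.level = (Piece.pillow d b q).level → z.shift = (Piece.pillow d b q).shift →
      dist z (.pillow d b q) = 0 := by
    intro d b q z hz hzb hzl hzs
    cases z with
    | front b' p =>
      obtain ⟨q', hq'⟩ := exists_glue_pillow (d := d) (p := p)
        ⟨hzb, height_nonneg p, hzl.trans_le (pillow_level_le d q)⟩ b'
      exact dist_eq_zero_of_glue hq'.dist_eq (dist_self _)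
        (pillow_dist_eq_zero (hq'.level_eq.symm.trans hzl) (hq'.shift_eq.symm.trans hzs))
    | back p => norm_num [Piece.sheet] at hz
    | pillow e b' q' =>
      obtain rfl := Dyadic.pos_injective hzb
      exact pillow_dist_eq_zero hzl hzs
  cases y with
  | back p => norm_num [Piece.sheet] at hy
  | pillow d b q => exact hpil hx hb hl hs
  | front b p =>
    cases x with
    | back p => norm_num [Piece.sheet] at hx
    | pillow d b' q =>
      rw [dist_comm]
      exact hpil hy hb.symm hl.symm hs.symm
    | front b' p' =>
      obtain rfl : p' = p := region_ext hb hl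
      by_cases hp : ∃ d : Dyadic, p'.1 ∈ d.slit
      · obtain ⟨d, hd⟩ := hp
        obtain ⟨q, hq⟩ := exists_glue_pillow hd b
        exact dist_eq_zero_of_glue (dist_self _) hq.dist_eq (hpil hx hd.1
          (hl.trans hq.level_eq) (hs.trans hq.shift_eq))
      · have h1 := (Glue.unslit p' fun d hd => hp ⟨d, hd⟩).dist_eq
        cases b <;> cases b'
        · exact dist_self _
        · rwa [dist_comm]
        · exact h1
        · exact dist_self _

/-- Radius, height and signed bulge separate the points of the surface. -/
theorem dist_eq_zero_of_coords {x y : Piece} (hr : x.radius = y.radius) (hl : x.level = y.level)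
    (hV : x.signed = y.signed) : dist x y = 0 := by
  have hmix : ∀ {z : Piece} {p : region}, z.sheet = 1 → z.radius = (Piece.back p).radius →
      z.level = (Piece.back p).level → z.signed = (Piece.back p).signed →
      dist z (.back p) = 0 := by
    intro z p hz hzr hzl hzV
    have h0 : (Piece.back p).bulge = 0 := by
      have h1 := z.bulge_nonneg
      have h2 := (Piece.back p).bulge_nonneg
      have h3 : (Piece.back p).signed = -(Piece.back p).bulge := by simp [Piece.signed, Piece.sheet]
      have h4 : z.signed = z.bulge := by rw [Piece.signed, hz, one_mul]
      linarith
    have h5 : Glue (.front false p) (.back p) := by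
      refine .seam false p ?_
      rw [Piece.bulge, Piece.radius_back] at h0
      rcases mul_eq_zero.1 h0 with h | h
      · exact .inl h
      · exact .inr (sub_eq_zero.1 h).symm
    exact dist_eq_zero_of_glue (dist_self _) ((dist_comm _ _).trans h5.dist_eq)
      (dist_eq_zero_of_top hz rfl (hzr.trans h5.radius_eq.symm) (hzl.trans h5.level_eq.symm))
  rcases x.sheet_cases with hx | ⟨p, rfl⟩ <;> rcases y.sheet_cases with hy | ⟨p', rfl⟩
  · exact dist_eq_zero_of_top hx hy hr hl
  · exact hmix hx hr hl hV
  · rw [dist_comm]; exact hmix hy hr.symm hl.symm hV.symm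
  · rw [Piece.radius_back, Piece.radius_back] at hr
    rw [region_ext hr hl, dist_self]

/-! ### All values of the coordinates occur -/

theorem exists_back {R y : ℝ} (h0 : 0 ≤ R) (h1 : R < 1) (hy : 0 ≤ y) (hy' : y ≤ profile R) :
    ∃ x : Piece, x.sheet = -1 ∧ x.radius = R ∧ x.level = y :=
  ⟨.back ⟨!₂[R, y], pt_mem h0 h1 hy hy'⟩, rfl, by rw [Piece.radius_back]; simp,
    by simp [Piece.level]⟩

theorem tendsto_stack {u : ℕ → ℝ} {P : Set Dyadic} (y : ℝ)
    (h : ∀ d : Dyadic, ∀ᶠ n in atTop, (d ∈ cut false (u n) ↔ d ∈ P)) :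
    Tendsto (fun n => stack (cut false (u n)) y) atTop (𝓝 (stack P y)) := by
  refine tendsto_tsum_of_dominated_convergence summable_weight (fun d => ?_) (.of_forall ?_)
  · refine tendsto_const_nhds.congr' ?_
    filter_upwards [h d] with n hn
    by_cases hd : d ∈ P
    · rw [indicator_of_mem hd, indicator_of_mem (hn.2 hd)]
    · rw [indicator_of_notMem hd, indicator_of_notMem fun h' => hd (hn.1 h')]
  · intro n d
    rw [Real.norm_of_nonneg (indicator_width_nonneg _ _ _)]
    exact indicator_width_le _ _ _

/-- Every radius and height occur off the bottom copy: either the right radius is reached between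
two lenses, or it lies in a lens. -/
theorem exists_top {R y : ℝ} (h0 : 0 ≤ R) (h1 : R < 1) (hy : 0 ≤ y) (hy' : y ≤ profile R) :
    ∃ x : Piece, x.sheet = 1 ∧ x.radius = R ∧ x.level = y := by
  obtain ⟨t₀, ⟨ht00, ht0R⟩, ht0⟩ : ∃ t ∈ Icc 0 R, profile t = y :=
    intermediate_value_Icc h0 continuous_profile.continuousOn ⟨by rwa [profile_zero], hy'⟩
  -- The position is the last one at which the shift from the lenses strictly to its left does not
  -- exceed the radius.
  set T := 1 / (1 - R) with hT
  let g : ℝ → ℝ := fun t => 1 / (1 - t) + stack (cut false t) y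
  have hle : ∀ {t}, t < 1 → 1 / (1 - t) ≤ T → t ≤ R := fun {t} ht h => by
    have := le_of_one_div_le_one_div (by linarith) h; linarith
  set A : Set ℝ := {t | t₀ ≤ t ∧ t < 1 ∧ g t ≤ T} with hA
  have hAR : ∀ t ∈ A, t ≤ R := fun t ht =>
    hle ht.2.1 (by have := ht.2.2; have := stack_nonneg (cut false t) y; simp only [g] at *; linarith)
  have ht0A : t₀ ∈ A := by
    refine ⟨le_rfl, by linarith, ?_⟩
    have h2 : stack (cut false t₀) y = 0 :=
      stack_cut_top (.inr ht0.le)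
    simp only [g, h2, add_zero, hT]
    exact one_div_le_one_div_of_le (by linarith) (by linarith)
  have hbdd : BddAbove A := ⟨R, hAR⟩
  set t := sSup A with ht
  have htt0 : t₀ ≤ t := le_csSup hbdd ht0A
  have htR : t ≤ R := csSup_le ⟨t₀, ht0A⟩ hAR
  have ht1 : t < 1 := htR.trans_lt h1
  have hleft : g t ≤ T := by
    obtain ⟨u, -, hu, huA⟩ := exists_seq_tendsto_sSup ⟨t₀, ht0A⟩ hbdd
    have hlim : Tendsto (fun n => g (u n)) atTop (𝓝 (g t)) := by
      refine Tendsto.add ?_ (tendsto_stack y fun d => ?_)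
      · exact tendsto_const_nhds.div (tendsto_const_nhds.sub hu) (by linarith)
      · rcases lt_or_ge d.pos t with hd | hd
        · filter_upwards [hu.eventually_const_lt hd] with n hn
          exact ⟨fun _ => .inl hd, fun _ => .inl hn⟩
        · refine .of_forall fun n => ?_
          have := le_csSup hbdd (huA n)
          simp only [cut, mem_ofPred_eq, Bool.false_eq_true, false_and, or_false]
          constructor <;> intro h <;> linarith
    exact le_of_tendsto' hlim fun n => (huA n).2.2
  have hright : T ≤ 1 / (1 - t) + stack (cut true t) y := by
    obtain ⟨u, -, hu, hulim⟩ := exists_seq_strictAnti_tendsto' ht1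
    have hlim : Tendsto (fun n => g (u n)) atTop (𝓝 (1 / (1 - t) + stack (cut true t) y)) := by
      refine Tendsto.add ?_ (tendsto_stack y fun d => ?_)
      · exact tendsto_const_nhds.div (tendsto_const_nhds.sub hulim) (by linarith)
      · rcases le_or_gt d.pos t with hd | hd
        · refine .of_forall fun n => ⟨fun _ => ?_, fun _ => .inl (hd.trans_lt (hu n).1)⟩
          exact hd.lt_or_eq.imp_right fun h => ⟨rfl, h⟩
        · filter_upwards [hulim.eventually_lt_const hd] with n hn
          constructor
          · rintro (h | h)
            · linarith
            · simp at h
          · rintro (h | h)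
            · linarith
            · linarith [h.2]
    refine ge_of_tendsto' hlim fun n => le_of_not_ge fun h => ?_
    exact absurd (le_csSup hbdd ⟨htt0.trans (hu n).1.le, (hu n).2, h⟩) (not_le.2 (hu n).1)
  have hyt : y ≤ profile t := ht0 ▸ profile_mono htt0
  have hfin : ∀ x : Piece, x.base = t → 1 / (1 - t) + x.shift = T → x.radius = R := by
    intro x hx hxs
    have h2 := x.one_div_radius
    rw [hx, hxs, hT, one_div, one_div, inv_inj] at h2
    linarith
  rcases hleft.eq_or_lt with heq | hlt
  · refine ⟨.front false ⟨!₂[t, y], pt_mem (ht00.trans htt0) ht1 hy hyt⟩, rfl, hfin _ ?_ ?_, ?_⟩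
    · simp [Piece.base]
    · simpa [Piece.shift, g] using heq
    · simp [Piece.level]
  · obtain ⟨d, hdt⟩ : ∃ d : Dyadic, d.pos = t := by
      by_contra! hcon
      have : cut true t = cut false t := by
        ext d; simp [cut, hcon d]
      rw [this] at hright
      exact absurd hright (not_le.2 hlt)
    clear_value t
    subst hdt
    rw [stack_cut_true] at hright
    simp only [g] at hlt
    have hw := weight_pos d
    set e := (T - (1 / (1 - d.pos) + stack (cut false d.pos) y)) / weight d with he
    have he0 : 0 < e := div_pos (by linarith) hw
    have heT : weight d * e = T - (1 / (1 - d.pos) + stack (cut false d.pos) y) :=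
      mul_div_cancel₀ _ hw.ne'
    have he2 : e ≤ 2 * tent d.slitLength y := by
      rw [he, div_le_iff₀ hw]; rw [width] at hright; linarith
    have htent := le_of_le_tent (by linarith : 0 < tent d.slitLength y) le_rfl
    rcases le_total e (tent d.slitLength y) with hcase | hcase
    · obtain ⟨a, ha, b, hb, hab, hab'⟩ := exists_level_depth (s := y) (v := e) d.slitLength_pos
        d.slitLength_le_side he0.le (by linarith) (by linarith) (by linarith)
      refine ⟨.pillow d false ⟨!₂[a, b], by simpa [Dyadic.square] using ⟨ha, hb⟩⟩, rfl,
        hfin _ rfl ?_, ?_⟩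
      · simp [Piece.shift, hab, hab', heT]
        ring
      · simp [Piece.level, hab]
    · obtain ⟨a, ha, b, hb, hab, hab'⟩ := exists_level_depth (s := y)
        (v := 2 * tent d.slitLength y - e) d.slitLength_pos
        d.slitLength_le_side (by linarith) (by linarith) (by linarith) (by linarith)
      refine ⟨.pillow d true ⟨!₂[a, b], by simpa [Dyadic.square] using ⟨ha, hb⟩⟩, rfl,
        hfin _ rfl ?_, ?_⟩
      · simp [Piece.shift, hab, hab', stack_cut_true, width, mul_sub, heT]
        ring
      · simp [Piece.level, hab]

/-! ### Compactness of the part of the surface away from the open end -/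

theorem continuous_base : Continuous Piece.base := lipschitzWith_base.continuous

theorem Piece.height_mem (x : Piece) : 0 ≤ x.height ∧ x.height ≤ profile x.base := by
  cases x with
  | front b p => exact ⟨height_nonneg p, height_le_profile p⟩
  | back p => exact ⟨height_nonneg p, height_le_profile p⟩
  | pillow d b q =>
    exact ⟨le_min q.2.1.1 d.slitLength_pos.le, (min_le_right _ _).trans d.slitLength_le_profile⟩

theorem isCompact_face (d : Dyadic) (b : Bool) : IsCompact (range fun q => Piece.pillow d b q) := by
  let g : Icc (0 : ℝ) d.side × Icc (0 : ℝ) d.side → Piece := fun u =>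
    .pillow d b ⟨!₂[(u.1 : ℝ), (u.2 : ℝ)], by simpa [Dyadic.square] using ⟨u.1.2, u.2.2⟩⟩
  have hg : LipschitzWith 2 g := LipschitzWith.of_dist_le_mul fun u v => by
    refine (dist_pillow_le d b _ _).trans ?_
    have h1 : dist u.1 v.1 ≤ dist u v := le_max_left _ _
    have h2 : dist u.2 v.2 ≤ dist u v := le_max_right _ _
    rw [Subtype.dist_eq, Real.dist_eq] at h1 h2
    simpa [two_mul] using add_le_add h1 h2
  have : (range fun q => Piece.pillow d b q) ⊆ range g := by
    rintro _ ⟨q, rfl⟩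
    refine ⟨(⟨_, q.2.1⟩, ⟨_, q.2.2⟩), ?_⟩
    exact congrArg _ (square_ext (by simp) (by simp))
  rw [this.antisymm (by rintro _ ⟨u, rfl⟩; exact mem_range_self _)]
  exact isCompact_range hg.continuous

theorem ultrafilter_le_nhds_of_dist_le {F : Filter Piece} {z : Piece} {t y : ℝ}
    (ht : Tendsto Piece.base F (𝓝 t)) (hy : Tendsto Piece.height F (𝓝 y))
    (h : ∀ᶠ x in F, dist x z ≤ |x.base - t| + |x.height - y|) : F ≤ 𝓝 z := by
  refine tendsto_id'.1 (tendsto_iff_dist_tendsto_zero.2 ?_)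
  refine squeeze_zero' (.of_forall fun _ => dist_nonneg) h ?_
  have h1 : Tendsto (fun x => |Piece.base x - t|) F (𝓝 0) := by
    simpa using (ht.sub_const t).abs
  have h2 : Tendsto (fun x => |Piece.height x - y|) F (𝓝 0) := by
    simpa using (hy.sub_const y).abs
  simpa using h1.add h2

/-- An ultrafilter on the top copy whose projection to the region converges is itself convergent:
the side of the limit at a possible slit is the side from which the limit is approached. -/
theorem exists_limit_front {F : Ultrafilter Piece} {b : Bool} {p : region}
    (hb : ∀ᶠ x in (F : Filter Piece), ∃ q, x = .front b q)
    (ht : Tendsto Piece.base F (𝓝 (p.1 0))) (hy : Tendsto Piece.height F (𝓝 (p.1 1))) :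
    ∃ z, (F : Filter Piece) ≤ 𝓝 z := by
  rcases (height_nonneg p).eq_or_lt with hy0 | hy0
  · refine ⟨.back p, ultrafilter_le_nhds_of_dist_le ht hy ?_⟩
    filter_upwards [hb]
    rintro _ ⟨q, rfl⟩
    have h1 := dist_front_floor b q
    have h2 := dist_back_le (floorPt q) p
    have h3 := dist_triangle (Piece.front b q) (.back (floorPt q)) (.back p)
    simp only [floorPt_zero, floorPt_one, ← hy0, sub_self, abs_zero, add_zero] at h2
    simp only [Piece.base, Piece.height, ← hy0, sub_zero, abs_of_nonneg (height_nonneg q)]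
    linarith
  · have hfin := Dyadic.finite_le_side (half_pos hy0)
    have hhigh : ∀ᶠ x in (F : Filter Piece), p.1 1 / 2 < x.height :=
      hy.eventually_const_lt (by linarith)
    have htri : (∀ᶠ x in (F : Filter Piece), x.base < p.1 0) ∨
        (∀ᶠ x in (F : Filter Piece), x.base = p.1 0) ∨
          ∀ᶠ x in (F : Filter Piece), p.1 0 < x.base := by
      rw [← Ultrafilter.eventually_or, ← Ultrafilter.eventually_or]
      exact .of_forall fun x => lt_trichotomy _ _
    -- slits that are as high as `y` do not accumulate
    have hside : ∀ {d : Dyadic} {m : ℝ}, p.1 1 / 2 < m → ¬ p.1 1 / 2 ≤ d.side →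
        d.slitLength < m := fun hm hd => by
      have := Dyadic.slitLength_le_side ‹_›
      linarith
    rcases htri with hlt | heq | hgt
    · have hgap : ∀ᶠ x in (F : Filter Piece), ∀ d ∈ {d : Dyadic | p.1 1 / 2 ≤ d.side},
          d.pos < p.1 0 → d.pos < x.base :=
        (eventually_all_finite hfin).2 fun d _ => by
          by_cases hd : d.pos < p.1 0
          · filter_upwards [ht.eventually_const_lt hd] with x hx _ using hx
          · exact .of_forall fun x h => absurd h hd
      refine ⟨.front false p, ultrafilter_le_nhds_of_dist_le ht hy ?_⟩
      filter_upwards [hb, hhigh, hlt, hgap]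
      rintro _ ⟨q, rfl⟩ hq1 hq2 hq3
      simp only [Piece.base, Piece.height] at hq1 hq2 hq3 ⊢
      have hm : p.1 1 / 2 < min (q.1 1) (p.1 1) := lt_min hq1 (by linarith)
      have h1 := dist_front_le (p := q) (q := p) (y := min (q.1 1) (p.1 1)) hq2 (by linarith)
        (min_le_left _ _) (min_le_right _ _) fun d hd1 hd2 => hside hm fun hd =>
          (hq3 d hd hd2).not_gt hd1
      have h2 : dist (Piece.front b q) (.front true q) = 0 := by
        cases b
        · exact front_sides_dist_eq fun d hd => hside hq1 fun hd' =>
            (hq3 d hd' (hd.trans_lt hq2)).ne hd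
        · exact dist_self _
      have h3 := dist_triangle (Piece.front b q) (.front true q) (.front false p)
      rw [abs_of_neg (by linarith)]
      rcases le_total (q.1 1) (p.1 1) with h | h
      · rw [min_eq_left h] at h1
        rw [abs_of_nonpos (by linarith)]
        linarith
      · rw [min_eq_right h] at h1
        rw [abs_of_nonneg (by linarith)]
        linarith
    · refine ⟨.front b p, ultrafilter_le_nhds_of_dist_le ht hy ?_⟩
      filter_upwards [hb, heq]
      rintro _ ⟨q, rfl⟩ hq
      exact (dist_front_vertical_le b hq).trans (le_add_of_nonneg_left (abs_nonneg _))
    · have hgap : ∀ᶠ x in (F : Filter Piece), ∀ d ∈ {d : Dyadic | p.1 1 / 2 ≤ d.side},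
          p.1 0 < d.pos → x.base < d.pos :=
        (eventually_all_finite hfin).2 fun d _ => by
          by_cases hd : p.1 0 < d.pos
          · filter_upwards [ht.eventually_lt_const hd] with x hx _ using hx
          · exact .of_forall fun x h => absurd h hd
      refine ⟨.front true p, ultrafilter_le_nhds_of_dist_le ht hy ?_⟩
      filter_upwards [hb, hhigh, hgt, hgap]
      rintro _ ⟨q, rfl⟩ hq1 hq2 hq3
      simp only [Piece.base, Piece.height] at hq1 hq2 hq3 ⊢
      have hm : p.1 1 / 2 < min (p.1 1) (q.1 1) := lt_min (by linarith) hq1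
      have h1 := dist_front_le (p := p) (q := q) (y := min (p.1 1) (q.1 1)) hq2 (by linarith)
        (min_le_left _ _) (min_le_right _ _) fun d hd1 hd2 => hside hm fun hd =>
          (hq3 d hd hd1).not_gt hd2
      have h2 : dist (Piece.front false q) (.front b q) = 0 := by
        cases b
        · exact dist_self _
        · exact front_sides_dist_eq fun d hd => hside hq1 fun hd' =>
            (hq3 d hd' (hq2.trans_eq hd.symm)).ne hd.symm
      have h3 := dist_triangle (Piece.front true p) (.front false q) (.front b q)
      rw [dist_comm, abs_of_pos (by linarith)]
      rcases le_total (p.1 1) (q.1 1) with h | h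
      · rw [min_eq_left h] at h1
        rw [abs_of_nonneg (by linarith)]
        linarith
      · rw [min_eq_right h] at h1
        rw [abs_of_nonpos (by linarith)]
        linarith

theorem isCompact_base_le {a : ℝ} (ha : a < 1) : IsCompact {x : Piece | x.base ≤ a} := by
  refine isCompact_iff_ultrafilter_le_nhds.2 fun F hF => ?_
  rw [le_principal_iff] at hF
  suffices h : ∃ z, (F : Filter Piece) ≤ 𝓝 z by
    obtain ⟨z, hz⟩ := h
    exact ⟨z, (isClosed_le continuous_base continuous_const).mem_of_tendsto
      (tendsto_id'.2 hz) hF, hz⟩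
  obtain ⟨t, ht, htF⟩ := (isCompact_Icc (a := (0 : ℝ)) (b := a)).ultrafilter_le_nhds
    (F.map Piece.base) (le_principal_iff.2 (mem_map.2 (mem_of_superset hF fun x hx =>
      ⟨x.base_mem.1, hx⟩)))
  obtain ⟨y, -, hyF⟩ := (isCompact_Icc (a := (0 : ℝ)) (b := 1)).ultrafilter_le_nhds
    (F.map Piece.height) (le_principal_iff.2 (mem_map.2 (mem_of_superset hF fun x hx =>
      ⟨x.height_mem.1, x.height_mem.2.trans
        ((profile_le_third x.base_mem.1 x.base_mem.2.le).trans (by norm_num))⟩)))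
  have ht' : Tendsto Piece.base F (𝓝 t) := htF
  have hy' : Tendsto Piece.height F (𝓝 y) := hyF
  have hy0 : 0 ≤ y := ge_of_tendsto' hy' fun x => x.height_mem.1
  have hyt : y ≤ profile t :=
    le_of_tendsto_of_tendsto' hy' ((continuous_profile.tendsto t).comp ht') fun x => x.height_mem.2
  set p : region := ⟨!₂[t, y], pt_mem ht.1 (ht.2.trans_lt ha) hy0 hyt⟩ with hp
  have hp0 : p.1 0 = t := by simp [hp]
  have hp1 : p.1 1 = y := by simp [hp]
  rw [← hp0] at ht'
  rw [← hp1] at hy'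
  have hcases : (∀ᶠ x in (F : Filter Piece), ∃ q, x = .back q) ∨
      (∀ᶠ x in (F : Filter Piece), ∃ q, x = .front false q) ∨
      (∀ᶠ x in (F : Filter Piece), ∃ q, x = .front true q) ∨
      (∀ᶠ x in (F : Filter Piece), ∃ d b q, x = .pillow d b q) := by
    rw [← Ultrafilter.eventually_or, ← Ultrafilter.eventually_or, ← Ultrafilter.eventually_or]
    refine .of_forall fun x => ?_
    cases x with
    | front b q => cases b <;> simp
    | back q => simp
    | pillow d b q => simp
  rcases hcases with hb | hb | hb | hb
  · refine ⟨.back p, ultrafilter_le_nhds_of_dist_le ht' hy' ?_⟩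
    filter_upwards [hb]
    rintro _ ⟨q, rfl⟩
    exact dist_back_le q p
  · exact exists_limit_front hb ht' hy'
  · exact exists_limit_front hb ht' hy'
  · by_cases hd : ∃ d : Dyadic, ∀ᶠ x in (F : Filter Piece), ∃ b q, x = .pillow d b q
    · obtain ⟨d, hd⟩ := hd
      obtain ⟨z, -, hz⟩ := ((isCompact_face d false).union (isCompact_face d true)).ultrafilter_le_nhds
        F (le_principal_iff.2 (by
          filter_upwards [hd]
          rintro _ ⟨b, q, rfl⟩
          cases b
          · exact .inl (mem_range_self q)
          · exact .inr (mem_range_self q)))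
      exact ⟨z, hz⟩
    -- the pillowcases become small, so the limit is on the floor
    · refine ⟨.back (floorPt p), tendsto_id'.1 (Metric.tendsto_nhds.2 fun ε hε => ?_)⟩
      have h1 : ∀ᶠ x in (F : Filter Piece), ∀ d ∈ {d : Dyadic | ε / 4 ≤ d.side},
          ¬ ∃ b q, x = .pillow d b q :=
        (eventually_all_finite (Dyadic.finite_le_side (by positivity))).2 fun d _ =>
          Ultrafilter.eventually_not.2 fun h => hd ⟨d, h⟩
      filter_upwards [hb, h1, Metric.tendsto_nhds.1 ht' (ε / 2) (half_pos hε)]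
      rintro _ ⟨d, b, q, rfl⟩ h2 h3
      have h4 : d.side < ε / 4 := not_le.1 fun h => h2 d h ⟨b, q, rfl⟩
      have h5 := dist_pillow_foot_le_side d b q
      have h6 := dist_back_le d.foot (floorPt p)
      have h7 := dist_triangle (Piece.pillow d b q) (.back d.foot) (.back (floorPt p))
      simp only [d.foot_zero, d.foot_one, floorPt_zero, floorPt_one, sub_self, abs_zero,
        add_zero] at h6
      rw [Real.dist_eq] at h3
      simp only [Piece.base] at h3
      simp only [id]
      linarith

/-! ### The homeomorphism with the plane -/

/-- The radial coordinate in `[0, ∞)`. -/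
def Piece.gauge (x : Piece) : ℝ := 1 / (1 - x.radius) - 1

theorem Piece.gauge_eq (x : Piece) : x.gauge = 1 / (1 - x.base) + x.shift - 1 := by
  rw [Piece.gauge, x.one_div_radius]

theorem Piece.gauge_eq_div (x : Piece) : x.gauge = x.radius / (1 - x.radius) := by
  have : 1 - x.radius ≠ 0 := by linarith [x.radius_lt_one]
  rw [Piece.gauge]; field_simp; ring

theorem Piece.gauge_nonneg (x : Piece) : 0 ≤ x.gauge := by
  rw [x.gauge_eq_div]
  exact div_nonneg x.radius_nonneg (by linarith [x.radius_lt_one])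

theorem continuous_shift : Continuous Piece.shift := lipschitzWith_shift.continuous
theorem continuous_level : Continuous Piece.level := lipschitzWith_level.continuous
theorem continuous_signed : Continuous Piece.signed := lipschitzWith_signed.continuous

theorem continuous_gauge : Continuous Piece.gauge := by
  rw [show Piece.gauge = fun x => 1 / (1 - x.base) + x.shift - 1 from funext Piece.gauge_eq]
  refine ((continuous_const.div (continuous_const.sub continuous_base) fun x => ?_).add
    continuous_shift).sub continuous_const
  exact (sub_pos.2 x.base_mem.2).ne'

theorem Piece.radius_eq_gauge (x : Piece) : x.radius = 1 - 1 / (1 + x.gauge) := by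
  rw [Piece.gauge, add_sub_cancel, one_div_one_div]; ring

theorem continuous_radius : Continuous Piece.radius := by
  rw [show Piece.radius = fun x => 1 - 1 / (1 + x.gauge) from funext Piece.radius_eq_gauge]
  refine continuous_const.sub (continuous_const.div (continuous_const.add continuous_gauge)
    fun x => ?_)
  linarith [x.gauge_nonneg]

theorem Piece.profile_radius_pos {x : Piece} (h : 0 < x.gauge) : 0 < profile x.radius := by
  refine profile_pos (x.radius_nonneg.lt_of_ne fun h0 => ?_)
  rw [x.gauge_eq_div, ← h0, zero_div] at h
  exact h.false

/-- The first planar coordinate. -/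
def Piece.planeX (x : Piece) : ℝ := x.gauge * (1 - 2 * (x.level / profile x.radius))

/-- The second planar coordinate: an arc over the diameter `[-gauge, gauge]`, above it for the top
copy and below it for the bottom copy. -/
def Piece.planeZ (x : Piece) : ℝ := x.gauge * (4 * (x.signed / profile x.radius ^ 2))

theorem Piece.abs_signed (x : Piece) : |x.signed| = x.bulge := by
  rw [Piece.signed, abs_mul, abs_of_nonneg x.bulge_nonneg]
  rcases x.sheet_cases with h | ⟨p, rfl⟩
  · rw [h, abs_one, one_mul]
  · simp [Piece.sheet]

theorem Piece.ratio_mem (x : Piece) :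
    0 ≤ x.level / profile x.radius ∧ x.level / profile x.radius ≤ 1 :=
  ⟨div_nonneg x.level_nonneg (profile_nonneg x.radius_nonneg),
    div_le_one_of_le₀ x.level_le_radius (profile_nonneg x.radius_nonneg)⟩

theorem Piece.abs_planeX_le (x : Piece) : |x.planeX| ≤ x.gauge := by
  rw [Piece.planeX, abs_mul, abs_of_nonneg x.gauge_nonneg]
  refine mul_le_of_le_one_right x.gauge_nonneg (abs_le.2 ?_)
  constructor <;> linarith [x.ratio_mem.1, x.ratio_mem.2]

/-- The relation between the two planar coordinates and the gauge. -/
theorem Piece.abs_planeZ {x : Piece} (h : 0 < x.gauge) :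
    |x.planeZ| = x.gauge - x.planeX ^ 2 / x.gauge := by
  have hF := (Piece.profile_radius_pos h).ne'
  have hg := h.ne'
  rw [Piece.planeZ, abs_mul, abs_mul, abs_div, x.abs_signed, abs_of_pos h, Piece.bulge,
    abs_of_pos (by norm_num : (0 : ℝ) < 4), abs_of_nonneg (sq_nonneg _), Piece.planeX]
  field_simp
  ring

theorem Piece.planeZ_of_gauge {x : Piece} (h : x.gauge = 0) : x.planeZ = 0 := by
  rw [Piece.planeZ, h, zero_mul]

theorem Piece.abs_planeZ_le (x : Piece) : |x.planeZ| ≤ x.gauge := by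
  rcases x.gauge_nonneg.eq_or_lt with h | h
  · rw [Piece.planeZ_of_gauge h.symm, abs_zero]; exact h.le
  · rw [Piece.abs_planeZ h]
    linarith [div_nonneg (sq_nonneg x.planeX) h.le]

theorem Piece.gauge_le (x : Piece) : x.gauge ≤ |x.planeX| + |x.planeZ| := by
  rcases x.gauge_nonneg.eq_or_lt with h | h
  · rw [← h]; positivity
  · rw [Piece.abs_planeZ h]
    have : x.planeX ^ 2 / x.gauge ≤ |x.planeX| := by
      rw [div_le_iff₀ h, ← sq_abs, sq]
      exact mul_le_mul_of_nonneg_left x.abs_planeX_le (abs_nonneg _)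
    linarith

theorem continuous_of_gauge_mul {h : Piece → ℝ} (hb : ∀ x, |h x| ≤ x.gauge)
    (hc : ∀ x : Piece, 0 < x.gauge → ContinuousAt h x) : Continuous h := by
  refine continuous_iff_continuousAt.2 fun x => ?_
  rcases x.gauge_nonneg.eq_or_lt with hx | hx
  · have h0 : h x = 0 := abs_nonpos_iff.1 ((hb x).trans_eq hx.symm)
    rw [ContinuousAt, h0]
    refine squeeze_zero_norm hb ?_
    have := continuous_gauge.tendsto x
    rwa [← hx] at this
  · exact hc x hx

theorem continuous_planeX : Continuous Piece.planeX :=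
  continuous_of_gauge_mul Piece.abs_planeX_le fun _ hx =>
    continuous_gauge.continuousAt.mul (continuousAt_const.sub (continuousAt_const.mul
      (continuous_level.continuousAt.div (continuous_profile.comp continuous_radius).continuousAt
        (Piece.profile_radius_pos hx).ne')))

theorem continuous_planeZ : Continuous Piece.planeZ :=
  continuous_of_gauge_mul Piece.abs_planeZ_le fun _ hx =>
    continuous_gauge.continuousAt.mul (continuousAt_const.mul
      (continuous_signed.continuousAt.div
        ((continuous_profile.comp continuous_radius).pow 2).continuousAt
        (pow_ne_zero 2 (Piece.profile_radius_pos hx).ne')))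

theorem dist_eq_zero_of_plane {x y : Piece} (hX : x.planeX = y.planeX)
    (hZ : x.planeZ = y.planeZ) : dist x y = 0 := by
  have hg : x.gauge = y.gauge := by
    rcases x.gauge_nonneg.eq_or_lt with hx | hx
    · have h1 := x.abs_planeX_le
      have h2 := x.abs_planeZ_le
      have h3 := y.gauge_le
      rw [← hX, ← hZ] at h3
      linarith [y.gauge_nonneg]
    · rcases y.gauge_nonneg.eq_or_lt with hy | hy
      · have h1 := y.abs_planeX_le
        have h2 := y.abs_planeZ_le
        have h3 := x.gauge_le
        rw [hX, hZ] at h3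
        linarith
      · have h1 := Piece.abs_planeZ hx
        rw [hZ, Piece.abs_planeZ hy, hX] at h1
        have h2 : (x.gauge - y.gauge) * (1 + y.planeX ^ 2 / (x.gauge * y.gauge)) = 0 := by
          have : y.gauge - y.planeX ^ 2 / y.gauge - (x.gauge - y.planeX ^ 2 / x.gauge) =
            -((x.gauge - y.gauge) * (1 + y.planeX ^ 2 / (x.gauge * y.gauge))) := by
            field_simp; ring
          linarith
        have h3 : 0 < 1 + y.planeX ^ 2 / (x.gauge * y.gauge) := by positivity
        linarith [(mul_eq_zero.1 h2).resolve_right h3.ne']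
  have hr : x.radius = y.radius := by rw [x.radius_eq_gauge, y.radius_eq_gauge, hg]
  rcases x.gauge_nonneg.eq_or_lt with hx | hx
  · have h0 : x.radius = 0 := by rw [x.radius_eq_gauge, ← hx]; norm_num
    have hl : ∀ z : Piece, z.radius = 0 → z.level = 0 := fun z hz => by
      have := z.level_le_radius
      rw [hz, profile_zero] at this
      exact le_antisymm this z.level_nonneg
    have h1 := hl x h0
    have h2 := hl y (hr ▸ h0)
    refine dist_eq_zero_of_coords hr (h1.trans h2.symm) ?_
    simp [Piece.signed, Piece.bulge, h1, h2]
  · have hF := Piece.profile_radius_pos hx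
    refine dist_eq_zero_of_coords hr ?_ ?_
    · rw [Piece.planeX, Piece.planeX, ← hg, ← hr] at hX
      have h1 := mul_left_cancel₀ hx.ne' hX
      have h2 : x.level / profile x.radius = y.level / profile x.radius := by linarith
      exact (div_left_inj' hF.ne').1 h2
    · rw [Piece.planeZ, Piece.planeZ, ← hg, ← hr] at hZ
      have h1 := mul_left_cancel₀ four_ne_zero (mul_left_cancel₀ hx.ne' hZ)
      exact (div_left_inj' (pow_ne_zero 2 hF.ne')).1 h1

theorem exists_plane (X Z : ℝ) : ∃ x : Piece, x.planeX = X ∧ x.planeZ = Z := by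
  set φ := (|Z| + √(Z ^ 2 + 4 * X ^ 2)) / 2 with hφ
  have hsq := Real.sq_sqrt (by positivity : 0 ≤ Z ^ 2 + 4 * X ^ 2)
  have hquad : φ ^ 2 = |Z| * φ + X ^ 2 := by
    rw [hφ]; nlinarith [sq_abs Z]
  have hφ0 : 0 ≤ φ := by positivity
  set R := 1 - 1 / (1 + φ) with hR
  have hR0 : 0 ≤ R := by
    rw [hR, sub_nonneg, div_le_one (by linarith)]; linarith
  have hR1 : R < 1 := by
    have : 0 < 1 / (1 + φ) := by positivity
    linarith
  have hgauge : ∀ x : Piece, x.radius = R → x.gauge = φ := fun x hx => by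
    rw [Piece.gauge, hx, hR, sub_sub_cancel, one_div_one_div]; ring
  rcases hφ0.eq_or_lt with h0 | h0
  · rw [← h0] at hquad
    have hX : X = 0 := by nlinarith
    have hZ : Z = 0 := by
      have h1 : 0 ≤ √(Z ^ 2 + 4 * X ^ 2) := Real.sqrt_nonneg _
      have h2 := abs_nonneg Z
      exact abs_nonpos_iff.1 (by linarith)
    obtain ⟨x, -, hx, -⟩ := exists_back hR0 hR1 le_rfl (profile_nonneg hR0)
    have hxg : x.gauge = 0 := by rw [hgauge x hx, h0]
    exact ⟨x, by rw [hX, Piece.planeX, hxg, zero_mul], by rw [hZ, Piece.planeZ, hxg, zero_mul]⟩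
  · have hXφ : |X| ≤ φ := by
      refine abs_le_of_sq_le_sq ?_ hφ0
      rw [hquad]; nlinarith [mul_nonneg (abs_nonneg Z) hφ0]
    obtain ⟨hX1, hX2⟩ := abs_le.1 hXφ
    have hF : 0 ≤ profile R := profile_nonneg hR0
    set u := (1 - X / φ) / 2 with hu
    have hu0 : 0 ≤ u := by
      have : X / φ ≤ 1 := (div_le_one h0).2 hX2
      linarith
    have hu1 : u ≤ 1 := by
      have : -1 ≤ X / φ := by rw [le_div_iff₀ h0]; linarith
      linarith
    have hy0 : 0 ≤ u * profile R := mul_nonneg hu0 hF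
    have hy1 : u * profile R ≤ profile R := mul_le_of_le_one_left hF hu1
    have key : ∀ x : Piece, x.radius = R → x.level = u * profile R → Z = x.sheet * |Z| →
        x.planeX = X ∧ x.planeZ = Z := by
      intro x hxr hxl hxs
      have hg := hgauge x hxr
      have hFp : 0 < profile R := by
        have := Piece.profile_radius_pos (x := x) (by rw [hg]; exact h0)
        rwa [hxr] at this
      constructor
      · rw [Piece.planeX, hg, hxl, hxr, mul_div_cancel_right₀ _ hFp.ne', hu]
        field_simp; ring
      · rw [Piece.planeZ, hg, Piece.signed, Piece.bulge, hxl, hxr]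
        have h1 : φ * (4 * (x.sheet * (u * profile R * (profile R - u * profile R)) /
            profile R ^ 2)) = x.sheet * (φ * (4 * (u * (1 - u)))) := by
          field_simp
        have h2 : φ * (4 * (u * (1 - u))) = |Z| := by
          rw [hu]; field_simp; nlinarith
        rw [h1, h2, ← hxs]
    rcases le_total 0 Z with hZ | hZ
    · obtain ⟨x, hx, hxr, hxl⟩ := exists_top hR0 hR1 hy0 hy1
      exact ⟨x, key x hxr hxl (by rw [hx, one_mul, abs_of_nonneg hZ])⟩
    · obtain ⟨x, hx, hxr, hxl⟩ := exists_back hR0 hR1 hy0 hy1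
      exact ⟨x, key x hxr hxl (by rw [hx, abs_of_nonpos hZ]; ring)⟩

/-- The map from the surface to the plane. -/
def Surface.plane : Surface → ℝ × ℝ :=
  SeparationQuotient.lift (fun x : Piece => (x.planeX, x.planeZ)) fun _ _ h =>
    (h.map (continuous_planeX.prodMk continuous_planeZ)).eq

theorem Surface.plane_mk (x : Piece) : (Surface.mk x).plane = (x.planeX, x.planeZ) := rfl

theorem Surface.continuous_plane : Continuous Surface.plane :=
  SeparationQuotient.continuous_lift (continuous_planeX.prodMk continuous_planeZ)

theorem Surface.bijective_plane : Function.Bijective Surface.plane := by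
  constructor
  · intro x y hxy
    obtain ⟨x, rfl⟩ := Surface.surjective_mk x
    obtain ⟨y, rfl⟩ := Surface.surjective_mk y
    rw [Surface.plane_mk, Surface.plane_mk, Prod.mk.injEq] at hxy
    exact Surface.mk_eq_mk.2 (dist_eq_zero_of_plane hxy.1 hxy.2)
  · rintro ⟨X, Z⟩
    obtain ⟨x, hX, hZ⟩ := exists_plane X Z
    exact ⟨Surface.mk x, by rw [Surface.plane_mk, hX, hZ]⟩

theorem Surface.isProperMap_plane : IsProperMap Surface.plane := by
  refine isProperMap_iff_isCompact_preimage.2 ⟨Surface.continuous_plane, fun K hK => ?_⟩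
  obtain ⟨C, hC⟩ := hK.isBounded.exists_norm_le
  have hcl : IsClosed (Surface.plane ⁻¹' K) := hK.isClosed.preimage Surface.continuous_plane
  set a := 1 - 1 / (1 + 2 * |C|) with ha
  have ha1 : a < 1 := by
    have : 0 < 1 / (1 + 2 * |C|) := by positivity
    linarith
  refine ((isCompact_base_le ha1).image Surface.continuous_mk).of_isClosed_subset hcl fun x hx => ?_
  obtain ⟨x, rfl⟩ := Surface.surjective_mk x
  refine mem_image_of_mem _ ?_
  have h1 := hC _ hx
  rw [Surface.plane_mk, Prod.norm_def, max_le_iff, Real.norm_eq_abs, Real.norm_eq_abs] at h1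
  have h2 := x.gauge_le
  rw [x.gauge_eq] at h2
  have h3 : 1 / (1 - x.base) ≤ 1 + 2 * |C| := by
    linarith [x.shift_nonneg, le_abs_self C, h1.1, h1.2]
  have h4 : 0 < 1 - x.base := by linarith [x.base_mem.2]
  have h5 : 1 / (1 + 2 * |C|) ≤ 1 - x.base := by
    rw [div_le_iff₀ h4] at h3
    rw [div_le_iff₀ (by positivity)]
    linarith
  change x.base ≤ a
  linarith

/-- The surface is homeomorphic to the plane. -/
def Surface.homeomorphPlane : Surface ≃ₜ ℝ × ℝ :=
  (Equiv.ofBijective _ Surface.bijective_plane).toHomeomorphOfContinuousClosed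
    Surface.continuous_plane Surface.isProperMap_plane.isClosedMap

/-- An open interval is homeomorphic to the line. -/
def intervalHomeomorph : ℝ ≃ₜ Ioo (-2 : ℝ) 2 :=
  ((OpenPartialHomeomorph.univBall (0 : ℝ) 2).isOpenEmbedding
    (OpenPartialHomeomorph.univBall_source _ _)).isEmbedding.toHomeomorph.trans
    (Homeomorph.setCongr (by
      rw [← image_univ, ← OpenPartialHomeomorph.univBall_source (0 : ℝ) 2,
        OpenPartialHomeomorph.image_source_eq_target,
        OpenPartialHomeomorph.univBall_target _ (by norm_num), Real.ball_eq_Ioo]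
      norm_num))

theorem nonempty_homeomorph_space : Nonempty (Space ≃ₜ EuclideanSpace ℝ (Fin 3)) :=
  ⟨Space.homeomorphProd.trans ((Surface.homeomorphPlane.prodCongr intervalHomeomorph.symm).trans
    (ContinuousLinearEquiv.ofFinrankEq (𝕜 := ℝ) (E := (ℝ × ℝ) × ℝ)
      (by simp)).toHomeomorph)⟩

/-! ### Two general facts on Hausdorff measures -/

/-- A map that is locally `K`-Lipschitz on `s` increases the Hausdorff measure of `s` by at most the
factor `K ^ d`. -/
theorem hausdorffMeasure_image_le_of_locally {α β : Type*} [MetricSpace α] [MetricSpace β]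
    [SecondCountableTopology α] [MeasurableSpace α] [BorelSpace α] [MeasurableSpace β]
    [BorelSpace β] {f : α → β} {s : Set α} {K : ℝ≥0} {d : ℝ} (hd : 0 ≤ d)
    (h : ∀ x ∈ s, ∃ U ∈ 𝓝 x, LipschitzOnWith K f (U ∩ s)) :
    Measure.hausdorffMeasure d (f '' s) ≤ (K : ℝ≥0∞) ^ d * Measure.hausdorffMeasure d s := by
  rcases s.eq_empty_or_nonempty with rfl | hs
  · simp
  choose! U hU hLip using h
  obtain ⟨T, hTs, hTc, hT⟩ := TopologicalSpace.countable_cover_nhdsWithin (s := s)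
    (f := fun x => interior (U x))
    fun x hx => mem_nhdsWithin_of_mem_nhds (interior_mem_nhds.2 (hU x hx))
  have hTne : T.Nonempty := by
    obtain ⟨x, hx⟩ := hs
    obtain ⟨y, hy, -⟩ := mem_iUnion₂.1 (hT hx)
    exact ⟨y, hy⟩
  obtain ⟨g, hg⟩ := hTc.exists_eq_range hTne
  have hgs : ∀ n, g n ∈ s := fun n => hTs (hg ▸ mem_range_self n)
  set V : ℕ → Set α := fun n => interior (U (g n)) with hV
  have hcov : s ⊆ ⋃ n, disjointed V n := by
    rw [iUnion_disjointed]
    refine hT.trans ?_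
    rw [hg]
    exact iUnion₂_subset fun x ⟨n, hn⟩ => hn ▸ subset_iUnion V n
  have hmeas : ∀ n, MeasurableSet (disjointed V n) :=
    MeasurableSet.disjointed fun n => isOpen_interior.measurableSet
  calc Measure.hausdorffMeasure d (f '' s)
      ≤ Measure.hausdorffMeasure d (⋃ n, f '' (disjointed V n ∩ s)) := by
        refine measure_mono ?_
        rintro _ ⟨x, hx, rfl⟩
        obtain ⟨n, hn⟩ := mem_iUnion.1 (hcov hx)
        exact mem_iUnion.2 ⟨n, mem_image_of_mem f ⟨hn, hx⟩⟩
    _ ≤ ∑' n, Measure.hausdorffMeasure d (f '' (disjointed V n ∩ s)) := measure_iUnion_le _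
    _ ≤ ∑' n, (K : ℝ≥0∞) ^ d * Measure.hausdorffMeasure d (disjointed V n ∩ s) := by
        refine ENNReal.tsum_le_tsum fun n => LipschitzOnWith.hausdorffMeasure_image_le ?_ hd
        exact (hLip _ (hgs n)).mono
          (inter_subset_inter_left _ ((disjointed_subset V n).trans interior_subset))
    _ = (K : ℝ≥0∞) ^ d * ∑' n, (Measure.hausdorffMeasure d).restrict s (disjointed V n) := by
        rw [ENNReal.tsum_mul_left]
        simp only [Measure.restrict_apply (hmeas _)]
    _ ≤ (K : ℝ≥0∞) ^ d * Measure.hausdorffMeasure d s := by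
        refine mul_le_mul_right ?_ _
        rw [← measure_iUnion (disjoint_disjointed V) hmeas]
        exact (measure_mono (subset_univ _)).trans_eq (Measure.restrict_apply_univ _)

/-- The Hausdorff `3`-measure of the part of a product over a set `A` and an interval is bounded by
the `2`-measure of `A` times the length of the interval: cut each member of a cover of `A`, times
the interval, into pieces that are as long as they are wide. -/
theorem hausdorffMeasure_product_le {Y Z : Type*} [MetricSpace Y] [MeasurableSpace Y]
    [BorelSpace Y] [MetricSpace Z] [MeasurableSpace Z] [BorelSpace Z] {π : Z → Y} {σ : Z → ℝ}
    (hπσ : ∀ z w, dist z w ≤ dist (π z) (π w) + dist (σ z) (σ w)) (A : Set Y) {a b : ℝ}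
    (hab : a < b) :
    Measure.hausdorffMeasure 3 {z | π z ∈ A ∧ σ z ∈ Icc a b} ≤
      ENNReal.ofReal (64 * (b - a)) * Measure.hausdorffMeasure 2 A := by
  have hc0 : ENNReal.ofReal (64 * (b - a)) ≠ 0 := by
    rw [Ne, ENNReal.ofReal_eq_zero, not_le]; linarith
  have hcover : ∀ M' : ℝ≥0∞, Measure.hausdorffMeasure 2 A < M' → ∀ ρ : ℝ, 0 < ρ →
      2 * ρ ≤ b - a → ∃ (N : ℕ → ℕ) (T : (Σ n, Fin (N n)) → Set Z),
        (∀ i, Metric.ediam (T i) ≤ ENNReal.ofReal (4 * ρ)) ∧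
        {z | π z ∈ A ∧ σ z ∈ Icc a b} ⊆ ⋃ i, T i ∧
        ∑' i, Metric.ediam (T i) ^ (3 : ℝ) ≤ ENNReal.ofReal (64 * (b - a)) * M' := by
    intro M' hM' ρ hρ hρab
    have hM0 : M' ≠ 0 := (bot_le.trans_lt hM').ne'
    have h1 := hM'
    rw [Measure.hausdorffMeasure_apply] at h1
    have h2 := (le_iSup₂ (f := fun (r : ℝ≥0∞) (_ : 0 < r) =>
      ⨅ (t : ℕ → Set Y) (_ : A ⊆ ⋃ n, t n) (_ : ∀ n, Metric.ediam (t n) ≤ r),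
        ∑' n, ⨆ _ : (t n).Nonempty, Metric.ediam (t n) ^ (2 : ℝ)) (ENNReal.ofReal ρ)
      (ENNReal.ofReal_pos.2 hρ)).trans_lt h1
    simp only [iInf_lt_iff] at h2
    obtain ⟨t, hAt, htd, hts⟩ := h2
    obtain ⟨η, hη, hηs⟩ := ENNReal.exists_pos_sum_of_countable' hM0 ℕ
    -- positive side lengths, slightly larger than the diameters
    set e : ℕ → ℝ := fun n => (Metric.ediam (t n)).toReal + min ρ (min 1 (η n).toReal) with he
    have hηtop : ∀ n, η n ≠ ∞ := fun n =>
      ((ENNReal.le_tsum n).trans_lt (hηs.trans_le le_top)).ne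
    have hmin0 : ∀ n, 0 < min ρ (min 1 (η n).toReal) := fun n =>
      lt_min hρ (lt_min one_pos (ENNReal.toReal_pos (hη n).ne' (hηtop n)))
    have hdtop : ∀ n, Metric.ediam (t n) ≠ ∞ := fun n =>
      ((htd n).trans_lt ENNReal.ofReal_lt_top).ne
    have he0 : ∀ n, 0 < e n := fun n => add_pos_of_nonneg_of_pos ENNReal.toReal_nonneg (hmin0 n)
    have hdρ : ∀ n, (Metric.ediam (t n)).toReal ≤ ρ := fun n =>
      ENNReal.toReal_le_of_le_ofReal hρ.le (htd n)
    have heρ : ∀ n, e n ≤ 2 * ρ := fun n => by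
      have := min_le_left ρ (min 1 (η n).toReal)
      have := hdρ n
      simp only [he]; linarith
    have hesq : ∀ n, (t n).Nonempty → ENNReal.ofReal (e n ^ 2) ≤
        2 * (⨆ _ : (t n).Nonempty, Metric.ediam (t n) ^ (2 : ℝ)) + 2 * η n := by
      intro n hn
      rw [iSup_pos hn]
      have h3 : (min ρ (min 1 (η n).toReal)) ^ 2 ≤ (η n).toReal := by
        have h4 : min ρ (min 1 (η n).toReal) ≤ 1 := (min_le_right _ _).trans (min_le_left _ _)
        have h5 : min ρ (min 1 (η n).toReal) ≤ (η n).toReal :=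
          (min_le_right _ _).trans (min_le_right _ _)
        nlinarith [hmin0 n]
      have h4 : e n ^ 2 ≤ 2 * (Metric.ediam (t n)).toReal ^ 2 + 2 * (η n).toReal := by
        simp only [he]
        nlinarith [sq_nonneg ((Metric.ediam (t n)).toReal - min ρ (min 1 (η n).toReal))]
      refine (ENNReal.ofReal_le_ofReal h4).trans ?_
      rw [ENNReal.ofReal_add (by positivity) (by positivity), ENNReal.ofReal_mul zero_le_two,
        ENNReal.ofReal_mul zero_le_two, ENNReal.ofReal_toReal (hηtop n),
        ENNReal.ofReal_pow ENNReal.toReal_nonneg, ENNReal.ofReal_toReal (hdtop n)]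
      simp
    set N : ℕ → ℕ := fun n => ⌈(b - a) / e n⌉₊ with hN
    let T : (Σ n, Fin (N n)) → Set Z := fun i =>
      {z | π z ∈ t i.1 ∧ σ z ∈ Icc (a + i.2 * e i.1) (a + (i.2 + 1) * e i.1)}
    have hTd : ∀ i, Metric.ediam (T i) ≤ ENNReal.ofReal (2 * e i.1) := by
      rintro ⟨n, j⟩
      refine Metric.ediam_le fun z hz w hw => ?_
      rw [edist_dist]
      refine ENNReal.ofReal_le_ofReal ((hπσ z w).trans ?_)
      have h3 : dist (π z) (π w) ≤ (Metric.ediam (t n)).toReal := by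
        rw [dist_edist]
        exact ENNReal.toReal_mono (hdtop n) (Metric.edist_le_ediam_of_mem hz.1 hw.1)
      have h4 : dist (σ z) (σ w) ≤ e n := by
        obtain ⟨hz1, hz2⟩ := hz.2
        obtain ⟨hw1, hw2⟩ := hw.2
        rw [Real.dist_eq, abs_le]
        constructor <;> linarith
      have := hmin0 n
      simp only [he] at h4 ⊢
      linarith
    refine ⟨N, T, fun i => (hTd i).trans (ENNReal.ofReal_le_ofReal (by linarith [heρ i.1])), ?_, ?_⟩
    · rintro z ⟨hz, hza, hzb⟩
      obtain ⟨n, hn⟩ := mem_iUnion.1 (hAt hz)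
      rcases hza.eq_or_lt with hza' | hza'
      · have hNpos : 0 < N n := Nat.ceil_pos.2 (div_pos (by linarith) (he0 n))
        refine mem_iUnion.2 ⟨⟨n, ⟨0, hNpos⟩⟩, hn, ?_, ?_⟩ <;> simp [← hza', (he0 n).le]
      · -- the number of the interval that contains `σ z`
        set j := ⌈(σ z - a) / e n⌉₊ with hj
        have hj0 : 0 < j := Nat.ceil_pos.2 (div_pos (by linarith) (he0 n))
        have hjN : j ≤ N n := Nat.ceil_mono (div_le_div_of_nonneg_right (by linarith) (he0 n).le)
        have h3 : σ z - a ≤ j * e n := (div_le_iff₀ (he0 n)).1 (Nat.le_ceil _)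
        have h4 : (j - 1 : ℝ) * e n ≤ σ z - a := by
          have := Nat.ceil_lt_add_one (div_nonneg (by linarith : 0 ≤ σ z - a) (he0 n).le)
          rw [← le_div_iff₀ (he0 n)]; linarith
        have hcast : ((j - 1 : ℕ) : ℝ) = j - 1 := by push_cast [Nat.cast_sub hj0]; ring
        refine mem_iUnion.2 ⟨⟨n, ⟨j - 1, by omega⟩⟩, hn, ?_, ?_⟩ <;> simp only [hcast] <;> linarith
    · rw [ENNReal.tsum_sigma']
      have hrow : ∀ n, ∑' j : Fin (N n), Metric.ediam (T ⟨n, j⟩) ^ (3 : ℝ) ≤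
          ENNReal.ofReal (16 * (b - a)) *
            (2 * (⨆ _ : (t n).Nonempty, Metric.ediam (t n) ^ (2 : ℝ)) + 2 * η n) := by
        intro n
        rcases (t n).eq_empty_or_nonempty with hn | hn
        · have : ∀ j : Fin (N n), T ⟨n, j⟩ = ∅ := fun j =>
            eq_empty_of_forall_notMem fun z hz => by simp [T, hn] at hz
          simp [this]
        · refine le_trans ?_ (mul_le_mul_right (hesq n hn) _)
          calc ∑' j : Fin (N n), Metric.ediam (T ⟨n, j⟩) ^ (3 : ℝ)
              ≤ ∑' _ : Fin (N n), ENNReal.ofReal ((2 * e n) ^ 3) := by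
                refine ENNReal.tsum_le_tsum fun j => ?_
                refine (ENNReal.rpow_le_rpow (hTd ⟨n, j⟩) (by norm_num)).trans_eq ?_
                rw [ENNReal.ofReal_rpow_of_pos (by linarith [he0 n])]
                norm_num
            _ = ENNReal.ofReal (N n * (2 * e n) ^ 3) := by
                rw [tsum_fintype, Finset.sum_const, Finset.card_univ, Fintype.card_fin,
                  nsmul_eq_mul, ENNReal.ofReal_mul (Nat.cast_nonneg _), ENNReal.ofReal_natCast]
            _ ≤ ENNReal.ofReal (16 * (b - a) * e n ^ 2) := by
                refine ENNReal.ofReal_le_ofReal ?_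
                have h3 : (N n : ℝ) < (b - a) / e n + 1 :=
                  Nat.ceil_lt_add_one (div_nonneg (by linarith) (he0 n).le)
                have h4 : (N n : ℝ) * e n ≤ 2 * (b - a) := by
                  have h5 := mul_le_mul_of_nonneg_right h3.le (he0 n).le
                  rw [add_mul, div_mul_cancel₀ _ (he0 n).ne'] at h5
                  linarith [heρ n]
                nlinarith [mul_le_mul_of_nonneg_right h4 (sq_nonneg (e n))]
            _ = _ := ENNReal.ofReal_mul (by linarith)
      calc ∑' n, ∑' j : Fin (N n), Metric.ediam (T ⟨n, j⟩) ^ (3 : ℝ)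
          ≤ ∑' n, ENNReal.ofReal (16 * (b - a)) *
            (2 * (⨆ _ : (t n).Nonempty, Metric.ediam (t n) ^ (2 : ℝ)) + 2 * η n) :=
            ENNReal.tsum_le_tsum hrow
        _ ≤ ENNReal.ofReal (16 * (b - a)) * (2 * M' + 2 * M') := by
            rw [ENNReal.tsum_mul_left, ENNReal.tsum_add, ENNReal.tsum_mul_left,
              ENNReal.tsum_mul_left]
            exact mul_le_mul_right (add_le_add (mul_le_mul_right hts.le _)
              (mul_le_mul_right hηs.le _)) _
        _ = ENNReal.ofReal (64 * (b - a)) * M' := by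
            rw [← add_mul, ← mul_assoc, show (64 : ℝ) * (b - a) = 16 * (b - a) * 4 by ring,
              ENNReal.ofReal_mul (by linarith : 0 ≤ 16 * (b - a))]
            norm_num
  have hle : ∀ M' : ℝ≥0∞, Measure.hausdorffMeasure 2 A < M' →
      Measure.hausdorffMeasure 3 {z | π z ∈ A ∧ σ z ∈ Icc a b} ≤
        ENNReal.ofReal (64 * (b - a)) * M' := by
    intro M' hM'
    have hρ : ∀ k : ℕ, 0 < (b - a) / (2 * (k + 1)) := fun k =>
      div_pos (by linarith) (by positivity)
    have hρ' : ∀ k : ℕ, 2 * ((b - a) / (2 * (k + 1))) ≤ b - a := fun k => by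
      have hk : (0 : ℝ) ≤ k := Nat.cast_nonneg k
      rw [mul_div_assoc', div_le_iff₀ (by positivity)]
      nlinarith [mul_nonneg hk (sub_nonneg.2 hab.le)]
    choose N T hT1 hT2 hT3 using fun k => hcover M' hM' _ (hρ k) (hρ' k)
    refine (Measure.hausdorffMeasure_le_liminf_tsum 3 _ (l := atTop)
      (fun k : ℕ => ENNReal.ofReal (4 * ((b - a) / (2 * (k + 1))))) ?_ T (.of_forall hT1)
      (.of_forall hT2)).trans ?_
    · rw [← ENNReal.ofReal_zero]
      refine ENNReal.tendsto_ofReal ?_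
      have h3 : Tendsto (fun k : ℕ => 2 * (b - a) * (1 / ((k : ℝ) + 1))) atTop (𝓝 (2 * (b - a) * 0)) :=
        tendsto_one_div_add_atTop_nhds_zero_nat.const_mul _
      rw [mul_zero] at h3
      refine h3.congr fun k => ?_
      field_simp
      ring
    · refine (liminf_le_liminf (.of_forall hT3)).trans ?_
      simp
  rcases eq_or_ne (Measure.hausdorffMeasure 2 A) ∞ with hM | hM
  · rw [hM, ENNReal.mul_top hc0]; exact le_top
  · rw [mul_comm, ← ENNReal.div_le_iff hc0 ENNReal.ofReal_ne_top]
    refine le_of_forall_gt_imp_ge_of_dense fun M' hM' => ?_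
    rw [ENNReal.div_le_iff hc0 ENNReal.ofReal_ne_top, mul_comm]
    exact hle M' hM'

/-! ### Charts -/

/-- The second coordinate of the folding map, on the surface. -/
def Surface.height : Surface → ℝ := (exists_lift lipschitzWith_height).choose

theorem Surface.lipschitzWith_height : LipschitzWith 1 Surface.height :=
  (exists_lift CuspExample.lipschitzWith_height).choose_spec.1

@[simp] theorem Surface.height_mk (x : Piece) : (Surface.mk x).height = x.height :=
  (exists_lift CuspExample.lipschitzWith_height).choose_spec.2 x

theorem Surface.abs_height_sub_le (x y : Surface) : |x.height - y.height| ≤ dist x y := by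
  simpa [Real.dist_eq] using Surface.lipschitzWith_height.dist_le_mul x y

/-- The region `Y₀` as a subset of `ℝ × ℝ`. -/
def flatRegion : Set (ℝ × ℝ) := {u | 0 ≤ u.1 ∧ u.1 < 1 ∧ 0 ≤ u.2 ∧ u.2 ≤ profile u.1}

/-- The point of the region with the given coordinates. -/
def toRegion (u : flatRegion) : region := ⟨!₂[u.1.1, u.1.2], pt_mem u.2.1 u.2.2.1 u.2.2.2.1 u.2.2.2.2⟩

@[simp] theorem toRegion_zero (u : flatRegion) : (toRegion u).1 0 = u.1.1 := by simp [toRegion]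
@[simp] theorem toRegion_one (u : flatRegion) : (toRegion u).1 1 = u.1.2 := by simp [toRegion]

theorem exists_toRegion (p : region) : ∃ u : flatRegion, toRegion u = p ∧ u.1 = (p.1 0, p.1 1) :=
  ⟨⟨(p.1 0, p.1 1), p.2⟩, region_ext (by simp) (by simp), rfl⟩

/-- The square of a pillowcase as a subset of `ℝ × ℝ`. -/
def Dyadic.flatSquare (d : Dyadic) : Set (ℝ × ℝ) := Icc 0 d.side ×ˢ Icc 0 d.side

/-- The point of the square with the given coordinates. -/
def Dyadic.toSquare (d : Dyadic) (u : d.flatSquare) : d.square :=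
  ⟨!₂[u.1.1, u.1.2], by simpa [Dyadic.square] using ⟨u.2.1, u.2.2⟩⟩

@[simp] theorem Dyadic.toSquare_zero (d : Dyadic) (u : d.flatSquare) :
    (d.toSquare u).1 0 = u.1.1 := by simp [toSquare]
@[simp] theorem Dyadic.toSquare_one (d : Dyadic) (u : d.flatSquare) :
    (d.toSquare u).1 1 = u.1.2 := by simp [toSquare]

theorem Dyadic.exists_toSquare (d : Dyadic) (q : d.square) : ∃ u : d.flatSquare, d.toSquare u = q :=
  ⟨⟨(q.1 0, q.1 1), q.2⟩, square_ext (by simp) (by simp)⟩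

open Classical in
/-- The parametrization of the left side of the top copy (a junk value outside the region). -/
def Surface.front (u : ℝ × ℝ) : Surface :=
  if h : u ∈ flatRegion then Surface.mk (.front false (toRegion ⟨u, h⟩)) else cusp

open Classical in
/-- The parametrization of the bottom copy (a junk value outside the region). -/
def Surface.back (u : ℝ × ℝ) : Surface :=
  if h : u ∈ flatRegion then Surface.mk (.back (toRegion ⟨u, h⟩)) else cusp

open Classical in
/-- The parametrization of a face of a pillowcase (a junk value outside the square). -/
def Surface.face (d : Dyadic) (b : Bool) (u : ℝ × ℝ) : Surface :=
  if h : u ∈ d.flatSquare then Surface.mk (.pillow d b (d.toSquare ⟨u, h⟩)) else cusp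

theorem Surface.front_of_mem {u : ℝ × ℝ} (h : u ∈ flatRegion) :
    Surface.front u = Surface.mk (.front false (toRegion ⟨u, h⟩)) := dif_pos h

theorem Surface.back_of_mem {u : ℝ × ℝ} (h : u ∈ flatRegion) :
    Surface.back u = Surface.mk (.back (toRegion ⟨u, h⟩)) := dif_pos h

theorem Surface.face_of_mem {d : Dyadic} {u : ℝ × ℝ} (b : Bool) (h : u ∈ d.flatSquare) :
    Surface.face d b u = Surface.mk (.pillow d b (d.toSquare ⟨u, h⟩)) := dif_pos h

/-- The part of the region off the floor and off the slits. -/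
def unslitRegion : Set (ℝ × ℝ) :=
  {u | u ∈ flatRegion ∧ 0 < u.2 ∧ ∀ d : Dyadic, d.pos = u.1 → d.slitLength < u.2}

theorem abs_add_abs_le_dist (u v : ℝ × ℝ) : |u.1 - v.1| + |u.2 - v.2| ≤ 2 * dist u v := by
  have h1 : |u.1 - v.1| ≤ dist u v := le_max_left _ _
  have h2 : |u.2 - v.2| ≤ dist u v := le_max_right _ _
  linarith

theorem Surface.lipschitzOnWith_back : LipschitzOnWith 2 Surface.back flatRegion := by
  refine LipschitzOnWith.of_dist_le_mul fun u hu v hv => ?_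
  rw [Surface.back_of_mem hu, Surface.back_of_mem hv, Surface.dist_mk]
  refine (dist_back_le _ _).trans ?_
  simpa using abs_add_abs_le_dist u v

theorem Surface.lipschitzOnWith_face (d : Dyadic) (b : Bool) :
    LipschitzOnWith 2 (Surface.face d b) d.flatSquare := by
  refine LipschitzOnWith.of_dist_le_mul fun u hu v hv => ?_
  rw [Surface.face_of_mem b hu, Surface.face_of_mem b hv, Surface.dist_mk]
  refine (dist_pillow_le _ _ _ _).trans ?_
  simpa using abs_add_abs_le_dist u v

/-- Off the floor and the slits the top copy is locally Lipschitz: only finitely many slits reach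
half the height of a given point, and a small neighbourhood avoids them. -/
theorem Surface.locally_lipschitz_front (u : ℝ × ℝ) (hu : u ∈ unslitRegion) :
    ∃ U ∈ 𝓝 u, LipschitzOnWith 2 Surface.front (U ∩ unslitRegion) := by
  obtain ⟨-, hu0, hus⟩ := hu
  have hfin := Dyadic.finite_le_side (half_pos hu0)
  set U : Set (ℝ × ℝ) := {v | u.2 / 2 < v.2 ∧ ∀ d ∈ {d : Dyadic | u.2 / 2 ≤ d.side},
    (d.pos < u.1 → d.pos < v.1) ∧ (u.1 < d.pos → v.1 < d.pos) ∧
      (d.pos = u.1 → d.slitLength < v.2)} with hU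
  have hUn : U ∈ 𝓝 u := by
    have h1 : Tendsto (fun v : ℝ × ℝ => v.1) (𝓝 u) (𝓝 u.1) := continuous_fst.continuousAt
    have h2 : Tendsto (fun v : ℝ × ℝ => v.2) (𝓝 u) (𝓝 u.2) := continuous_snd.continuousAt
    refine (h2.eventually_const_lt (by linarith)).and ((eventually_all_finite hfin).2 fun d _ => ?_)
    rcases lt_trichotomy d.pos u.1 with h | h | h
    · filter_upwards [h1.eventually_const_lt h] with v hv
      exact ⟨fun _ => hv, fun h' => absurd h' h.not_gt, fun h' => absurd h' h.ne⟩
    · filter_upwards [h2.eventually_const_lt (hus d h)] with v hv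
      exact ⟨fun h' => absurd h h'.ne, fun h' => absurd h h'.ne', fun _ => hv⟩
    · filter_upwards [h1.eventually_lt_const h] with v hv
      exact ⟨fun h' => absurd h' h.not_gt, fun _ => hv, fun h' => absurd h' h.ne'⟩
  refine ⟨U, hUn, LipschitzOnWith.of_dist_le_mul fun v hv w hw => ?_⟩
  wlog hvw : v.1 ≤ w.1 generalizing v w
  · rw [dist_comm, dist_comm v]; exact this w hw v hv (le_of_not_ge hvw)
  have hside : ∀ (z : ℝ × ℝ) (hz : z ∈ unslitRegion),
      Surface.mk (.front false (toRegion ⟨z, hz.1⟩)) =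
        Surface.mk (.front true (toRegion ⟨z, hz.1⟩)) := fun z hz =>
    Surface.mk_eq_mk.2 (front_sides_dist_eq fun d hd => by
      rw [toRegion_zero] at hd; rw [toRegion_one]; exact hz.2.2 d hd)
  rw [Surface.front_of_mem hv.2.1, Surface.front_of_mem hw.2.1]
  refine le_trans ?_ (abs_add_abs_le_dist v w)
  rcases hvw.eq_or_lt with heq | hlt
  · rw [Surface.dist_mk]
    refine (dist_front_vertical_le false (by simpa using heq)).trans ?_
    simp
  · rw [hside v hv.2, Surface.dist_mk]
    have hm : u.2 / 2 < min v.2 w.2 := lt_min hv.1.1 hw.1.1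
    have h1 := dist_front_le (p := toRegion ⟨v, hv.2.1⟩) (q := toRegion ⟨w, hw.2.1⟩)
      (y := min v.2 w.2) (by simpa using hlt) (by linarith) (by simp) (by simp) fun d hd1 hd2 => by
        rw [toRegion_zero] at hd1 hd2
        by_cases hd : u.2 / 2 ≤ d.side
        · have hvd := hv.1.2 d hd
          have hwd := hw.1.2 d hd
          rcases lt_trichotomy d.pos u.1 with h | h | h
          · exact absurd (hvd.1 h) hd1.not_gt
          · exact lt_min (hvd.2.2 h) (hwd.2.2 h)
          · exact absurd (hwd.2.1 h) hd2.not_gt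
        · linarith [d.slitLength_le_side]
    refine h1.trans ?_
    simp only [toRegion_zero, toRegion_one]
    rw [abs_of_neg (by linarith : v.1 - w.1 < 0)]
    rcases le_total v.2 w.2 with h | h
    · rw [min_eq_left h, abs_of_nonpos (by linarith)]; linarith
    · rw [min_eq_right h, abs_of_nonneg (by linarith)]; linarith

/-- The surface is covered by the charts. -/
theorem surface_cases (x : Surface) :
    (∃ u ∈ flatRegion, Surface.back u = x) ∨ (∃ u ∈ unslitRegion, Surface.front u = x) ∨
      ∃ d b, ∃ u ∈ d.flatSquare, Surface.face d b u = x := by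
  obtain ⟨x, rfl⟩ := Surface.surjective_mk x
  cases x with
  | back p =>
    obtain ⟨u, hu, -⟩ := exists_toRegion p
    exact .inl ⟨u, u.2, by rw [Surface.back_of_mem u.2, ← hu]⟩
  | pillow d b q =>
    obtain ⟨u, hu⟩ := d.exists_toSquare q
    exact .inr (.inr ⟨d, b, u, u.2, by rw [Surface.face_of_mem b u.2, ← hu]⟩)
  | front b p =>
    rcases (height_nonneg p).eq_or_lt with h0 | h0
    · obtain ⟨u, hu, -⟩ := exists_toRegion p
      refine .inl ⟨u, u.2, ?_⟩
      rw [Surface.back_of_mem u.2, hu, eq_comm]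
      exact Surface.mk_eq_mk.2 (Glue.seam b p (.inl h0.symm)).dist_eq
    · by_cases hp : ∃ d : Dyadic, p.1 ∈ d.slit
      · obtain ⟨d, hd⟩ := hp
        obtain ⟨q, hq⟩ := exists_glue_pillow hd b
        obtain ⟨u, hu⟩ := d.exists_toSquare q
        refine .inr (.inr ⟨d, b, u, u.2, ?_⟩)
        rw [Surface.face_of_mem b u.2, hu, eq_comm]
        exact Surface.mk_eq_mk.2 hq.dist_eq
      · obtain ⟨u, hu, hu'⟩ := exists_toRegion p
        refine .inr (.inl ⟨u, ⟨u.2, by rw [hu']; exact h0, fun d hd => ?_⟩, ?_⟩)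
        · rw [hu'] at hd ⊢
          exact lt_of_not_ge fun h => hp ⟨d, hd.symm, height_nonneg p, h⟩
        · rw [Surface.front_of_mem u.2, hu]
          cases b
          · rfl
          · exact Surface.mk_eq_mk.2 (Glue.unslit p fun d hd => hp ⟨d, hd⟩).dist_eq

theorem Surface.base_front {u : ℝ × ℝ} (h : u ∈ flatRegion) : (Surface.front u).base = u.1 := by
  rw [Surface.front_of_mem h, Surface.base_mk]; exact toRegion_zero ⟨u, h⟩

theorem Surface.base_back {u : ℝ × ℝ} (h : u ∈ flatRegion) : (Surface.back u).base = u.1 := by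
  rw [Surface.back_of_mem h, Surface.base_mk]; exact toRegion_zero ⟨u, h⟩

theorem Surface.height_front {u : ℝ × ℝ} (h : u ∈ flatRegion) : (Surface.front u).height = u.2 := by
  rw [Surface.front_of_mem h, Surface.height_mk]; exact toRegion_one ⟨u, h⟩

theorem Surface.height_back {u : ℝ × ℝ} (h : u ∈ flatRegion) : (Surface.back u).height = u.2 := by
  rw [Surface.back_of_mem h, Surface.height_mk]; exact toRegion_one ⟨u, h⟩

theorem Surface.base_face {d : Dyadic} {b : Bool} {u : ℝ × ℝ} (h : u ∈ d.flatSquare) :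
    (Surface.face d b u).base = d.pos := by
  rw [Surface.face_of_mem b h, Surface.base_mk]; rfl

/-! ### Retraction onto a pillowcase -/

open Classical in
/-- The first coordinate on the pillowcase of `d`, extended to the surface. -/
def Piece.along (d : Dyadic) : Piece → ℝ
  | .pillow e _ q => if e = d then q.1 0 else min (min (q.1 0) e.slitLength) d.slitLength
  | x => min x.height d.slitLength

open Classical in
/-- The second coordinate on the pillowcase of `d`, extended by zero to the surface. -/
def Piece.across (d : Dyadic) : Piece → ℝ
  | .pillow e _ q => if e = d then q.1 1 else 0
  | _ => 0

theorem abs_min_sub_min_le (a b c : ℝ) : |min a c - min b c| ≤ |a - b| := by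
  refine (abs_min_sub_min_le_max _ _ _ _).trans ?_
  rw [sub_self, abs_zero, max_eq_left (abs_nonneg _)]

theorem abs_along_sub_le (d : Dyadic) (x y : Piece) : |x.along d - y.along d| ≤ dist x y := by
  refine (abs_sub_le_mul_dist (K := 1) (fun x y h => ?_) (fun x y L h => ?_) zero_le_one x y).trans
    (one_mul _).le
  · cases h with
    | slit b e p q hp h0 h1 =>
      simp only [Piece.along, Piece.height]
      split_ifs with h
      · subst h; rw [h0, min_eq_left hp.2.2]
      · rw [h0, min_eq_left hp.2.2]
    | _ => rfl
  · rw [one_mul]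
    cases h with
    | pillow e b q q' =>
      simp only [Piece.along]
      split_ifs with h
      · exact abs_coord_sub_le _ _ 0
      · exact (abs_min_sub_min_le _ _ _).trans ((abs_min_sub_min_le _ _ _).trans
          (abs_coord_sub_le _ _ 0))
    | _ => exact (abs_min_sub_min_le _ _ _).trans (abs_coord_sub_le _ _ 1)

theorem abs_across_sub_le (d : Dyadic) (x y : Piece) : |x.across d - y.across d| ≤ dist x y := by
  refine (abs_sub_le_mul_dist (K := 1) (fun x y h => ?_) (fun x y L h => ?_) zero_le_one x y).trans
    (one_mul _).le
  · cases h with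
    | slit b e p q hp h0 h1 => simp [Piece.across, h1]
    | _ => rfl
  · cases h with
    | pillow e b q q' =>
      simp only [Piece.across]
      split_ifs with h
      · rw [one_mul]; exact abs_coord_sub_le _ _ 1
      · simp
    | _ => simp [Piece.across]

theorem dist_le_dist_face {d : Dyadic} {b : Bool} {u v : ℝ × ℝ} (hu : u ∈ d.flatSquare)
    (hv : v ∈ d.flatSquare) : dist u v ≤ dist (Surface.face d b u) (Surface.face d b v) := by
  rw [Surface.face_of_mem b hu, Surface.face_of_mem b hv, Surface.dist_mk]
  refine max_le ?_ ?_
  · simpa [Piece.along, Real.dist_eq] using abs_along_sub_le d (.pillow d b (d.toSquare ⟨u, hu⟩))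
      (.pillow d b (d.toSquare ⟨v, hv⟩))
  · simpa [Piece.across, Real.dist_eq] using abs_across_sub_le d (.pillow d b (d.toSquare ⟨u, hu⟩))
      (.pillow d b (d.toSquare ⟨v, hv⟩))

/-! ### Upper bounds for the Hausdorff measure -/

theorem two_rpow_two : ((2 : ℝ≥0) : ℝ≥0∞) ^ (2 : ℝ) = 4 := by norm_num

theorem hausdorffMeasure_back_le {s : Set (ℝ × ℝ)} (hs : s ⊆ flatRegion) :
    Measure.hausdorffMeasure 2 (Surface.back '' s) ≤ 4 * volume s := by
  rw [← hausdorffMeasure_prod_real, ← two_rpow_two]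
  exact (Surface.lipschitzOnWith_back.mono hs).hausdorffMeasure_image_le zero_le_two

theorem hausdorffMeasure_front_le {s : Set (ℝ × ℝ)} (hs : s ⊆ unslitRegion) :
    Measure.hausdorffMeasure 2 (Surface.front '' s) ≤ 4 * volume s := by
  rw [← hausdorffMeasure_prod_real, ← two_rpow_two]
  refine hausdorffMeasure_image_le_of_locally zero_le_two fun u hu => ?_
  obtain ⟨U, hU, hL⟩ := Surface.locally_lipschitz_front u (hs hu)
  exact ⟨U, hU, hL.mono (inter_subset_inter_right _ hs)⟩

theorem hausdorffMeasure_face_le {d : Dyadic} {b : Bool} {s : Set (ℝ × ℝ)}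
    (hs : s ⊆ d.flatSquare) :
    Measure.hausdorffMeasure 2 (Surface.face d b '' s) ≤ 4 * volume s := by
  rw [← hausdorffMeasure_prod_real, ← two_rpow_two]
  exact ((Surface.lipschitzOnWith_face d b).mono hs).hausdorffMeasure_image_le zero_le_two

theorem volume_prod_Icc {a b c d : ℝ} (h : a ≤ b) :
    volume (Icc a b ×ˢ Icc c d) = ENNReal.ofReal ((b - a) * (d - c)) := by
  rw [Measure.volume_eq_prod, Measure.prod_prod, Real.volume_Icc, Real.volume_Icc,
    ENNReal.ofReal_mul (sub_nonneg.2 h)]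

theorem volume_closedBall (u : ℝ × ℝ) {r : ℝ} (hr : 0 ≤ r) :
    volume (Metric.closedBall u r) = ENNReal.ofReal (4 * r ^ 2) := by
  rw [show u = (u.1, u.2) from rfl, ← closedBall_prod_same, Real.closedBall_eq_Icc,
    Real.closedBall_eq_Icc, volume_prod_Icc (by linarith)]
  congr 1; ring

/-- Disjoint planar boxes, of area `min side r ^ 2`, that serve to sum the areas of the pillowcases
in a ball of radius `r`. Boxes of small pillowcases are separated by their heights or, at the same
height, by their positions; boxes of large pillowcases lie below the axis. -/
def countingBox (r : ℝ) (d : Dyadic) : Set (ℝ × ℝ) :=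
  Ico d.pos (d.pos + min d.side r) ×ˢ
    if d.side ≤ r then Ioc d.side (2 * d.side) else Ioc (-r) 0

theorem measurableSet_countingBox (r : ℝ) (d : Dyadic) : MeasurableSet (countingBox r d) := by
  unfold countingBox
  split_ifs <;> exact measurableSet_Ico.prod measurableSet_Ioc

theorem volume_countingBox {r : ℝ} (hr : 0 < r) (d : Dyadic) :
    volume (countingBox r d) = ENNReal.ofReal (min d.side r ^ 2) := by
  have h0 : 0 ≤ min d.side r := le_min d.side_nonneg hr.le
  rw [countingBox, Measure.volume_eq_prod, Measure.prod_prod, Real.volume_Ico,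
    add_sub_cancel_left, sq, ENNReal.ofReal_mul h0]
  congr 1
  split_ifs with h
  · rw [Real.volume_Ioc, min_eq_left h]; congr 1; ring
  · rw [Real.volume_Ioc, min_eq_right (le_of_not_ge h)]; congr 1; ring

theorem side_eq_of_mem_Ioc {d e : Dyadic} {y : ℝ} (hd : y ∈ Ioc d.side (2 * d.side))
    (he : y ∈ Ioc e.side (2 * e.side)) : d.side = e.side := by
  wlog hm : d.m ≤ e.m generalizing d e
  · exact (this he hd (le_of_not_ge hm)).symm
  rcases hm.eq_or_lt with h | h
  · unfold Dyadic.side; rw [h]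
  · exfalso
    have : 2 * e.side ≤ d.side := by
      unfold Dyadic.side
      rw [mul_one_div, div_le_div_iff₀ (by positivity) (by positivity), one_mul, ← pow_succ']
      exact pow_le_pow_right₀ one_le_two h
    linarith [hd.1, he.2]

theorem pairwise_disjoint_countingBox (r : ℝ) :
    Pairwise (Function.onFun Disjoint (countingBox r)) := by
  intro d e hne
  refine disjoint_left.2 fun u hd he => hne ?_
  by_contra hcon
  have hpos := Dyadic.min_side_le_abs hcon
  obtain ⟨⟨hd1, hd2⟩, hd3⟩ := hd
  obtain ⟨⟨he1, he2⟩, he3⟩ := he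
  have habs : |d.pos - e.pos| < max (min d.side r) (min e.side r) := by
    rw [abs_lt]
    constructor
    · linarith [le_max_left (min d.side r) (min e.side r)]
    · linarith [le_max_right (min d.side r) (min e.side r)]
  have hsd := d.side_pos
  have hse := e.side_pos
  split_ifs at hd3 he3 with h1 h2 h2
  · have := side_eq_of_mem_Ioc hd3 he3
    rw [← this, max_self, min_eq_left h1] at habs
    rw [← this, min_self] at hpos
    linarith
  · linarith [hd3.1, he3.2]
  · linarith [hd3.2, he3.1]
  · rw [min_eq_right (le_of_not_ge h1), min_eq_right (le_of_not_ge h2), max_self] at habs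
    exact absurd (lt_min (not_le.1 h1) (not_le.1 h2)) (by linarith)

theorem tsum_min_side_sq_le {r : ℝ} (hr : 0 < r) (t : ℝ) :
    ∑' d : {d : Dyadic | |d.pos - t| ≤ r}, ENNReal.ofReal (min d.1.side r ^ 2) ≤
      ENNReal.ofReal (9 * r ^ 2) := by
  set D : Set Dyadic := {d | |d.pos - t| ≤ r}
  calc ∑' d : D, ENNReal.ofReal (min d.1.side r ^ 2)
      = ∑' d : D, volume (countingBox r d.1) := by
        simp only [volume_countingBox hr]
    _ = volume (⋃ d : D, countingBox r d.1) :=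
        (measure_iUnion (fun (d e : D) hde => pairwise_disjoint_countingBox r
          fun h => hde (Subtype.ext h))
          fun (d : D) => measurableSet_countingBox r d.1).symm
    _ ≤ volume (Icc (t - r) (t + 2 * r) ×ˢ Icc (-r) (2 * r)) := by
        refine measure_mono (iUnion_subset fun (d : D) u hu => ?_)
        obtain ⟨hd1, hd2⟩ := abs_le.1 (show |d.1.pos - t| ≤ r from d.2)
        obtain ⟨⟨hu1, hu2⟩, hu3⟩ := hu
        have := min_le_right d.1.side r
        refine ⟨⟨by linarith, by linarith⟩, ?_⟩
        split_ifs at hu3 with h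
        · exact ⟨by linarith [hu3.1, d.1.side_pos], hu3.2.trans (by linarith)⟩
        · exact ⟨hu3.1.le, hu3.2.trans (by linarith)⟩
    _ = ENNReal.ofReal (9 * r ^ 2) := by
        rw [volume_prod_Icc (by linarith)]; congr 1; ring

/-- The part of a face of a pillowcase in a ball of radius `r` has area comparable at most to the
square of `min side r`. -/
theorem hausdorffMeasure_face_inter_ball_le (x : Surface) {r : ℝ} (hr : 0 < r) (d : Dyadic)
    (b : Bool) :
    Measure.hausdorffMeasure 2
      (Surface.face d b '' (d.flatSquare ∩ Surface.face d b ⁻¹' Metric.ball x r)) ≤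
        ENNReal.ofReal (64 * min d.side r ^ 2) := by
  refine (hausdorffMeasure_face_le inter_subset_left).trans ?_
  rw [show (64 : ℝ) * min d.side r ^ 2 = 4 * (16 * min d.side r ^ 2) by ring,
    ENNReal.ofReal_mul (by norm_num : (0 : ℝ) ≤ 4), ENNReal.ofReal_ofNat]
  refine mul_le_mul_right ?_ _
  rcases (d.flatSquare ∩ Surface.face d b ⁻¹' Metric.ball x r).eq_empty_or_nonempty with h | h
  · rw [h, measure_empty]; exact bot_le
  rcases le_total d.side r with hdr | hdr
  · refine (measure_mono inter_subset_left).trans ?_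
    rw [Dyadic.flatSquare, volume_prod_Icc d.side_nonneg, min_eq_left hdr]
    exact ENNReal.ofReal_le_ofReal (by nlinarith [sq_nonneg d.side])
  · obtain ⟨u, hu, hux⟩ := h
    refine (measure_mono (t := Metric.closedBall u (2 * r)) fun v hv => ?_).trans ?_
    · rw [Metric.mem_closedBall]
      refine (dist_le_dist_face (b := b) hv.1 hu).trans ?_
      have h1 : dist (Surface.face d b v) x < r := hv.2
      have h2 : dist (Surface.face d b u) x < r := hux
      linarith [dist_triangle_right (Surface.face d b v) (Surface.face d b u) x]
    · rw [volume_closedBall u (by linarith), min_eq_right hdr]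
      exact ENNReal.ofReal_le_ofReal (by nlinarith)

theorem Surface.hausdorffMeasure_ball_le (x : Surface) {r : ℝ} (hr : 0 < r) :
    Measure.hausdorffMeasure 2 (Metric.ball x r) ≤ ENNReal.ofReal (2000 * r ^ 2) := by
  set u₀ : ℝ × ℝ := (x.base, x.height)
  set D : Set Dyadic := {d | |d.pos - x.base| ≤ r} with hD
  set P : Dyadic → Bool → Set Surface := fun d b =>
    Surface.face d b '' (d.flatSquare ∩ Surface.face d b ⁻¹' Metric.ball x r) with hP
  have hcover : Metric.ball x r ⊆ Surface.back '' (flatRegion ∩ Metric.closedBall u₀ r) ∪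
      Surface.front '' (unslitRegion ∩ Metric.closedBall u₀ r) ∪
        ⋃ d ∈ D, (P d false ∪ P d true) := by
    intro y hy
    have hy' : dist y x ≤ r := (Metric.mem_ball.1 hy).le
    have hbase := (Surface.abs_base_sub_le y x).trans hy'
    have hheight := (Surface.abs_height_sub_le y x).trans hy'
    rcases surface_cases y with ⟨u, hu, rfl⟩ | ⟨u, hu, rfl⟩ | ⟨d, b, u, hu, rfl⟩
    · rw [Surface.base_back hu] at hbase
      rw [Surface.height_back hu] at hheight
      exact .inl (.inl (mem_image_of_mem _ ⟨hu, max_le hbase hheight⟩))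
    · rw [Surface.base_front hu.1] at hbase
      rw [Surface.height_front hu.1] at hheight
      exact .inl (.inr (mem_image_of_mem _ ⟨hu, max_le hbase hheight⟩))
    · rw [Surface.base_face hu] at hbase
      refine .inr (mem_iUnion₂.2 ⟨d, hbase, ?_⟩)
      cases b
      · exact .inl (mem_image_of_mem _ ⟨hu, hy⟩)
      · exact .inr (mem_image_of_mem _ ⟨hu, hy⟩)
  have hball := volume_closedBall u₀ hr.le
  have h1 : Measure.hausdorffMeasure 2 (Surface.back '' (flatRegion ∩ Metric.closedBall u₀ r)) ≤
      ENNReal.ofReal (16 * r ^ 2) := by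
    refine (hausdorffMeasure_back_le inter_subset_left).trans
      ((mul_le_mul_right (measure_mono inter_subset_right) _).trans_eq ?_)
    rw [hball, ← ENNReal.ofReal_ofNat, ← ENNReal.ofReal_mul (by norm_num)]
    congr 1; ring
  have h2 : Measure.hausdorffMeasure 2
      (Surface.front '' (unslitRegion ∩ Metric.closedBall u₀ r)) ≤ ENNReal.ofReal (16 * r ^ 2) := by
    refine (hausdorffMeasure_front_le inter_subset_left).trans
      ((mul_le_mul_right (measure_mono inter_subset_right) _).trans_eq ?_)
    rw [hball, ← ENNReal.ofReal_ofNat, ← ENNReal.ofReal_mul (by norm_num)]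
    congr 1; ring
  have h3 : Measure.hausdorffMeasure 2 (⋃ d ∈ D, (P d false ∪ P d true)) ≤
      ENNReal.ofReal (128 * (9 * r ^ 2)) := by
    refine (measure_biUnion_le _ (to_countable D) _).trans ?_
    rw [ENNReal.ofReal_mul (by norm_num)]
    refine le_trans ?_ (mul_le_mul_right (tsum_min_side_sq_le hr x.base) _)
    rw [← ENNReal.tsum_mul_left]
    refine ENNReal.tsum_le_tsum fun d => (measure_union_le _ _).trans ?_
    refine (add_le_add (hausdorffMeasure_face_inter_ball_le x hr d.1 false)
      (hausdorffMeasure_face_inter_ball_le x hr d.1 true)).trans_eq ?_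
    rw [← ENNReal.ofReal_add (by positivity) (by positivity), ← ENNReal.ofReal_mul (by norm_num)]
    congr 1; ring
  refine (measure_mono hcover).trans ((measure_union_le _ _).trans
    ((add_le_add ((measure_union_le _ _).trans (add_le_add h1 h2)) h3).trans ?_))
  rw [← ENNReal.ofReal_add (by positivity) (by positivity),
    ← ENNReal.ofReal_add (by positivity) (by positivity)]
  exact ENNReal.ofReal_le_ofReal (by nlinarith [sq_nonneg r])

/-- The area of a strip of the cusp with the pillowcases removed. -/
theorem hausdorffMeasure_strip_le {a b : ℝ} (hab : a ≤ b) :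
    Measure.hausdorffMeasure 2
      {x : Surface | x.base ∈ Icc a b ∧ x.base ∉ range Dyadic.pos} ≤
        ENNReal.ofReal (8 * ((b - a) * profile b)) := by
  set Q : Set (ℝ × ℝ) := Icc a b ×ˢ Icc 0 (profile b)
  have hmem : ∀ {u : ℝ × ℝ}, u ∈ flatRegion → u.1 ∈ Icc a b → u ∈ Q := fun hu h =>
    ⟨h, hu.2.2.1, hu.2.2.2.trans (profile_mono h.2)⟩
  have hcover : {x : Surface | x.base ∈ Icc a b ∧ x.base ∉ range Dyadic.pos} ⊆
      Surface.back '' (flatRegion ∩ Q) ∪ Surface.front '' (unslitRegion ∩ Q) := by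
    rintro x ⟨hx, hxd⟩
    rcases surface_cases x with ⟨u, hu, rfl⟩ | ⟨u, hu, rfl⟩ | ⟨d, b, u, hu, rfl⟩
    · rw [Surface.base_back hu] at hx
      exact .inl (mem_image_of_mem _ ⟨hu, hmem hu hx⟩)
    · rw [Surface.base_front hu.1] at hx
      exact .inr (mem_image_of_mem _ ⟨hu, hmem hu.1 hx⟩)
    · rw [Surface.base_face hu] at hxd
      exact absurd (mem_range_self d) hxd
  have hQ : volume Q = ENNReal.ofReal ((b - a) * profile b) := by
    rw [volume_prod_Icc hab, sub_zero]
  refine (measure_mono hcover).trans ((measure_union_le _ _).trans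
    ((add_le_add ((hausdorffMeasure_back_le inter_subset_left).trans
      (mul_le_mul_right (measure_mono inter_subset_right) _))
      ((hausdorffMeasure_front_le inter_subset_left).trans
      (mul_le_mul_right (measure_mono inter_subset_right) _))).trans_eq ?_))
  rw [hQ, ← add_mul, ENNReal.ofReal_mul (by norm_num : (0 : ℝ) ≤ 8)]
  norm_num

/-! ### Lower bounds for the Hausdorff measure -/

/-- The set `s` is mapped by some `1`-Lipschitz map of the surface to the plane onto a set that
contains a square of side length `h`; this bounds its Hausdorff `2`-measure from below. -/
def CapturesSquare (s : Set Surface) (h : ℝ) : Prop :=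
  ∃ G : Surface → ℝ × ℝ, LipschitzWith 1 G ∧
    ∃ a b, Icc a (a + h) ×ˢ Icc b (b + h) ⊆ G '' s

theorem CapturesSquare.mono {s t : Set Surface} {h : ℝ} (hs : CapturesSquare s h) (hst : s ⊆ t) :
    CapturesSquare t h := by
  obtain ⟨G, hG, a, b, hab⟩ := hs
  exact ⟨G, hG, a, b, hab.trans (image_mono hst)⟩

theorem exists_retraction (d : Dyadic) : ∃ G : Surface → ℝ × ℝ, LipschitzWith 1 G ∧
    ∀ b, ∀ u ∈ d.flatSquare, G (Surface.face d b u) = u := by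
  obtain ⟨G, hG, hG'⟩ := exists_lift (h := fun x : Piece => (x.along d, x.across d)) (K := 1)
    (LipschitzWith.of_dist_le_mul fun x y => by
      rw [NNReal.coe_one, one_mul]
      exact max_le (abs_along_sub_le d x y) (abs_across_sub_le d x y))
  refine ⟨G, hG, fun b u hu => ?_⟩
  rw [Surface.face_of_mem b hu, hG']
  simp [Piece.along, Piece.across]

/-- A subinterval of `[0, l]` of length `h` that contains a given point. -/
theorem exists_Icc_subset {l h x : ℝ} (hh : 0 ≤ h) (hl : h ≤ l) (hx : x ∈ Icc 0 l) :
    ∃ a, x ∈ Icc a (a + h) ∧ Icc a (a + h) ⊆ Icc 0 l := by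
  refine ⟨min x (l - h), ⟨min_le_left _ _, ?_⟩, Icc_subset_Icc (le_min hx.1 (by linarith)) ?_⟩
  · rw [min_add, le_min_iff]; exact ⟨by linarith, by linarith [hx.2]⟩
  · linarith [min_le_right x (l - h)]

theorem abs_sub_le_of_mem_Icc {a h x y : ℝ} (hx : x ∈ Icc a (a + h)) (hy : y ∈ Icc a (a + h)) :
    |x - y| ≤ h := by
  rw [abs_le]; constructor <;> linarith [hx.1, hx.2, hy.1, hy.2]

theorem capturesSquare_face {d : Dyadic} {b : Bool} {u : ℝ × ℝ} (hu : u ∈ d.flatSquare) {r h : ℝ}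
    (hh : 0 ≤ h) (hd : h ≤ d.side) (hr : 2 * h < r) :
    CapturesSquare (Metric.ball (Surface.face d b u) r) h := by
  obtain ⟨G, hG, hG'⟩ := exists_retraction d
  obtain ⟨a, ha, ha'⟩ := exists_Icc_subset hh hd hu.1
  obtain ⟨c, hc, hc'⟩ := exists_Icc_subset hh hd hu.2
  refine ⟨G, hG, a, c, fun v hv => ?_⟩
  have hv' : v ∈ d.flatSquare := ⟨ha' hv.1, hc' hv.2⟩
  refine ⟨Surface.face d b v, ?_, hG' b v hv'⟩
  rw [Metric.mem_ball, Surface.face_of_mem b hu, Surface.face_of_mem b hv', Surface.dist_mk]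
  refine (dist_pillow_le _ _ _ _).trans_lt ?_
  simp only [Dyadic.toSquare_zero, Dyadic.toSquare_one]
  linarith [abs_sub_le_of_mem_Icc hv.1 ha, abs_sub_le_of_mem_Icc hv.2 hc]

/-- Near each point of the floor there is a pillowcase of every size. -/
theorem capturesSquare_floor (p : region) {r : ℝ} (hr : 0 < r) (hr1 : r ≤ 1) :
    CapturesSquare (Metric.ball (Surface.mk (.back (floorPt p))) r) (r / 32) := by
  obtain ⟨d, hd, hd1, hd2⟩ := Dyadic.exists_near (base_nonneg p) (base_lt_one p)
    (by positivity : 0 < r / 8) (by linarith)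
  have h0 : ((0 : ℝ), (0 : ℝ)) ∈ d.flatSquare :=
    ⟨⟨le_rfl, d.side_nonneg⟩, ⟨le_rfl, d.side_nonneg⟩⟩
  refine (capturesSquare_face (b := false) h0 (r := r / 2) (by positivity) (by linarith)
    (by linarith)).mono (Metric.ball_subset_ball' ?_)
  have h1 := dist_pillow_foot d false (d.toSquare ⟨_, h0⟩)
  have h2 := dist_back_le d.foot (floorPt p)
  have h3 := dist_triangle (Piece.pillow d false (d.toSquare ⟨_, h0⟩)) (.back d.foot)
    (.back (floorPt p))
  simp only [Dyadic.toSquare_zero, Dyadic.toSquare_one, Dyadic.foot_zero, Dyadic.foot_one,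
    floorPt_zero, floorPt_one, sub_zero, abs_zero, add_zero] at h1 h2
  rw [Surface.face_of_mem false h0, Surface.dist_mk]
  linarith

theorem capturesSquare_of_near_floor {x : Surface} {p : region} {r : ℝ} (hr : 0 < r) (hr1 : r ≤ 1)
    (h : dist x (Surface.mk (.back (floorPt p))) ≤ r / 2) :
    CapturesSquare (Metric.ball x r) (r / 64) := by
  have := capturesSquare_floor p (half_pos hr) (by linarith)
  rw [div_div] at this
  norm_num at this
  exact this.mono (Metric.ball_subset_ball' (by rw [dist_comm]; linarith))

/-- The folding map captures a square in the region once the square lifts to the given set. -/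
theorem capturesSquare_of_lift {s : Set Surface} {a b h : ℝ}
    (H : ∀ v ∈ Icc a (a + h) ×ˢ Icc b (b + h),
      ∃ x : Piece, Surface.mk x ∈ s ∧ x.base = v.1 ∧ x.height = v.2) : CapturesSquare s h := by
  refine ⟨fun x => (x.base, x.height), LipschitzWith.of_dist_le_mul fun x y => ?_, a, b,
    fun v hv => ?_⟩
  · rw [NNReal.coe_one, one_mul]
    exact max_le (Surface.abs_base_sub_le x y) (Surface.abs_height_sub_le x y)
  · obtain ⟨x, hx, h1, h2⟩ := H v hv
    exact ⟨_, hx, Prod.ext ((Surface.base_mk x).trans h1) ((Surface.height_mk x).trans h2)⟩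

/-- The square below and to the left of a point of the region, at distances comparable to a small
fraction of the height of the point, lies in the region. -/
theorem mem_flatRegion_of_mem_box {u v : ℝ × ℝ} (hu : u ∈ flatRegion) {h : ℝ} (hh : 0 < h)
    (hu2 : 32 * h ≤ u.2)
    (hv : v ∈ Icc (u.1 - 2 * h) (u.1 - 2 * h + h) ×ˢ Icc (u.2 - 3 * h) (u.2 - 3 * h + h)) :
    v ∈ flatRegion := by
  obtain ⟨⟨h1, h2⟩, h3, h4⟩ := hv
  have h5 := profile_le_self hu.1 hu.2.1.le
  have h6 := hu.2.2.2
  have h7 := abs_le.1 (abs_profile_sub_le (s := v.1) (t := u.1)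
    ⟨by linarith, by linarith [hu.2.1]⟩ ⟨hu.1, hu.2.1.le⟩)
  rw [abs_of_nonpos (by linarith : v.1 - u.1 ≤ 0)] at h7
  exact ⟨by linarith, by linarith [hu.2.1], by linarith, by linarith [h7.1]⟩

/-- Every ball of radius at most `1` captures a square of comparable size. Points of small height and
points of small pillowcases are near the floor; a point in a large pillowcase has a square of that
pillowcase nearby; and next to a point of large height there is a square of the region, unless a long
slit, hence a large pillowcase, lies in between. -/
theorem capturesSquare_ball (x : Surface) {r : ℝ} (hr : 0 < r) (hr1 : r ≤ 1) :
    CapturesSquare (Metric.ball x r) (r / 64) := by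
  set h : ℝ := r / 64 with hh
  have hh0 : 0 < h := by positivity
  rcases surface_cases x with ⟨u, hu, rfl⟩ | ⟨u, hu, rfl⟩ | ⟨d, b, u, hu, rfl⟩
  · rcases le_total u.2 (r / 2) with h2 | h2
    · refine capturesSquare_of_near_floor (p := toRegion ⟨u, hu⟩) hr hr1 ?_
      rw [Surface.back_of_mem hu, Surface.dist_mk]
      refine (dist_back_le _ _).trans ?_
      simpa [abs_of_nonneg hu.2.2.1] using h2
    · refine capturesSquare_of_lift (a := u.1 - 2 * h) (b := u.2 - 3 * h) fun v hv => ?_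
      have hv' := mem_flatRegion_of_mem_box hu hh0 (by linarith) hv
      refine ⟨.back (toRegion ⟨v, hv'⟩), ?_, toRegion_zero ⟨v, hv'⟩, toRegion_one ⟨v, hv'⟩⟩
      rw [Metric.mem_ball, Surface.back_of_mem hu, Surface.dist_mk]
      refine (dist_back_le _ _).trans_lt ?_
      obtain ⟨⟨h3, h4⟩, h5, h6⟩ := hv
      simp only [toRegion_zero, toRegion_one]
      rw [abs_of_nonpos (by linarith), abs_of_nonpos (by linarith)]
      linarith
  · rcases le_total u.2 (r / 2) with h2 | h2
    · refine capturesSquare_of_near_floor (p := toRegion ⟨u, hu.1⟩) hr hr1 ?_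
      rw [Surface.front_of_mem hu.1, Surface.dist_mk]
      refine (dist_front_floor _ _).trans ?_
      simpa using h2
    · have hu' := hu.1
      have hside : ∀ d : Dyadic, u.2 - 3 * h ≤ d.slitLength → 29 * h ≤ d.side := fun d hd => by
        linarith [d.slitLength_le_side]
      by_cases hslit : ∃ d : Dyadic, u.1 - 2 * h < d.pos ∧ d.pos < u.1 ∧ u.2 - 3 * h ≤ d.slitLength
      · -- A slit blocks the way to the square; its pillowcase is large and can be entered.
        obtain ⟨d, hd1, hd2, hd3⟩ := hslit
        have hq : (u.2 - 3 * h, (0 : ℝ)) ∈ d.flatSquare :=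
          ⟨⟨by linarith, hd3.trans d.slitLength_le_side⟩, ⟨le_rfl, d.side_nonneg⟩⟩
        have hp : (d.pos, u.2 - 3 * h) ∈ flatRegion :=
          ⟨d.pos_nonneg, d.pos_lt_one, by linarith, hd3.trans d.slitLength_le_profile⟩
        refine (capturesSquare_face (b := true) hq (r := r / 2) hh0.le (by linarith [hside d hd3])
          (by linarith)).mono (Metric.ball_subset_ball' ?_)
        have h3 := (Glue.slit true d (toRegion ⟨_, hp⟩) (d.toSquare ⟨_, hq⟩)
          ⟨by simp, by simp; linarith, by simpa using hd3⟩ (by simp) (by simp)).dist_eq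
        have h4 := dist_front_le (p := toRegion ⟨_, hp⟩) (q := toRegion ⟨u, hu'⟩)
          (y := u.2 - 3 * h) (by simpa using hd2) (by linarith) (by simp) (by simp; linarith)
          fun e he1 he2 => by
            rw [toRegion_zero] at he1 he2
            by_contra hcon
            have hde : d ≠ e := fun hde => by subst hde; exact lt_irrefl _ he1
            have h5 := Dyadic.min_side_le_abs hde
            have h6 := le_min (hside d hd3) (hside e (not_lt.1 hcon))
            rw [abs_of_nonpos (by linarith [show d.pos < e.pos from he1])] at h5
            linarith [show e.pos < u.1 from he2]
        have h5 := dist_triangle (Piece.pillow d true (d.toSquare ⟨_, hq⟩))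
          (.front true (toRegion ⟨_, hp⟩)) (.front false (toRegion ⟨u, hu'⟩))
        rw [dist_comm] at h3
        simp only [toRegion_zero, toRegion_one] at h4
        rw [Surface.face_of_mem true hq, Surface.front_of_mem hu', Surface.dist_mk]
        linarith
      · push Not at hslit
        refine capturesSquare_of_lift (a := u.1 - 2 * h) (b := u.2 - 3 * h) fun v hv => ?_
        have hv' := mem_flatRegion_of_mem_box hu' hh0 (by linarith) hv
        refine ⟨.front true (toRegion ⟨v, hv'⟩), ?_, toRegion_zero ⟨v, hv'⟩, toRegion_one ⟨v, hv'⟩⟩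
        rw [Metric.mem_ball, Surface.front_of_mem hu', Surface.dist_mk]
        obtain ⟨⟨h3, h4⟩, h5, h6⟩ := hv
        refine (dist_front_le (p := toRegion ⟨v, hv'⟩) (q := toRegion ⟨u, hu'⟩)
          (y := u.2 - 3 * h) (by simp; linarith) (by linarith) (by simpa using h5)
          (by simp; linarith) fun e he1 he2 => ?_).trans_lt ?_
        · rw [toRegion_zero] at he1 he2
          exact hslit e (h3.trans_lt he1) he2
        · simp only [toRegion_zero, toRegion_one]
          linarith
  · rcases le_total h d.side with hd | hd
    · exact capturesSquare_face hu hh0.le hd (by linarith)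
    · refine capturesSquare_of_near_floor (p := d.foot) hr hr1 ?_
      have : floorPt d.foot = d.foot := region_ext (by simp) (by simp)
      rw [Surface.face_of_mem b hu, Surface.dist_mk, this]
      exact (dist_pillow_foot_le_side d b _).trans (by linarith)

theorem CapturesSquare.le_hausdorffMeasure {s : Set Surface} {h : ℝ} (hs : CapturesSquare s h)
    (hh : 0 ≤ h) : ENNReal.ofReal (h ^ 2) ≤ Measure.hausdorffMeasure 2 s := by
  obtain ⟨G, hG, a, b, hab⟩ := hs
  have h1 := (hG.lipschitzOnWith (s := s)).hausdorffMeasure_image_le (zero_le_two (α := ℝ))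
  rw [ENNReal.coe_one, ENNReal.one_rpow, one_mul, hausdorffMeasure_prod_real] at h1
  refine le_trans ?_ ((measure_mono hab).trans h1)
  rw [volume_prod_Icc (by linarith), add_sub_cancel_left, add_sub_cancel_left, sq]

/-! ### Ahlfors regularity -/

theorem Surface.ediam_le : Metric.ediam (univ : Set Surface) ≤ ENNReal.ofReal 3 :=
  Metric.ediam_le fun x _ y _ => by
    rw [edist_dist]; exact ENNReal.ofReal_le_ofReal (Surface.dist_le_three x y)

theorem Space.ediam_le : Metric.ediam (univ : Set Space) ≤ ENNReal.ofReal 7 :=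
  Metric.ediam_le fun x _ y _ => by
    rw [edist_dist]; exact ENNReal.ofReal_le_ofReal (Space.dist_le_seven x y)

theorem le_of_ofReal_lt {r D : ℝ} {e : ℝ≥0∞} (hr : 0 < r) (h : ENNReal.ofReal r < e)
    (he : e ≤ ENNReal.ofReal D) : r ≤ D :=
  ((ENNReal.ofReal_lt_ofReal_iff_of_nonneg hr.le).1 (h.trans_le he)).le

theorem isAhlforsRegular_surface : IsAhlforsRegular 2 Surface := by
  refine ⟨192 ^ 2, by norm_num, fun x r hr hrd => ?_⟩
  have hr3 := le_of_ofReal_lt hr hrd Surface.ediam_le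
  rw [Real.rpow_two]
  constructor
  · refine le_trans ?_ ((capturesSquare_ball x (r := r / 3) (by positivity)
      (by linarith)).le_hausdorffMeasure (by positivity) |>.trans
        (measure_mono (Metric.ball_subset_ball (by linarith))))
    refine le_of_eq ?_
    congr 1; ring
  · refine (Surface.hausdorffMeasure_ball_le x hr).trans (ENNReal.ofReal_le_ofReal ?_)
    nlinarith [sq_nonneg r]

theorem exists_Icc_subset_Ioo {s r : ℝ} (hs : s ∈ Ioo (-2 : ℝ) 2) (hr : 0 < r) (hr1 : r ≤ 1) :
    ∃ a, ∀ t ∈ Icc a (a + r / 2), t ∈ Ioo (-2 : ℝ) 2 ∧ |t - s| < r := by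
  rcases le_total 0 s with h | h
  · refine ⟨s - r / 2, fun t ht => ⟨⟨by linarith [ht.1], by linarith [ht.2, hs.2]⟩, ?_⟩⟩
    rw [abs_lt]; constructor <;> linarith [ht.1, ht.2]
  · refine ⟨s, fun t ht => ⟨⟨by linarith [ht.1, hs.1], by linarith [ht.2]⟩, ?_⟩⟩
    rw [abs_lt]; constructor <;> linarith [ht.1, ht.2]

/-- The product of a square-capturing chart of the surface with the second factor is a
`1`-Lipschitz map to `ℝ³`, whose image contains a box. -/
theorem Space.le_hausdorffMeasure_ball (x : Space) {r : ℝ} (hr : 0 < r) (hr1 : r ≤ 1) :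
    ENNReal.ofReal ((r / 64) ^ 2 * (r / 2)) ≤
      Measure.hausdorffMeasure 3 (Metric.ball x (2 * r)) := by
  obtain ⟨G, hG, a, b, hab⟩ := capturesSquare_ball x.fst hr hr1
  obtain ⟨c, hc⟩ := exists_Icc_subset_Ioo x.snd.2 hr hr1
  set F : Space → Fin 3 → ℝ := fun z => ![(G z.fst).1, (G z.fst).2, z.snd] with hF
  have hFL : LipschitzWith 1 F := by
    refine LipschitzWith.of_dist_le_mul fun z w => ?_
    rw [NNReal.coe_one, one_mul]
    have h1 : dist (G z.fst) (G w.fst) ≤ dist z w :=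
      (by simpa using hG.dist_le_mul z.fst w.fst : _ ≤ _).trans (Space.dist_fst_le z w)
    refine (dist_pi_le_iff dist_nonneg).2 fun i => ?_
    fin_cases i
    · exact (le_max_left _ _).trans h1
    · exact (le_max_right _ _).trans h1
    · exact Space.dist_snd_le z w
  have hsub : Icc ![a, b, c] ![a + r / 64, b + r / 64, c + r / 2] ⊆
      F '' Metric.ball x (2 * r) := by
    intro v hv
    have hv1 := hv.1
    have hv2 := hv.2
    obtain ⟨y, hy, hyv⟩ := hab (show (v 0, v 1) ∈ _ from
      ⟨⟨hv1 0, hv2 0⟩, ⟨hv1 1, hv2 1⟩⟩)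
    obtain ⟨ht1, ht2⟩ := hc (v 2) ⟨hv1 2, hv2 2⟩
    refine ⟨Space.pt y ⟨v 2, ht1⟩, ?_, ?_⟩
    · rw [Metric.mem_ball] at hy ⊢
      refine (Space.dist_le_add _ _).trans_lt ?_
      simp only [Space.fst_pt, Space.snd_pt, Real.dist_eq]
      linarith
    · funext i
      fin_cases i <;> simp [hF, hyv]
  have h1 := (hFL.lipschitzOnWith (s := Metric.ball x (2 * r))).hausdorffMeasure_image_le
    (by norm_num : (0 : ℝ) ≤ 3)
  rw [ENNReal.coe_one, ENNReal.one_rpow, one_mul] at h1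
  refine le_trans ?_ ((measure_mono hsub).trans h1)
  have h3 : (Measure.hausdorffMeasure 3 : Measure (Fin 3 → ℝ)) = volume := by
    have := hausdorffMeasure_pi_real (ι := Fin 3)
    rwa [Fintype.card_fin, Nat.cast_ofNat] at this
  rw [h3, Real.volume_Icc_pi, Fin.prod_univ_three]
  simp only [Matrix.cons_val_zero, Matrix.cons_val_one, Matrix.cons_val, add_sub_cancel_left]
  rw [← ENNReal.ofReal_mul (by positivity), ← ENNReal.ofReal_mul (by positivity), sq]

theorem isAhlforsRegular_space : IsAhlforsRegular 3 Space := by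
  refine ⟨2 * 14 ^ 3 * 64 ^ 2, by norm_num, fun x r hr hrd => ?_⟩
  have hr7 := le_of_ofReal_lt hr hrd Space.ediam_le
  have h3 : r ^ (3 : ℝ) = r ^ 3 := by exact_mod_cast Real.rpow_natCast r 3
  rw [h3]
  constructor
  · refine le_trans ?_ ((Space.le_hausdorffMeasure_ball x (r := r / 14) (by positivity)
      (by linarith)).trans (measure_mono (Metric.ball_subset_ball (by linarith))))
    refine le_of_eq ?_
    congr 1; ring
  · refine (measure_mono (t := {z : Space | z.fst ∈ Metric.ball x.fst r ∧
      (z.snd : ℝ) ∈ Icc ((x.snd : ℝ) - r) (x.snd + r)}) fun z hz => ?_).trans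
      ((hausdorffMeasure_product_le Space.dist_le_add _ (by linarith)).trans ?_)
    · have hz' : dist z x < r := hz
      refine ⟨(Space.dist_fst_le z x).trans_lt hz', ?_⟩
      have := abs_le.1 ((Space.dist_snd_le z x).trans hz'.le)
      exact ⟨by linarith [this.1], by linarith [this.2]⟩
    · refine (mul_le_mul_right (Surface.hausdorffMeasure_ball_le x.fst hr) _).trans ?_
      rw [← ENNReal.ofReal_mul (by linarith)]
      refine ENNReal.ofReal_le_ofReal ?_
      nlinarith [pow_pos hr 3]

/-! ### Arc-length parametrizations -/

section ArcLength

variable {E : Type*} [MetricSpace E] {f : ℝ → E}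

theorem continuousOn_variationOnFromTo {s : Set ℝ} (hf : BoundedVariationOn f s)
    (hc : ContinuousOn f s) {a : ℝ} (ha : a ∈ s) :
    ContinuousOn (variationOnFromTo f s a) s := by
  intro x hx
  have h1 := (ENNReal.tendsto_toReal ENNReal.zero_ne_top).comp
    (hf.tendsto_eVariationOn_Icc_zero_left ((hc x hx).mono inter_subset_left))
  have h2 := (ENNReal.tendsto_toReal ENNReal.zero_ne_top).comp
    (hf.tendsto_eVariationOn_Icc_zero_right x ((hc x hx).mono inter_subset_left))
  have h3 := h1.add h2
  rw [ENNReal.toReal_zero, add_zero] at h3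
  refine tendsto_iff_dist_tendsto_zero.2 (squeeze_zero' (.of_forall fun _ => dist_nonneg) ?_ h3)
  filter_upwards [self_mem_nhdsWithin] with y hy
  rw [Real.dist_eq, variationOnFromTo.sub_right hf.locallyBoundedVariationOn ha hy hx]
  simp only [Function.comp_apply]
  rcases le_total x y with h | h
  · rw [variationOnFromTo.eq_of_le f s h, abs_of_nonneg ENNReal.toReal_nonneg]
    exact le_add_of_nonneg_left ENNReal.toReal_nonneg
  · rw [variationOnFromTo.eq_of_ge f s h, abs_neg, abs_of_nonneg ENNReal.toReal_nonneg]
    exact le_add_of_nonneg_right ENNReal.toReal_nonneg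

theorem image_variationOnFromTo {a b : ℝ} (hab : a ≤ b) (hf : BoundedVariationOn f (Icc a b))
    (hc : ContinuousOn f (Icc a b)) :
    variationOnFromTo f (Icc a b) a '' Icc a b = Icc 0 (eVariationOn f (Icc a b)).toReal := by
  have ha : a ∈ Icc a b := left_mem_Icc.2 hab
  have hb : variationOnFromTo f (Icc a b) a b = (eVariationOn f (Icc a b)).toReal := by
    rw [variationOnFromTo.eq_of_le f _ hab, inter_self]
  refine Subset.antisymm ?_ ?_
  · rintro _ ⟨c, hc, rfl⟩
    refine ⟨variationOnFromTo.nonneg_of_le f _ hc.1, ?_⟩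
    rw [← hb]
    exact variationOnFromTo.monotoneOn hf.locallyBoundedVariationOn ha hc (right_mem_Icc.2 hab) hc.2
  · have := intermediate_value_Icc hab (continuousOn_variationOnFromTo hf hc ha)
    rwa [variationOnFromTo.self, hb] at this

theorem lipschitzOnWith_naturalParameterization {a b : ℝ} (hab : a ≤ b)
    (hf : BoundedVariationOn f (Icc a b)) (hc : ContinuousOn f (Icc a b)) :
    LipschitzOnWith 1 (naturalParameterization f (Icc a b) a)
      (Icc 0 (eVariationOn f (Icc a b)).toReal) := by
  have h := has_unit_speed_naturalParameterization f hf.locallyBoundedVariationOn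
    (left_mem_Icc.2 hab)
  rw [image_variationOnFromTo hab hf hc] at h
  intro x hx y hy
  wlog hxy : x ≤ y generalizing x y
  · rw [edist_comm, edist_comm x]; exact this hy hx (le_of_not_ge hxy)
  have h1 := h hx hy
  rw [ENNReal.coe_one, one_mul, edist_comm x y, edist_dist y x, Real.dist_eq,
    abs_of_nonneg (sub_nonneg.2 hxy)]
  rw [NNReal.coe_one, one_mul] at h1
  rw [← h1]
  exact eVariationOn.edist_le _ ⟨hx, le_rfl, hxy⟩ ⟨hy, hxy, le_rfl⟩

theorem exists_naturalParameterization_eq {a b : ℝ} (hab : a ≤ b)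
    (hf : BoundedVariationOn f (Icc a b)) (hc : ContinuousOn f (Icc a b)) {c : ℝ}
    (hcab : c ∈ Icc a b) : ∃ u ∈ Icc 0 (eVariationOn f (Icc a b)).toReal,
      naturalParameterization f (Icc a b) a u = f c :=
  ⟨_, by rw [← image_variationOnFromTo hab hf hc]; exact mem_image_of_mem _ hcab,
    edist_eq_zero.1 (edist_naturalParameterization_eq_zero hf.locallyBoundedVariationOn
      (left_mem_Icc.2 hab) hcab)⟩

end ArcLength

/-! ### The test function -/

open Classical in
/-- The weight `1 / t`, infinite at zero, and vanishing at the dyadic positions, over which the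
pillowcases lie. -/
def reciprocalWeight (t : ℝ) : ℝ≥0∞ :=
  if t ≤ 0 then ∞ else if t ∈ range Dyadic.pos then 0 else ENNReal.ofReal t⁻¹

theorem measurable_reciprocalWeight : Measurable reciprocalWeight := by
  refine Measurable.ite measurableSet_Iic measurable_const (Measurable.ite
    (countable_range Dyadic.pos).measurableSet measurable_const ?_)
  exact measurable_inv.ennreal_ofReal

theorem reciprocalWeight_of_nonpos {t : ℝ} (ht : t ≤ 0) : reciprocalWeight t = ∞ := if_pos ht

theorem reciprocalWeight_of_mem {t : ℝ} (ht : 0 < t) (h : t ∈ range Dyadic.pos) :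
    reciprocalWeight t = 0 := by
  rw [reciprocalWeight, if_neg ht.not_ge, if_pos h]

theorem reciprocalWeight_of_notMem {t : ℝ} (ht : 0 < t) (h : t ∉ range Dyadic.pos) :
    reciprocalWeight t = ENNReal.ofReal t⁻¹ := by
  rw [reciprocalWeight, if_neg ht.not_ge, if_neg h]

theorem lintegral_reciprocalWeight {t : ℝ} (ht : 0 < t) :
    ∫⁻ u in Ioc 0 t, reciprocalWeight u = ∞ := by
  have h1 : ∫⁻ u in Ioc 0 t, reciprocalWeight u = ∫⁻ u in Ioc 0 t, ENNReal.ofReal u⁻¹ := by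
    have h0 : ∀ᵐ u : ℝ, u ∉ range Dyadic.pos :=
      (countable_range Dyadic.pos).ae_notMem volume
    refine setLIntegral_congr_fun_ae measurableSet_Ioc ?_
    filter_upwards [h0] with u hu hu'
    exact reciprocalWeight_of_notMem hu'.1 hu
  rw [h1]
  by_contra hcon
  have h2 : IntegrableOn (fun u : ℝ => u⁻¹) (Ioc 0 t) := by
    refine ⟨measurable_inv.aestronglyMeasurable, ?_⟩
    rw [hasFiniteIntegral_iff_ofReal]
    · exact lt_top_iff_ne_top.2 hcon
    · filter_upwards [ae_restrict_mem measurableSet_Ioc] with u hu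
      exact inv_nonneg.2 hu.1.le
  have h3 := (intervalIntegrable_iff_integrableOn_Ioc_of_le ht.le).2 h2
  rw [intervalIntegrable_inv_iff] at h3
  exact h3.elim (fun h => ht.ne h) fun h => h left_mem_uIcc

/-- A `1`-Lipschitz function on an interval does not increase the Lebesgue measure, so if it
vanishes somewhere, then the integral of its weight diverges along with that of `1 / t`. -/
theorem lintegral_reciprocalWeight_comp {L : ℝ} (hL : 0 < L) {g : ℝ → ℝ}
    (hg : LipschitzOnWith 1 g (Icc 0 L)) (hg0 : ∀ u ∈ Icc 0 L, 0 ≤ g u)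
    {u₀ : ℝ} (hu₀ : u₀ ∈ Icc 0 L) (h0 : g u₀ = 0) :
    ∫⁻ u in Icc 0 L, reciprocalWeight (g u) = ∞ := by
  by_cases hall : ∀ u ∈ Icc 0 L, g u = 0
  · rw [setLIntegral_congr_fun (g := fun _ => ∞) measurableSet_Icc fun u hu =>
      reciprocalWeight_of_nonpos (hall u hu).le, setLIntegral_const, Real.volume_Icc, sub_zero]
    exact ENNReal.top_mul (by simpa using hL)
  · push Not at hall
    obtain ⟨u₁, hu₁, h1⟩ := hall
    have ht : 0 < g u₁ := lt_of_le_of_ne (hg0 u₁ hu₁) h1.symm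
    have hm : AEMeasurable g (volume.restrict (Icc 0 L)) :=
      hg.continuousOn.aemeasurable measurableSet_Icc
    have hle : volume.restrict (Ioc 0 (g u₁)) ≤ (volume.restrict (Icc 0 L)).map g := by
      refine Measure.le_iff.2 fun s hs => ?_
      rw [Measure.restrict_apply hs, Measure.map_apply_of_aemeasurable hm hs,
        Measure.restrict_apply' measurableSet_Icc, ← hausdorffMeasure_real]
      have hsub : s ∩ Ioc 0 (g u₁) ⊆ g '' (g ⁻¹' s ∩ Icc 0 L) := by
        rintro t ⟨hts, ht0, ht1⟩
        obtain ⟨u, hu, rfl⟩ := isPreconnected_Icc.intermediate_value hu₀ hu₁ hg.continuousOn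
          (show t ∈ Icc (g u₀) (g u₁) from ⟨h0.trans_le ht0.le, ht1⟩)
        exact ⟨u, ⟨hts, hu⟩, rfl⟩
      refine (measure_mono hsub).trans ?_
      simpa using (hg.mono inter_subset_right).hausdorffMeasure_image_le
        (zero_le_one (α := ℝ))
    have h2 := lintegral_mono' hle (le_refl reciprocalWeight)
    rw [lintegral_reciprocalWeight ht, lintegral_map' measurable_reciprocalWeight.aemeasurable hm] at h2
    exact top_le_iff.1 h2

theorem Surface.base_nonneg (x : Surface) : 0 ≤ x.base := by
  obtain ⟨x, rfl⟩ := Surface.surjective_mk x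
  rw [Surface.base_mk]
  exact x.base_mem.1

theorem Surface.base_cusp : cusp.base = 0 := by
  rw [cusp_eq, Surface.base_mk]; simp [Piece.base, tip]

/-- The test function on the product space: the weight of the first coordinate
of the surface component. -/
def testFunction (x : Space) : ℝ≥0∞ := reciprocalWeight x.fst.base

theorem measurable_testFunction : Measurable testFunction :=
  measurable_reciprocalWeight.comp
    (Surface.lipschitzWith_base.continuous.comp Space.continuous_fst).measurable

/-- Every nonconstant rectifiable curve through `E` has a compact subcurve along which the test
function has infinite integral. -/
theorem exists_lintegral_testFunction_eq_top {γ : MetricCurve Space}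
    (hγ : γ ∈ curvesMeeting cuspSet) (hr : γ.IsLocallyRectifiable) :
    ∃ a ∈ γ.domain, ∃ b ∈ γ.domain, a ≤ b ∧
      ∫⁻ u in Icc 0 (eVariationOn γ.toFun (Icc a b)).toReal,
        testFunction (naturalParameterization γ.toFun (Icc a b) a u) = ∞ := by
  obtain ⟨⟨p, hp, q, hq, hpq⟩, s, hs, hsE⟩ := hγ
  obtain ⟨t, ht, hst⟩ : ∃ t ∈ γ.domain, γ.toFun s ≠ γ.toFun t := by
    by_cases h : γ.toFun s = γ.toFun p
    · exact ⟨q, hq, h ▸ hpq⟩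
    · exact ⟨p, hp, h⟩
  have key : ∀ a ∈ γ.domain, ∀ b ∈ γ.domain, a ≤ b → s ∈ Icc a b → t ∈ Icc a b →
      ∃ a ∈ γ.domain, ∃ b ∈ γ.domain, a ≤ b ∧
        ∫⁻ u in Icc 0 (eVariationOn γ.toFun (Icc a b)).toReal,
          testFunction (naturalParameterization γ.toFun (Icc a b) a u) = ∞ := by
    intro a ha b hb hab hsab htab
    refine ⟨a, ha, b, hb, hab, ?_⟩
    have hsub : Icc a b ⊆ γ.domain := γ.ordConnected.out ha hb
    have hbv : BoundedVariationOn γ.toFun (Icc a b) := by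
      have := hr a b ha hb
      rwa [inter_eq_self_of_subset_right hsub] at this
    have hc := γ.continuousOn.mono hsub
    have hL : 0 < (eVariationOn γ.toFun (Icc a b)).toReal :=
      (dist_pos.2 hst).trans_le (hbv.dist_le hsab htab)
    obtain ⟨u, hu, huN⟩ := exists_naturalParameterization_eq hab hbv hc hsab
    refine lintegral_reciprocalWeight_comp (g := fun u =>
      (naturalParameterization γ.toFun (Icc a b) a u).fst.base) hL ?_
      (fun _ _ => Surface.base_nonneg _) hu ?_
    · refine LipschitzOnWith.of_dist_le_mul fun v hv w hw => ?_
      have h1 := (lipschitzOnWith_naturalParameterization hab hbv hc).dist_le_mul v hv w hw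
      exact ((Surface.abs_base_sub_le _ _).trans (Space.dist_fst_le _ _)).trans h1
    · simp only [huN]
      rw [(mem_cuspSet.1 hsE).1, Surface.base_cusp]
  rcases le_total s t with h | h
  · exact key s hs t ht h ⟨le_rfl, h⟩ ⟨h, le_rfl⟩
  · exact key t ht s hs h ⟨h, le_rfl⟩ ⟨le_rfl, h⟩

theorem hausdorffMeasure_shell_le {a b : ℝ} (hab : a ≤ b) :
    Measure.hausdorffMeasure 3
      {x : Space | x.fst.base ∈ Icc a b ∧ x.fst.base ∉ range Dyadic.pos} ≤
        ENNReal.ofReal (2048 * ((b - a) * profile b)) := by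
  have h1 := hausdorffMeasure_product_le Space.dist_le_add
    {x : Surface | x.base ∈ Icc a b ∧ x.base ∉ range Dyadic.pos} (by norm_num : (-2 : ℝ) < 2)
  have h2 := mul_le_mul_right (hausdorffMeasure_strip_le hab) (ENNReal.ofReal (64 * (2 - -2)))
  refine (measure_mono fun x hx => ?_).trans (h1.trans (h2.trans_eq ?_))
  · exact ⟨hx, x.snd.2.1.le, x.snd.2.2.le⟩
  · rw [← ENNReal.ofReal_mul (by norm_num)]; congr 1; ring

/-- On the dyadic shell `2⁻ᵏ⁻¹ < t ≤ 2⁻ᵏ` the cube of the test function is at most `8ᵏ⁺¹`, whereas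
the volume of the shell is of the order of `16⁻ᵏ`. -/
theorem lintegral_testFunction_ne_top :
    ∫⁻ x, testFunction x ^ (3 : ℝ) ∂(Measure.hausdorffMeasure 3 : Measure Space) ≠ ∞ := by
  set μ : Measure Space := Measure.hausdorffMeasure 3 with hμ
  set τ : Space → ℝ := fun x => x.fst.base with hτ
  have hτm : Measurable τ :=
    (Surface.lipschitzWith_base.continuous.comp Space.continuous_fst).measurable
  have hD : MeasurableSet (τ ⁻¹' range Dyadic.pos) :=
    hτm (countable_range Dyadic.pos).measurableSet
  set Z : Set Space := {x | τ x ∈ Icc 0 0 ∧ τ x ∉ range Dyadic.pos} with hZ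
  set B : ℕ → Set Space := fun k =>
    {x | τ x ∈ Ioc ((1 / 2 : ℝ) ^ (k + 1)) ((1 / 2) ^ k) ∧ τ x ∉ range Dyadic.pos} with hB
  have hBm : ∀ k, MeasurableSet (B k) := fun k => (hτm measurableSet_Ioc).inter hD.compl
  have hcover : (univ : Set Space) ⊆ Z ∪ τ ⁻¹' range Dyadic.pos ∪ ⋃ k, B k := by
    intro x _
    by_cases hx : τ x ∈ range Dyadic.pos
    · exact .inl (.inr hx)
    rcases (Surface.base_nonneg x.fst).eq_or_lt with h0 | h0
    · exact .inl (.inl ⟨⟨h0.le, h0.ge⟩, hx⟩)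
    · obtain ⟨y, hy⟩ := Surface.surjective_mk x.fst
      have h1 : τ x ≤ 1 := by
        simp only [hτ]; rw [← hy, Surface.base_mk]; exact y.base_mem.2.le
      obtain ⟨k, hk1, hk2⟩ := exists_nat_pow_near_of_lt_one h0 h1
        (by norm_num : (0 : ℝ) < 1 / 2) (by norm_num)
      exact .inr (mem_iUnion.2 ⟨k, ⟨hk1, hk2⟩, hx⟩)
  have hZ0 : ∫⁻ x in Z, testFunction x ^ (3 : ℝ) ∂μ = 0 := by
    refine setLIntegral_measure_zero _ _ (le_bot_iff.1 ((hausdorffMeasure_shell_le le_rfl).trans ?_))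
    simp
  have hD0 : ∫⁻ x in τ ⁻¹' range Dyadic.pos, testFunction x ^ (3 : ℝ) ∂μ = 0 := by
    rw [setLIntegral_congr_fun (g := fun _ => 0) hD fun x hx => ?_, lintegral_zero]
    obtain ⟨d, hd⟩ := id hx
    have : 0 < x.fst.base := d.pos_pos.trans_eq hd
    simp only [testFunction]
    rw [reciprocalWeight_of_mem this hx, ENNReal.zero_rpow_of_pos (by norm_num)]
  have hBk : ∀ k, ∫⁻ x in B k, testFunction x ^ (3 : ℝ) ∂μ ≤
      ENNReal.ofReal (2731 * (1 / 2) ^ k) := by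
    intro k
    have hpos : (0 : ℝ) < (1 / 2) ^ (k + 1) := by positivity
    have h1 : ∀ x ∈ B k, testFunction x ^ (3 : ℝ) ≤ ENNReal.ofReal (8 ^ (k + 1)) := by
      rintro x ⟨⟨hx1, hx2⟩, hx⟩
      have hx0 : 0 < x.fst.base := hpos.trans hx1
      simp only [testFunction]
      rw [reciprocalWeight_of_notMem hx0 hx,
        ENNReal.ofReal_rpow_of_nonneg (inv_nonneg.2 hx0.le) (by norm_num)]
      refine ENNReal.ofReal_le_ofReal ?_
      have h2 : (x.fst.base)⁻¹ ≤ 2 ^ (k + 1) := by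
        rw [inv_le_comm₀ hx0 (by positivity)]
        refine le_trans (le_of_eq ?_) hx1.le
        rw [one_div, inv_pow]
      calc (x.fst.base)⁻¹ ^ (3 : ℝ) = (x.fst.base)⁻¹ ^ 3 := by exact_mod_cast Real.rpow_natCast _ 3
        _ ≤ (2 ^ (k + 1)) ^ 3 := pow_le_pow_left₀ (inv_nonneg.2 hx0.le) h2 3
        _ = 8 ^ (k + 1) := by rw [← pow_mul, mul_comm, pow_mul]; norm_num
    have h2 : μ (B k) ≤ ENNReal.ofReal
        (2048 * (((1 / 2) ^ k - (1 / 2) ^ (k + 1)) * profile ((1 / 2) ^ k))) :=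
      (measure_mono fun x (hx : x ∈ B k) => show x.fst.base ∈ Icc ((1 / 2) ^ (k + 1)) ((1 / 2) ^ k) ∧
        x.fst.base ∉ range Dyadic.pos from ⟨Ioc_subset_Icc_self hx.1, hx.2⟩).trans (hausdorffMeasure_shell_le
        (pow_le_pow_of_le_one (by norm_num) (by norm_num) (Nat.le_succ k)))
    refine (setLIntegral_mono' (hBm k) h1).trans ?_
    rw [setLIntegral_const]
    refine (mul_le_mul_right h2 _).trans ?_
    rw [← ENNReal.ofReal_mul (by positivity)]
    refine ENNReal.ofReal_le_ofReal ?_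
    have h8 : (8 : ℝ) ^ k * ((1 / 2) ^ k) ^ 3 = 1 := by
      rw [← pow_mul, mul_comm k 3, pow_mul, ← mul_pow]; norm_num
    have : (8 : ℝ) ^ (k + 1) * (2048 * (((1 / 2) ^ k - (1 / 2) ^ (k + 1)) * profile ((1 / 2) ^ k)))
        = 8192 / 3 * (1 / 2) ^ k * (8 ^ k * ((1 / 2) ^ k) ^ 3) := by
      unfold profile; ring
    rw [this, h8, mul_one]
    exact mul_le_mul_of_nonneg_right (by norm_num) (by positivity)
  have hsum : ∑' k : ℕ, ENNReal.ofReal (2731 * (1 / 2) ^ k) ≠ ∞ :=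
    (summable_geometric_two.mul_left 2731).tsum_ofReal_ne_top
  rw [← setLIntegral_univ]
  refine ne_top_of_le_ne_top hsum ?_
  calc ∫⁻ x in univ, testFunction x ^ (3 : ℝ) ∂μ
      ≤ ∫⁻ x in Z ∪ τ ⁻¹' range Dyadic.pos ∪ ⋃ k, B k, testFunction x ^ (3 : ℝ) ∂μ :=
        lintegral_mono_set hcover
    _ ≤ 0 + 0 + ∑' k, ∫⁻ x in B k, testFunction x ^ (3 : ℝ) ∂μ :=
        (lintegral_union_le _ _ _).trans (add_le_add ((lintegral_union_le _ _ _).trans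
          (add_le_add hZ0.le hD0.le)) (lintegral_iUnion_le _ _))
    _ ≤ ∑' k : ℕ, ENNReal.ofReal (2731 * (1 / 2) ^ k) := by
        rw [zero_add, zero_add]
        exact ENNReal.tsum_le_tsum hBk

/-! ### Curves through the cusp -/

theorem curveModulus_mono {X : Type*} [MetricSpace X] [MeasurableSpace X] (μ : Measure X) (p : ℝ)
    {Γ Γ' : Set (MetricCurve X)} (h : Γ ⊆ Γ') : curveModulus μ p Γ ≤ curveModulus μ p Γ' :=
  le_iInf₂ fun ρ hρ => iInf₂_le ρ ⟨hρ.1, fun γ hγ => hρ.2 γ (h hγ)⟩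

theorem isAdmissible_smul_testFunction {c : ℝ≥0∞} (hc : c ≠ 0) (hc' : c ≠ ∞) :
    IsAdmissible (curvesMeeting cuspSet) fun x => c * testFunction x := by
  refine ⟨measurable_testFunction.const_mul c, fun γ hγ hr => ?_⟩
  obtain ⟨a, ha, b, hb, hab, h⟩ := exists_lintegral_testFunction_eq_top hγ hr
  refine le_trans ?_ (le_iSup₂_of_le a ha (le_iSup₂_of_le b hb (le_iSup_of_le hab le_rfl)))
  rw [lintegral_const_mul' c _ hc', h, ENNReal.mul_top hc]
  exact le_top

theorem curveModulus_curvesMeeting_cuspSet :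
    curveModulus (Measure.hausdorffMeasure 3) 3 (curvesMeeting cuspSet) = 0 := by
  set M := ∫⁻ x, testFunction x ^ (3 : ℝ) ∂(Measure.hausdorffMeasure 3 : Measure Space) with hM
  have hlim : Tendsto (fun n : ℕ => ((n : ℝ≥0∞)⁻¹) ^ (3 : ℝ) * M) atTop (𝓝 0) := by
    have h1 := ((ENNReal.continuous_rpow_const (y := 3)).tendsto 0).comp
      ENNReal.tendsto_inv_nat_nhds_zero
    rw [ENNReal.zero_rpow_of_pos (by norm_num)] at h1
    have h2 := ENNReal.Tendsto.mul_const h1 (.inr lintegral_testFunction_ne_top)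
    rwa [zero_mul] at h2
  refine le_bot_iff.1 (ge_of_tendsto hlim ?_)
  filter_upwards [eventually_ge_atTop 1] with n hn
  have h0 : (n : ℝ≥0∞)⁻¹ ≠ 0 := ENNReal.inv_ne_zero.2 (ENNReal.natCast_ne_top n)
  have h1 : (n : ℝ≥0∞)⁻¹ ≠ ∞ := ENNReal.inv_ne_top.2 (by exact_mod_cast (by lia : n ≠ 0))
  refine (iInf₂_le _ (isAdmissible_smul_testFunction h0 h1)).trans_eq ?_
  simp only [ENNReal.mul_rpow_of_nonneg _ _ (by norm_num : (0 : ℝ) ≤ 3)]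
  exact lintegral_const_mul _ (measurable_testFunction.pow_const 3)

theorem curvesJoining_subset_curvesMeeting {X : Type*} [MetricSpace X] {E F : Set X}
    (h : Disjoint E F) : curvesJoining E F ⊆ curvesMeeting E := by
  rintro γ ⟨⟨s, hs, hsE⟩, t, ht, htF⟩
  exact ⟨⟨s, hs, t, ht, fun hst => disjoint_left.1 h hsE (hst ▸ htF)⟩, s, hs, hsE⟩

end CuspExample

end

theorem theorem1p1 :
    IsAhlforsRegular 2 CuspExample.Surface ∧
    IsAhlforsRegular 3 CuspExample.Space ∧
    IsLinearlyLocallyConnected CuspExample.Space ∧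
    Nonempty (CuspExample.Space ≃ₜ EuclideanSpace ℝ (Fin 3)) ∧
    IsContinuumSet CuspExample.cuspSet ∧
    CuspExample.cuspSet.Nontrivial ∧
    curveModulus (Measure.hausdorffMeasure 3) 3 (curvesMeeting CuspExample.cuspSet) = 0 ∧
    ∀ F : Set CuspExample.Space, IsContinuumSet F → Disjoint CuspExample.cuspSet F →
      curveModulus (Measure.hausdorffMeasure 3) 3 (curvesJoining CuspExample.cuspSet F) = 0 := by
  refine ⟨CuspExample.isAhlforsRegular_surface, CuspExample.isAhlforsRegular_space,
    CuspExample.isLinearlyLocallyConnected_space, CuspExample.nonempty_homeomorph_space,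
    CuspExample.isContinuumSet_cuspSet, CuspExample.nontrivial_cuspSet,
    CuspExample.curveModulus_curvesMeeting_cuspSet, fun F _ hF => ?_⟩
  exact le_bot_iff.1 ((CuspExample.curveModulus_mono _ _
    (CuspExample.curvesJoining_subset_curvesMeeting hF)).trans
      CuspExample.curveModulus_curvesMeeting_cuspSet.le)
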